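/- **Calculus.** Fix sets of node names, channels, values and process constants $A$ (with arities), a first-order language of data expressions $e$ and boolean tests $b$ with an evaluation $[\![\cdot]\!]$ of closed ones, and for every constant a definition $A(\tilde x)\Leftarrow s$ with $s$ a state whose free variables are among $\tilde x$. Processes and states are $$p,q::=s\mid p\;{}_r\!\oplus q\ (r\in[0,1]),\qquad s,t::=c!\langle e\rangle.p\mid c?(x).p\mid\omega.0\mid s+t\mid\text{if }b\text{ then }s\text{ else }t\mid\tau.p\mid A(\tilde e)\mid 0,$$ and system terms are $M,N::=s[n]\mid M\,|\,N\mid 0$ with $s$ closed (code $s$ running at node $n$). A process denotes a distribution on states: $[\![s]\!]=\overline{s}$ (point distribution), $[\![p\;{}_r\!\oplus q]\!]=r[\![p]\!]+(1-r)[\![q]\!]$. Closed states have transitions $c!\langle e\rangle.p\xrightarrow{c![\![e]\!]}[\![p]\!]$, $c?(x).p\xrightarrow{c?v}[\![p\{v/x\}]\!]$, $\tau.p\xrightarrow{\tau}[\![p]\!]$; a sum has those of both summands, a conditional those of the branch selected by $[\![b]\!]$, and $A(\tilde e)$ those of $s\{\tilde e/\tilde x\}$. A connectivity graph $\Gamma$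 has a finite vertex set $\Gamma_V$ and an irreflexive edge relation on it; $m\to n$ means that $n$ can hear $m$. Relative to $\Gamma$: $s[n]$ does $n.c!v$ or $n.\tau$ when $s$ does $c!v$ or $\tau$; it does $m.c?v$, following a transition $s\xrightarrow{c?v}\Delta$ if $m\to n$, and staying unchanged if $s$ has no $c?v$ transition or $m\not\to n$; $0$ does $m.c?v$ unchanged; $M|N$ does $m.c?v$ if both components do, $m.c!v$ if one component does $m.c!v$ and the other $m.c?v$, and $m.\tau$ if one component does while the other is unchanged (component distributions are combined as products). Structural congruence $\equiv$ on states makes $(+,0)$ a commutative monoid and identifies a closed conditional with its selected branch and $A(\tilde e)$ with $s\{\tilde e/\tilde x\}$; on systems it makes $(|,0)$ a commutative monoid and contains $s[m]\equiv t[m]$ for $s\equiv t$. A system is *successful* if it is $\equiv M'\,|\,(\omega.0+s)[n]$ for some $M',s,n$. A (well-formed) network $\mathcal M=\Gamma\triangleright M$ is a graph with a system in which no node name occurs twice, all of whose nodes $\mathrm{nodes}(\mathcal M)$ lie in $\Gamma_V$, such that every edge has an end in $\mathrm{nodes}(\mathcal M)$ and every vertex without any edge lies in $\mathrm{nodes}(\mathcal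 M)$. The other vertices are external; $\mathrm{Inp}(\mathcal M)$, resp. $\mathrm{Outp}(\mathcal M)$, is the set of external nodes with an edge leaving, resp. entering, them. $\mathcal M\rhd\mathcal T=(\Gamma_M\cup\Gamma_T)\triangleright(M|T)$ is defined when $\mathrm{nodes}(\mathcal M)$ is disjoint from the vertex set of $\mathcal T$. **Probabilistic notions.** A sub-distribution has total mass at most $1$; $\varepsilon$ is the empty one. The lifting $\overline{\mathcal R}$ of a relation $\mathcal R$ between states and sub-distributions is the least relation on sub-distributions containing $(\overline s,\Theta)$ for $s\,\mathcal R\,\Theta$ and closed under $\sum_{i\in I}p_i\cdot(-)$, $I$ finite, $p_i\ge0$, $\sum_ip_i\le1$. A relation $\mathcal R$ between states is lifted through $s\,\mathcal R^e\,\overline t\iff s\,\mathcal R\,t$. Given a step relation from states to distributions and a success predicate, $\Delta\Rightarrow\Theta$ (hyper-derivation) means that there are sub-distributions $\Delta_k^{\to},\Delta_k^{\times}$ ($k\ge0$) with $\Delta=\Delta_0^{\to}+\Delta_0^{\times}$, lifted steps $\Delta_k^{\to}\to\Delta_{k+1}^{\to}+\Delta_{k+1}^{\times}$, no successful state in the support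 of any $\Delta_k^{\to}$, and $\Theta=\sum_k\Delta_k^{\times}$. It is *extreme* if moreover each state in the support of $\Theta$ that can step is successful. **May testing.** Let networks step by $\Gamma\triangleright M\to\Gamma\triangleright\Delta$ whenever $M$ has an $m.\tau$ or $m.c!v$ transition to $\Delta$. $\mathrm{Results}(\mathcal M)$ is the set of the probabilities $\Theta\{\text{successful}\}$, over all extreme derivatives $\Theta$ of $\overline{\mathcal M}$. $\mathcal M\sqsubseteq_{may}\mathcal N$ means that $\mathrm{Inp}$ and $\mathrm{Outp}$ of $\mathcal M$ and $\mathcal N$ coincide and, for each well-formed network $\mathcal T$ such that $\mathcal M\rhd\mathcal T$ and $\mathcal N\rhd\mathcal T$ are defined, every $p\in\mathrm{Results}(\mathcal M\rhd\mathcal T)$ has a $q\in\mathrm{Results}(\mathcal N\rhd\mathcal T)$ with $p\le q$. **Extensional actions.** Only networks that are not successful act. $\mathcal M\xrightarrow{\tau}$ is an $m.\tau$ transition, or an $n.c!v$ transition such that no external node hears $n$; $\mathcal M\xrightarrow{n.c?v}$ is an $n.c?v$ transition with $n\in\mathrm{Inp}(\mathcal M)$; $\mathcal M\xrightarrow{c!v\triangleright\eta}$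 is an $m.c!v$ transition where $\eta\ne\emptyset$ is the set of all output nodes that hear $m$. Weak actions: $\mathcal M\stackrel{\tau}{\Longrightarrow}\Delta$ is a hyper-derivation with respect to $\xrightarrow{\tau}$; $\mathcal M\stackrel{n.c?v}{\Longrightarrow}\Delta$ means $\overline{\mathcal M}\Rightarrow\xrightarrow{n.c?v}\Rightarrow\Delta$ (the middle step lifted); $\mathcal M\stackrel{c!v\triangleright\eta}{\Longrightarrow}\Delta$ is the least family containing $\overline{\mathcal M}\Rightarrow\xrightarrow{c!v\triangleright\eta}\Rightarrow\Delta$ and such that $\mathcal M\stackrel{c!v\triangleright\eta_1}{\Longrightarrow}\Delta'\stackrel{c!v\triangleright\eta_2}{\Longrightarrow}\Delta$ (the second one lifted) with $\eta_1\cap\eta_2=\emptyset$ gives $\mathcal M\stackrel{c!v\triangleright(\eta_1\cup\eta_2)}{\Longrightarrow}\Delta$. $\mathcal M$ is *deadlocked* if it is not successful and has no $\xrightarrow{\tau}$ and no $\xrightarrow{c!v\triangleright\eta}$ transition. The *divergence-free deadlock simulation* $\preceq_{DF}$ is the largest relation between well-formed networks such that $\mathcal M\preceq_{DF}\mathcal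 N$ implies: (i) if $\mathcal M$ is deadlocked, then $\mathcal N\stackrel{\tau}{\Longrightarrow}\Theta$ for some $\Theta$ whose support consists of deadlocked networks; (ii) if $\mathcal M\stackrel{\lambda}{\Longrightarrow}\Delta$ then $\mathcal N\stackrel{\lambda}{\Longrightarrow}\Theta$ for some $\Theta$ with $\Delta\,\overline{\preceq_{DF}^{\,e}}\,\Theta$. A network is *convergent* if no network $\mathcal L$ reachable from it by strong extensional transitions has $\mathcal L\stackrel{\tau}{\Longrightarrow}\varepsilon$. It is *proper* if $\omega$ occurs neither in its code nor in the definitions of the process constants which that code uses, directly or through other definitions. **Theorem.** Let $\mathcal M,\mathcal N$ be convergent, proper, well-formed networks with $\mathrm{Inp}(\mathcal M)=\mathrm{Inp}(\mathcal N)$ and $\mathrm{Outp}(\mathcal M)=\mathrm{Outp}(\mathcal N)$. If $\mathcal M\preceq_{DF}\mathcal N$, then $\mathcal M\sqsubseteq_{may}\mathcal N$. -/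

import Mathlib

open scoped ENNReal NNReal

namespace Wireless

universe u

/-! ## Sub-distributions, lifting, hyper-derivations -/

section Probability

/-- Sub-distributions over `S`. Full distributions are Mathlib's `PMF S`. -/
structure SubDist (S : Type u) where
  toFun : S → ℝ≥0∞
  mass_le_one : ∑' s, toFun s ≤ 1

namespace SubDist

variable {S : Type u}

instance : CoeFun (SubDist S) (fun _ => S → ℝ≥0∞) := ⟨SubDist.toFun⟩

/-- A full distribution, seen as a sub-distribution. -/
def ofPMF (μ : PMF S) : SubDist S := ⟨fun s => μ s, le_of_eq μ.tsum_coe⟩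

/-- The point distribution at `s`. -/
noncomputable def point (s : S) : SubDist S := ofPMF (PMF.pure s)

/-- The empty sub-distribution. -/
def empty : SubDist S := ⟨fun _ => 0, by simp⟩

def support (Δ : SubDist S) : Set S := {s | Δ s ≠ 0}

/-- The sub-distribution `∑ i, p i • Δ i`, for weights `p` of total at most one. -/
noncomputable def combine {I : Type} [Fintype I] (p : I → ℝ≥0∞) (hp : ∑ i, p i ≤ 1)
    (Δ : I → SubDist S) : SubDist S where
  toFun s := ∑ i, p i * Δ i s
  mass_le_one := by
    rw [Summable.tsum_finsetSum (fun _ _ => ENNReal.summable)]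
    refine le_trans (Finset.sum_le_sum fun i _ => ?_) hp
    rw [ENNReal.tsum_mul_left]
    exact mul_le_of_le_one_right' (Δ i).mass_le_one

theorem ext' {Δ Θ : SubDist S} (h : ∀ s, Δ s = Θ s) : Δ = Θ := by
  cases Δ; cases Θ; congr; exact funext h

end SubDist

variable {S : Type u}

/-- The lifting of a relation between states and sub-distributions to a relation between
sub-distributions, in explicit form: `Δ = ∑ i, p i • point (s i)` and `Θ = ∑ i, p i • Ξ i` with
`R (s i) (Ξ i)` for each `i` in a finite index set. That this is the least relation which extends
`R` and is closed under finite sub-convex combinations is `lift_closed` and `lift_least`. -/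
def Lift (R : S → SubDist S → Prop) (Δ Θ : SubDist S) : Prop :=
  ∃ (I : Type) (_ : Fintype I) (p : I → ℝ≥0∞) (hp : ∑ i, p i ≤ 1)
    (s : I → S) (Ξ : I → SubDist S), (∀ i, R (s i) (Ξ i)) ∧
      Δ = SubDist.combine p hp (fun i => SubDist.point (s i)) ∧ Θ = SubDist.combine p hp Ξ

/-- `T` extends `R` and is closed under finite sub-convex combinations. -/
structure LiftClosed (R : S → SubDist S → Prop) (T : SubDist S → SubDist S → Prop) : Prop where
  point : ∀ s Θ, R s Θ → T (SubDist.point s) Θ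
  sum : ∀ (I : Type) [Fintype I] (p : I → ℝ≥0∞) (hp : ∑ i, p i ≤ 1) (Δ Θ : I → SubDist S),
    (∀ i, T (Δ i) (Θ i)) → T (SubDist.combine p hp Δ) (SubDist.combine p hp Θ)

theorem lift_least {R : S → SubDist S → Prop} {T : SubDist S → SubDist S → Prop}
    (h : LiftClosed R T) {Δ Θ : SubDist S} (hl : Lift R Δ Θ) : T Δ Θ := by
  obtain ⟨I, _, p, hp, s, Ξ, hR, rfl, rfl⟩ := hl
  exact h.sum I p hp _ _ fun i => h.point _ _ (hR i)

theorem lift_closed (R : S → SubDist S → Prop) : LiftClosed R (Lift R) where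
  point s Θ h := by
    refine ⟨Unit, inferInstance, fun _ => 1, by simp, fun _ => s, fun _ => Θ, fun _ => h, ?_, ?_⟩
    · exact SubDist.ext' fun x => by simp [SubDist.combine]
    · exact SubDist.ext' fun x => by simp [SubDist.combine]
  sum I _ p hp Δ Θ h := by
    choose J inst q hq s Ξ hR hΔ hΘ using h
    have key : ∀ F : (i : I) → J i → SubDist S, ∀ x,
        ∑ i, p i * (∑ j, q i j * F i j x) = ∑ k : Sigma J, p k.1 * q k.1 k.2 * F k.1 k.2 x := by
      intro F x
      rw [Fintype.sum_sigma]
      exact Finset.sum_congr rfl fun i _ => by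
        rw [Finset.mul_sum]; exact Finset.sum_congr rfl fun j _ => by rw [mul_assoc]
    refine ⟨Sigma J, inferInstance, fun k => p k.1 * q k.1 k.2, ?_, fun k => s k.1 k.2,
      fun k => Ξ k.1 k.2, fun k => hR _ _, ?_, ?_⟩
    · rw [Fintype.sum_sigma]
      refine le_trans (Finset.sum_le_sum fun i _ => ?_) hp
      simp only [← Finset.mul_sum]
      exact mul_le_of_le_one_right' (hq i)
    · refine SubDist.ext' fun x => ?_
      simp only [SubDist.combine, hΔ]
      exact key (fun i j => SubDist.point (s i j)) x
    · refine SubDist.ext' fun x => ?_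
      simp only [SubDist.combine, hΘ]
      exact key Ξ x

/-- A transition relation from states to full distributions, seen as one to sub-distributions. -/
def toSub (r : S → PMF S → Prop) : S → SubDist S → Prop :=
  fun s Θ => ∃ μ, r s μ ∧ Θ = SubDist.ofPMF μ

/-- The relation `Rᵉ` between states and point distributions given by a relation on states. -/
def toPoint (R : S → S → Prop) : S → SubDist S → Prop :=
  fun s Θ => ∃ t, R s t ∧ Θ = SubDist.point t

/-- Testing structures; a pLTS gives one by keeping only its `τ`-transitions. -/
structure TestingStructure (S : Type u) where
  red : S → PMF S → Prop
  success : S → Prop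

namespace TestingStructure

variable (T : TestingStructure S)

/-- `Θ` is a hyper-derivative of `Δ`: at stage `k` the part `go k` takes one more step, while the
part `halt k` halts; only states that are not successful may go on. -/
def Hyper (Δ Θ : SubDist S) : Prop :=
  ∃ go halt : ℕ → SubDist S,
    (∀ s, Δ s = go 0 s + halt 0 s) ∧
    (∀ k, ∃ Λ, Lift (toSub T.red) (go k) Λ ∧ ∀ s, Λ s = go (k + 1) s + halt (k + 1) s) ∧
    (∀ k, ∀ s ∈ (go k).support, ¬ T.success s) ∧
    (∀ s, Θ s = ∑' k, halt k s)

/-- `Θ` is an extreme derivative of `Δ`. -/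
def Extreme (Δ Θ : SubDist S) : Prop :=
  T.Hyper Δ Θ ∧ ∀ s ∈ Θ.support, (∃ μ, T.red s μ) → T.success s

open Classical in
/-- The probability that a sub-distribution gives to success. -/
noncomputable def value (Δ : SubDist S) : ℝ≥0∞ := ∑' s, if T.success s then Δ s else 0

/-- The set of possible results from a sub-distribution. -/
def results (Δ : SubDist S) : Set ℝ≥0∞ := {p | ∃ Θ, T.Extreme Δ Θ ∧ p = T.value Θ}

end TestingStructure

/-- The Hoare preorder on sets of outcomes. -/
def HoareLE (O₁ O₂ : Set ℝ≥0∞) : Prop := ∀ p₁ ∈ O₁, ∃ p₂ ∈ O₂, p₁ ≤ p₂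

end Probability

/-! ## Syntax -/

/-- The vocabulary of the calculus: node names, channels, values, process constants with their
arities, and a language of data expressions and boolean tests, which is that of first-order terms
and atoms over arbitrary function and predicate symbols with a given interpretation in the values
(no law is imposed on it). -/
structure Sig where
  Node : Type u
  Chan : Type u
  Val : Type u
  Fn : Type u
  fnArity : Fn → ℕ
  fnEval : (f : Fn) → (Fin (fnArity f) → Val) → Val
  Pred : Type u
  predArity : Pred → ℕ
  predEval : (b : Pred) → (Fin (predArity b) → Val) → Bool
  Const : Type u
  arity : Const → ℕ

/-- Data expressions with variables among `x₀, …, xₙ₋₁` (de Bruijn indices). -/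
inductive Exp (C : Sig.{u}) : ℕ → Type u
  | var {n : ℕ} (i : Fin n) : Exp C n
  | val {n : ℕ} (v : C.Val) : Exp C n
  | app {n : ℕ} (f : C.Fn) (args : Fin (C.fnArity f) → Exp C n) : Exp C n

/-- A probability. -/
abbrev Prob := {r : ℝ≥0 // r ≤ 1}

mutual
/-- Probabilistic processes with free variables among `x₀, …, xₙ₋₁`. -/
inductive Proc (C : Sig.{u}) : ℕ → Type u
  | ret {n : ℕ} (s : State C n) : Proc C n
  | choice {n : ℕ} (r : Prob) (p q : Proc C n) : Proc C n
/-- States with free variables among `x₀, …, xₙ₋₁`; `recv` binds one variable, which becomes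
index `0` in its body. -/
inductive State (C : Sig.{u}) : ℕ → Type u
  | send {n : ℕ} (c : C.Chan) (e : Exp C n) (p : Proc C n) : State C n
  | recv {n : ℕ} (c : C.Chan) (p : Proc C (n + 1)) : State C n
  | omega {n : ℕ} : State C n
  | sum {n : ℕ} (s t : State C n) : State C n
  | branch {n : ℕ} (b : C.Pred) (args : Fin (C.predArity b) → Exp C n) (s t : State C n) :
      State C n
  | tau {n : ℕ} (p : Proc C n) : State C n
  | call {n : ℕ} (A : C.Const) (args : Fin (C.arity A) → Exp C n) : State C n
  | nil {n : ℕ} : State C n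
end

/-- System terms over closed states. -/
inductive Sys (C : Sig.{u}) : Type u
  | node (s : State C 0) (n : C.Node) : Sys C
  | par (M N : Sys C) : Sys C
  | nil : Sys C

/-- The definitions `A(x₀, …, xₖ₋₁) ⇐ s` of the process constants. -/
abbrev Env (C : Sig.{u}) := (A : C.Const) → State C (C.arity A)

variable {C : Sig.{u}}

/-! ### Substitution and evaluation -/

def Exp.rename {n m : ℕ} (ρ : Fin n → Fin m) : Exp C n → Exp C m
  | .var i => .var (ρ i)
  | .val v => .val v
  | .app f args => .app f fun i => (args i).rename ρ

def Exp.subst {n m : ℕ} (σ : Fin n → Exp C m) : Exp C n → Exp C m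
  | .var i => σ i
  | .val v => .val v
  | .app f args => .app f fun i => (args i).subst σ

/-- A substitution pushed under a binder. -/
def Exp.up {n m : ℕ} (σ : Fin n → Exp C m) : Fin (n + 1) → Exp C (m + 1) :=
  Fin.cons (.var 0) fun i => (σ i).rename Fin.succ

/-- The value of an expression under an assignment of values to its variables. -/
def Exp.evalWith {n : ℕ} (ρ : Fin n → C.Val) : Exp C n → C.Val
  | .var i => ρ i
  | .val v => v
  | .app f args => C.fnEval f fun i => (args i).evalWith ρ

/-- The value of a closed expression. -/
def Exp.eval (e : Exp C 0) : C.Val := e.evalWith Fin.elim0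

/-- The truth value of a closed boolean test. -/
def testEval (b : C.Pred) (args : Fin (C.predArity b) → Exp C 0) : Bool :=
  C.predEval b fun i => (args i).eval

mutual
def Proc.subst {n m : ℕ} (σ : Fin n → Exp C m) : Proc C n → Proc C m
  | .ret s => .ret (s.subst σ)
  | .choice r p q => .choice r (p.subst σ) (q.subst σ)
def State.subst {n m : ℕ} (σ : Fin n → Exp C m) : State C n → State C m
  | .send c e p => .send c (e.subst σ) (p.subst σ)
  | .recv c p => .recv c (p.subst (Exp.up σ))
  | .omega => .omega
  | .sum s t => .sum (s.subst σ) (t.subst σ)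
  | .branch b args s t => .branch b (fun i => (args i).subst σ) (s.subst σ) (t.subst σ)
  | .tau p => .tau (p.subst σ)
  | .call A args => .call A fun i => (args i).subst σ
  | .nil => .nil
end

/-- A coin that shows `true` with probability `r`. -/
noncomputable def coin (r : Prob) : PMF Bool :=
  PMF.ofFintype (fun b => cond b (r.1 : ℝ≥0∞) (1 - r.1)) (by
    have h : (r.1 : ℝ≥0∞) ≤ 1 := by exact_mod_cast r.2
    simp [add_tsub_cancel_of_le h])

/-- The distribution of states that a process denotes. -/
noncomputable def Proc.interp {n : ℕ} : Proc C n → PMF (State C n)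
  | .ret s => PMF.pure s
  | .choice r p q => (coin r).bind fun b => cond b p.interp q.interp

/-! ## Intensional semantics -/

/-- Actions of states. -/
inductive Act (C : Sig.{u}) : Type u
  | send (c : C.Chan) (v : C.Val) : Act C
  | recv (c : C.Chan) (v : C.Val) : Act C
  | tau : Act C

/-- Pre-semantics of closed states. -/
inductive StateStep (D : Env C) : State C 0 → Act C → PMF (State C 0) → Prop
  | send (c : C.Chan) (e : Exp C 0) (p : Proc C 0) :
      StateStep D (.send c e p) (.send c e.eval) p.interp
  | recv (c : C.Chan) (p : Proc C 1) (v : C.Val) :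
      StateStep D (.recv c p) (.recv c v) (p.subst fun _ => Exp.val v).interp
  | tau (p : Proc C 0) : StateStep D (.tau p) .tau p.interp
  | sumL {s t : State C 0} {α : Act C} {Δ : PMF (State C 0)} :
      StateStep D s α Δ → StateStep D (.sum s t) α Δ
  | sumR {s t : State C 0} {α : Act C} {Δ : PMF (State C 0)} :
      StateStep D t α Δ → StateStep D (.sum s t) α Δ
  | branchTrue {b : C.Pred} {args : Fin (C.predArity b) → Exp C 0} {s t : State C 0} {α : Act C}
      {Δ : PMF (State C 0)} : testEval b args = true → StateStep D s α Δ →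
      StateStep D (.branch b args s t) α Δ
  | branchFalse {b : C.Pred} {args : Fin (C.predArity b) → Exp C 0} {s t : State C 0} {α : Act C}
      {Δ : PMF (State C 0)} : testEval b args = false → StateStep D t α Δ →
      StateStep D (.branch b args s t) α Δ
  | call {A : C.Const} {args : Fin (C.arity A) → Exp C 0} {α : Act C} {Δ : PMF (State C 0)} :
      StateStep D ((D A).subst args) α Δ → StateStep D (.call A args) α Δ

/-- Connectivity graphs; `edge m n` says that `n` can detect the broadcasts of `m`. -/
structure Graph (C : Sig.{u}) : Type u where
  verts : Set C.Node
  finite : verts.Finite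
  edge : C.Node → C.Node → Prop
  edge_mem : ∀ m n, edge m n → m ∈ verts ∧ n ∈ verts
  irrefl : ∀ m, ¬ edge m m

/-- The union of two connectivity graphs. -/
def Graph.union (Γ₁ Γ₂ : Graph C) : Graph C where
  verts := Γ₁.verts ∪ Γ₂.verts
  finite := Γ₁.finite.union Γ₂.finite
  edge m n := Γ₁.edge m n ∨ Γ₂.edge m n
  edge_mem m n h := h.elim
    (fun h => ⟨Or.inl (Γ₁.edge_mem m n h).1, Or.inl (Γ₁.edge_mem m n h).2⟩)
    (fun h => ⟨Or.inr (Γ₂.edge_mem m n h).1, Or.inr (Γ₂.edge_mem m n h).2⟩)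
  irrefl m h := h.elim (Γ₁.irrefl m) (Γ₂.irrefl m)

/-- The node names of a system term, with repetitions. -/
def Sys.names : Sys C → List C.Node
  | .node _ n => [n]
  | .par M N => M.names ++ N.names
  | .nil => []

/-- The set of nodes of a system term. -/
def Sys.nodes (M : Sys C) : Set C.Node := {n | n ∈ M.names}

/-- Parallel composition of distributions of system terms. -/
noncomputable def parDist (Δ Θ : PMF (Sys C)) : PMF (Sys C) :=
  Δ.bind fun M => Θ.map fun N => Sys.par M N

/-- Actions of system terms. -/
inductive SysAct (C : Sig.{u}) : Type u
  | recv (m : C.Node) (c : C.Chan) (v : C.Val) : SysAct C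
  | send (m : C.Node) (c : C.Chan) (v : C.Val) : SysAct C
  | tau (m : C.Node) : SysAct C

/-- Intensional semantics of system terms relative to a connectivity graph. -/
inductive SysStep (D : Env C) (Γ : Graph C) : Sys C → SysAct C → PMF (Sys C) → Prop
  | broad {s : State C 0} {n : C.Node} {c : C.Chan} {v : C.Val} {Δ : PMF (State C 0)} :
      StateStep D s (.send c v) Δ →
      SysStep D Γ (.node s n) (.send n c v) (Δ.map fun t => .node t n)
  | hear {s : State C 0} {n m : C.Node} {c : C.Chan} {v : C.Val} {Δ : PMF (State C 0)} :
      StateStep D s (.recv c v) Δ → Γ.edge m n →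
      SysStep D Γ (.node s n) (.recv m c v) (Δ.map fun t => .node t n)
  | deaf {s : State C 0} {n m : C.Node} {c : C.Chan} {v : C.Val} :
      (¬ ∃ Δ, StateStep D s (.recv c v) Δ) →
      SysStep D Γ (.node s n) (.recv m c v) (PMF.pure (.node s n))
  | disc {s : State C 0} {n m : C.Node} {c : C.Chan} {v : C.Val} :
      ¬ Γ.edge m n → SysStep D Γ (.node s n) (.recv m c v) (PMF.pure (.node s n))
  | nil {m : C.Node} {c : C.Chan} {v : C.Val} :
      SysStep D Γ .nil (.recv m c v) (PMF.pure .nil)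
  | tau {s : State C 0} {n : C.Node} {Δ : PMF (State C 0)} :
      StateStep D s .tau Δ → SysStep D Γ (.node s n) (.tau n) (Δ.map fun t => .node t n)
  | tauPropL {M N : Sys C} {n : C.Node} {Δ : PMF (Sys C)} :
      SysStep D Γ M (.tau n) Δ → SysStep D Γ (.par M N) (.tau n) (parDist Δ (PMF.pure N))
  | tauPropR {M N : Sys C} {n : C.Node} {Δ : PMF (Sys C)} :
      SysStep D Γ N (.tau n) Δ → SysStep D Γ (.par M N) (.tau n) (parDist (PMF.pure M) Δ)
  | prop {M N : Sys C} {m : C.Node} {c : C.Chan} {v : C.Val} {Δ Θ : PMF (Sys C)} :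
      SysStep D Γ M (.recv m c v) Δ → SysStep D Γ N (.recv m c v) Θ →
      SysStep D Γ (.par M N) (.recv m c v) (parDist Δ Θ)
  | syncL {M N : Sys C} {m : C.Node} {c : C.Chan} {v : C.Val} {Δ Θ : PMF (Sys C)} :
      SysStep D Γ M (.send m c v) Δ → SysStep D Γ N (.recv m c v) Θ →
      SysStep D Γ (.par M N) (.send m c v) (parDist Δ Θ)
  | syncR {M N : Sys C} {m : C.Node} {c : C.Chan} {v : C.Val} {Δ Θ : PMF (Sys C)} :
      SysStep D Γ M (.recv m c v) Δ → SysStep D Γ N (.send m c v) Θ →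
      SysStep D Γ (.par M N) (.send m c v) (parDist Δ Θ)

/-! ## Structural congruence and success -/

/-- Structural congruence of closed states. -/
inductive StateCongr (D : Env C) : State C 0 → State C 0 → Prop
  | refl (s : State C 0) : StateCongr D s s
  | symm {s t : State C 0} : StateCongr D s t → StateCongr D t s
  | trans {s t r : State C 0} : StateCongr D s t → StateCongr D t r → StateCongr D s r
  | sum {s s' t t' : State C 0} : StateCongr D s s' → StateCongr D t t' →
      StateCongr D (.sum s t) (.sum s' t')
  | comm (s t : State C 0) : StateCongr D (.sum s t) (.sum t s)
  | assoc (s t r : State C 0) : StateCongr D (.sum (.sum s t) r) (.sum s (.sum t r))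
  | unit (s : State C 0) : StateCongr D (.sum s .nil) s
  | branchTrue {b : C.Pred} {args : Fin (C.predArity b) → Exp C 0} (s t : State C 0) :
      testEval b args = true → StateCongr D (.branch b args s t) s
  | branchFalse {b : C.Pred} {args : Fin (C.predArity b) → Exp C 0} (s t : State C 0) :
      testEval b args = false → StateCongr D (.branch b args s t) t
  | call (A : C.Const) (args : Fin (C.arity A) → Exp C 0) :
      StateCongr D (.call A args) ((D A).subst args)

/-- Structural congruence of system terms. -/
inductive SysCongr (D : Env C) : Sys C → Sys C → Prop
  | refl (M : Sys C) : SysCongr D M M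
  | symm {M N : Sys C} : SysCongr D M N → SysCongr D N M
  | trans {M N L : Sys C} : SysCongr D M N → SysCongr D N L → SysCongr D M L
  | par {M M' N N' : Sys C} : SysCongr D M M' → SysCongr D N N' →
      SysCongr D (.par M N) (.par M' N')
  | comm (M N : Sys C) : SysCongr D (.par M N) (.par N M)
  | assoc (M N L : Sys C) : SysCongr D (.par (.par M N) L) (.par M (.par N L))
  | unit (M : Sys C) : SysCongr D (.par M .nil) M
  | node {s t : State C 0} (m : C.Node) : StateCongr D s t → SysCongr D (.node s m) (.node t m)

/-- The success predicate: the clause `ω` is enabled at some node. -/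
def Sys.Success (D : Env C) (M : Sys C) : Prop :=
  ∃ (M' : Sys C) (s : State C 0) (n : C.Node), SysCongr D M (.par M' (.node (.sum .omega s) n))

/-! ## Networks -/

/-- A connectivity graph together with a system term; see `IsNet`. -/
structure Net (C : Sig.{u}) : Type u where
  graph : Graph C
  sys : Sys C

namespace Net

variable (M : Net C)

/-- The interface: the external nodes. -/
def interface : Set C.Node := M.graph.verts \ M.sys.nodes

/-- The input nodes. -/
def inp : Set C.Node := {i | i ∈ M.interface ∧ ∃ m, M.graph.edge i m}

/-- The output nodes. -/
def outp : Set C.Node := {o | o ∈ M.interface ∧ ∃ m, M.graph.edge m o}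

/-- The well-formed networks: no node name occurs twice in the system term, all its nodes are in
the graph, each connection involves an internal node, and each external node is connected to some
node. -/
structure IsNet : Prop where
  nodup : M.sys.names.Nodup
  nodes_subset : M.sys.nodes ⊆ M.graph.verts
  conn : ∀ m n, M.graph.edge m n ∨ M.graph.edge n m → m ∈ M.sys.nodes ∨ n ∈ M.sys.nodes
  external : ∀ m ∈ M.graph.verts, (¬ ∃ n, M.graph.edge m n ∨ M.graph.edge n m) → m ∈ M.sys.nodes

/-- The composite `M ⊳ P` (to be used when `M.CompDefined P`). -/
def comp (P : Net C) : Net C := ⟨M.graph.union P.graph, .par M.sys P.sys⟩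

/-- `M ⊳ P` is defined. -/
def CompDefined (P : Net C) : Prop := Disjoint M.sys.nodes P.graph.verts

def Success (D : Env C) : Prop := M.sys.Success D

end Net

/-! ## May testing -/

/-- The testing structure of networks: reductions are internal moves and broadcasts. -/
def netTS (D : Env C) : TestingStructure (Net C) where
  red M μ := ∃ Δ : PMF (Sys C), μ = Δ.map (Net.mk M.graph) ∧
    ((∃ m ∈ M.sys.nodes, SysStep D M.graph M.sys (.tau m) Δ) ∨
      ∃ m c v, SysStep D M.graph M.sys (.send m c v) Δ)
  success M := M.Success D

/-- The may-testing preorder, on well-formed networks with equal input and output nodes. -/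
structure MayLE (D : Env C) (M₁ M₂ : Net C) : Prop where
  isNet_left : M₁.IsNet
  isNet_right : M₂.IsNet
  inp_eq : M₁.inp = M₂.inp
  outp_eq : M₁.outp = M₂.outp
  results_le : ∀ T : Net C, T.IsNet → M₁.CompDefined T → M₂.CompDefined T →
    HoareLE ((netTS D).results (SubDist.point (M₁.comp T)))
      ((netTS D).results (SubDist.point (M₂.comp T)))

/-! ## Extensional semantics -/

/-- Extensional actions. -/
inductive ExtAct (C : Sig.{u}) : Type u
  | tau : ExtAct C
  | inp (n : C.Node) (c : C.Chan) (v : C.Val) : ExtAct C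
  | out (c : C.Chan) (v : C.Val) (η : Set C.Node) : ExtAct C

/-- Strong extensional transitions of networks. -/
inductive ExtStep (D : Env C) (M : Net C) : ExtAct C → PMF (Net C) → Prop
  | tau {m : C.Node} {Δ : PMF (Sys C)} : ¬ M.Success D → SysStep D M.graph M.sys (.tau m) Δ →
      ExtStep D M .tau (Δ.map (Net.mk M.graph))
  | hidden {n : C.Node} {c : C.Chan} {v : C.Val} {Δ : PMF (Sys C)} : ¬ M.Success D →
      SysStep D M.graph M.sys (.send n c v) Δ →
      (∀ m, M.graph.edge n m → m ∈ M.sys.nodes) →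
      ExtStep D M .tau (Δ.map (Net.mk M.graph))
  | inp {n : C.Node} {c : C.Chan} {v : C.Val} {Δ : PMF (Sys C)} : ¬ M.Success D →
      SysStep D M.graph M.sys (.recv n c v) Δ → n ∈ M.inp →
      ExtStep D M (.inp n c v) (Δ.map (Net.mk M.graph))
  | out {m : C.Node} {c : C.Chan} {v : C.Val} {η : Set C.Node} {Δ : PMF (Sys C)} :
      ¬ M.Success D → SysStep D M.graph M.sys (.send m c v) Δ →
      η = {n | n ∈ M.outp ∧ M.graph.edge m n} → η.Nonempty →
      ExtStep D M (.out c v η) (Δ.map (Net.mk M.graph))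

/-- The internal part of the extensional pLTS of networks. -/
def extTS (D : Env C) : TestingStructure (Net C) where
  red M μ := ExtStep D M .tau μ
  success M := M.Success D

/-- A hyper-derivation, then one (lifted) strong action `lam`, then a hyper-derivation. -/
def HyperStep (D : Env C) (M : Net C) (lam : ExtAct C) (Δ : SubDist (Net C)) : Prop :=
  ∃ Δ₁ Δ₂, (extTS D).Hyper (SubDist.point M) Δ₁ ∧
    Lift (toSub fun N μ => ExtStep D N lam μ) Δ₁ Δ₂ ∧ (extTS D).Hyper Δ₂ Δ

/-- Weak output actions. In `multi` the second weak output is lifted to sub-distributions (the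
lifting is written out: see `Lift`). -/
inductive WeakOut (D : Env C) (c : C.Chan) (v : C.Val) :
    Net C → Set C.Node → SubDist (Net C) → Prop
  | single {M : Net C} {η : Set C.Node} {Δ : SubDist (Net C)} :
      HyperStep D M (.out c v η) Δ → WeakOut D c v M η Δ
  | multi {M : Net C} {η₁ η₂ : Set C.Node} {Δ' : SubDist (Net C)} (I : Type) [Fintype I]
      (p : I → ℝ≥0∞) (hp : ∑ i, p i ≤ 1) (N : I → Net C) (Ξ : I → SubDist (Net C)) :
      WeakOut D c v M η₁ Δ' → Δ' = SubDist.combine p hp (fun i => SubDist.point (N i)) →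
      (∀ i, WeakOut D c v (N i) η₂ (Ξ i)) → η₁ ∩ η₂ = ∅ →
      WeakOut D c v M (η₁ ∪ η₂) (SubDist.combine p hp Ξ)

/-- Weak extensional actions. -/
def WeakStep (D : Env C) (M : Net C) : ExtAct C → SubDist (Net C) → Prop
  | .tau, Δ => (extTS D).Hyper (SubDist.point M) Δ
  | .inp n c v, Δ => HyperStep D M (.inp n c v) Δ
  | .out c v η, Δ => WeakOut D c v M η Δ

/-- Deadlocked networks. -/
structure Deadlocked (D : Env C) (M : Net C) : Prop where
  not_success : ¬ M.Success D
  no_tau : ¬ ∃ μ, ExtStep D M .tau μ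
  no_out : ∀ c v η, ¬ ∃ μ, ExtStep D M (.out c v η) μ

/-- The two requirements on a divergence-free deadlock simulation `R` between well-formed
networks. -/
structure IsDFDeadlockSim (D : Env C) (R : Net C → Net C → Prop) : Prop where
  isNet : ∀ M N, R M N → M.IsNet ∧ N.IsNet
  deadlock : ∀ M N, R M N → Deadlocked D M →
    ∃ Θ, WeakStep D N .tau Θ ∧ ∀ L ∈ Θ.support, Deadlocked D L
  step : ∀ M N, R M N → ∀ lam Δ, WeakStep D M lam Δ →
    ∃ Θ, WeakStep D N lam Θ ∧ Lift (toPoint R) Δ Θ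

/-- The largest divergence-free deadlock simulation: `DFDeadlockSim D M N` says that each weak
move of `M` is matched by `N`. -/
def DFDeadlockSim (D : Env C) (M N : Net C) : Prop := ∃ R, IsDFDeadlockSim D R ∧ R M N

theorem isDFDeadlockSim_dfDeadlockSim (D : Env C) :
    IsDFDeadlockSim D (DFDeadlockSim D) where
  isNet := fun _ _ ⟨_, hR, h⟩ => hR.isNet _ _ h
  deadlock := fun _ _ ⟨_, hR, h⟩ => hR.deadlock _ _ h
  step := fun _ _ ⟨R, hR, h⟩ lam Δ hΔ => by
    obtain ⟨Θ, hΘ, I, inst, p, hp, s, Ξ, hs, h1, h2⟩ := hR.step _ _ h lam Δ hΔ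
    exact ⟨Θ, hΘ, I, inst, p, hp, s, Ξ,
      fun i => (hs i).imp fun t ht => ⟨⟨R, hR, ht.1⟩, ht.2⟩, h1, h2⟩

/-! ## Convergent and proper networks -/

/-- One step in the pLTS generated by a network with its strong extensional transitions. -/
def Reduces (D : Env C) (M N : Net C) : Prop := ∃ lam μ, ExtStep D M lam μ ∧ N ∈ μ.support

/-- No state of the pLTS generated by `M` can diverge. -/
def Convergent (D : Env C) (M : Net C) : Prop :=
  ∀ N, Relation.ReflTransGen (Reduces D) M N →
    ¬ (extTS D).Hyper (SubDist.point N) SubDist.empty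

mutual
/-- `ω` does not occur in the process, and all its process constants are in `K`. -/
def Proc.OmegaFree (K : Set C.Const) {n : ℕ} : Proc C n → Prop
  | .ret s => s.OmegaFree K
  | .choice _ p q => p.OmegaFree K ∧ q.OmegaFree K
/-- `ω` does not occur in the state, and all its process constants are in `K`. -/
def State.OmegaFree (K : Set C.Const) {n : ℕ} : State C n → Prop
  | .send _ _ p => p.OmegaFree K
  | .recv _ p => p.OmegaFree K
  | .omega => False
  | .sum s t => s.OmegaFree K ∧ t.OmegaFree K
  | .branch _ _ s t => s.OmegaFree K ∧ t.OmegaFree K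
  | .tau p => p.OmegaFree K
  | .call A _ => A ∈ K
  | .nil => True
end

def Sys.OmegaFree (K : Set C.Const) : Sys C → Prop
  | .node s _ => s.OmegaFree K
  | .par M N => M.OmegaFree K ∧ N.OmegaFree K
  | .nil => True

/-- The clause `ω` occurs neither in the code of `M` nor in the definitions of the process
constants which that code uses, directly or through other definitions. -/
def Proper (D : Env C) (M : Net C) : Prop :=
  ∃ K : Set C.Const, (∀ A ∈ K, (D A).OmegaFree K) ∧ M.sys.OmegaFree K

end Wireless

-- The argument has a half about the calculus and a half about probability, which meet in
-- `IsMaySim`: a relation that preserves success and for which each strong step `a → μ` of a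
-- non-successful state is answered, from every related `b`, by a hyper-derivation whose result
-- dominates a coupling of `μ` along the relation (`Reach`).
--
-- The calculus (`isMaySim_compositeRel`). A step of a composite is a move of one component alone or
-- a broadcast across. An internal move of the left component is answered by a hyper-derivation at
-- which the tester stands by. A broadcast of the left component is an output to the set η of
-- external nodes that hear it; the answer may consist of several broadcasts with disjoint audiences
-- that make up η, and the tester can receive the value in instalments, because reception at
-- disjoint sets of nodes factorises (`Hears.split`). A broadcast of the tester is an input of the
-- left component if its sender is an input node, and is not heard by it otherwise. Left components
-- are free of ω, so success is a matter of the tester's term. An answer can be cut short only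
-- because the tester succeeds half-way; the answering composite is then successful already, and the
-- relation accepts it as it is.
--
-- The probability (`IsMaySim.hoareLE`). Let `opt b` be the supremum of the success probabilities
-- from `b`, and `lowerOpt a` the infimum of `opt b` over the states `b` which simulate `a`. The
-- latter is superharmonic and bounds the indicator of success, so each result `p` of `a` satisfies
-- `p ≤ lowerOpt a ≤ opt b`. If `p < opt b`, some hyper-derivation from `b` does better. If `p = opt
-- b`, the supremum has to be attained. Replaying the derivation of `a` step by step is not enough:
-- infinitely many steps of `a` may be answered while `b` stays put, and the answers that pile up
-- can call for an infinite mixture of transitions, whereas lifted steps are finite combinations.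
--
-- The way out (`IsMaySim.opt_attained`) is to work with finite horizons. A derivation that attains
-- a superharmonic bound uses only transitions which conserve it, and with these the bound is
-- approached within finite horizons at every state that is met (`exists_conserving_core`). A
-- finite-horizon strategy can be replayed (`IsMaySim.exists_round`); by conservation no optimal
-- value is lost, and the states reached are again tight, meaning that their `opt` equals the
-- `lowerOpt` of a state that is met. Thus a round from a tight state earns at least half of its
-- `opt` and retains the rest. Rounds which each take at least one step are concatenated by
-- convolution in time into one hyper-derivation (`exists_iterate`), and n rounds leave at most a
-- fraction 2⁻ⁿ unearned (`le_pair_of_rounds`). Finally a hyper-derivation extends to an extreme one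
-- without loss of success (`RHyper.exists_extreme`).
--
-- Measures are plain functions into `ℝ≥0∞`, so that sums, mixtures and expected numbers of visits
-- need no mass bound; `hyper_iff` leads back to sub-distributions.

open scoped ENNReal NNReal

namespace Wireless
universe u v w

/-! ## Unbounded measures as functions -/

section Measures

variable {S : Type u}

/-- The point mass at `s`, as a function. -/
noncomputable def dirac (s : S) : S → ℝ≥0∞ := ⇑(PMF.pure s)

/-- The integral of `f` against `g`. -/
noncomputable def pair (g f : S → ℝ≥0∞) : ℝ≥0∞ := ∑' s, g s * f s

/-- The mixture of the family `g` with weights `y`. -/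
noncomputable def mix {Y : Type v} (y : Y → ℝ≥0∞) (g : Y → S → ℝ≥0∞) : S → ℝ≥0∞ :=
  fun t => ∑' s, y s * g s t

theorem dirac_self (s : S) : dirac s s = 1 := by simp [dirac]

theorem dirac_of_ne {s t : S} (h : t ≠ s) : dirac s t = 0 := by simp [dirac, h]

theorem eq_of_dirac_ne_zero {s t : S} (h : dirac s t ≠ 0) : t = s := by
  by_contra hne
  exact h (dirac_of_ne hne)

theorem pair_dirac (s : S) (f : S → ℝ≥0∞) : pair (dirac s) f = f s := by
  unfold pair
  rw [tsum_eq_single s fun t ht => by rw [dirac_of_ne ht, zero_mul], dirac_self, one_mul]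

theorem pair_zero (f : S → ℝ≥0∞) : pair 0 f = 0 := by simp [pair]

theorem pair_add (g h f : S → ℝ≥0∞) : pair (g + h) f = pair g f + pair h f := by
  simp only [pair, Pi.add_apply, add_mul]
  exact ENNReal.tsum_add

theorem pair_smul (c : ℝ≥0∞) (g f : S → ℝ≥0∞) : pair (c • g) f = c * pair g f := by
  simp only [pair, Pi.smul_apply, smul_eq_mul, mul_assoc]
  exact ENNReal.tsum_mul_left

theorem pair_mul_right (c : ℝ≥0∞) (g f : S → ℝ≥0∞) :
    pair g (fun s => c * f s) = c * pair g f := by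
  simp only [pair]
  rw [← ENNReal.tsum_mul_left]
  exact tsum_congr fun s => by ring

theorem pair_mono {g g' f f' : S → ℝ≥0∞} (hg : ∀ s, g s ≤ g' s)
    (hf : ∀ s, g s ≠ 0 → f s ≤ f' s) : pair g f ≤ pair g' f' := by
  refine ENNReal.tsum_le_tsum fun s => ?_
  by_cases h : g s = 0
  · simp [h]
  · exact mul_le_mul' (hg s) (hf s h)

theorem pair_mix {Y : Type v} (y : Y → ℝ≥0∞) (g : Y → S → ℝ≥0∞) (f : S → ℝ≥0∞) :
    pair (mix y g) f = pair y fun s => pair (g s) f := by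
  simp only [pair, mix, ← ENNReal.tsum_mul_right, ← ENNReal.tsum_mul_left, mul_assoc]
  exact ENNReal.tsum_comm

theorem pair_tsum (h : ℕ → S → ℝ≥0∞) (f : S → ℝ≥0∞) :
    pair (fun s => ∑' k, h k s) f = ∑' k, pair (h k) f := by
  simp only [pair, ← ENNReal.tsum_mul_right]
  exact ENNReal.tsum_comm

theorem mix_dirac (y : S → ℝ≥0∞) : mix y dirac = y := by
  funext t
  unfold mix
  rw [tsum_eq_single t fun s hs => by rw [dirac_of_ne (Ne.symm hs), mul_zero], dirac_self, mul_one]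

theorem mix_of_dirac {Y : Type v} (a : Y) (g : Y → S → ℝ≥0∞) : mix (dirac a) g = g a := by
  funext t
  exact pair_dirac a fun s => g s t

theorem mix_congr {Y : Type v} {y : Y → ℝ≥0∞} {g g' : Y → S → ℝ≥0∞}
    (h : ∀ s, y s ≠ 0 → g s = g' s) : mix y g = mix y g' := by
  funext t
  refine tsum_congr fun s => ?_
  by_cases hs : y s = 0
  · simp [hs]
  · rw [h s hs]

theorem mix_add_right {Y : Type v} (y : Y → ℝ≥0∞) (g h : Y → S → ℝ≥0∞) :
    mix y (g + h) = mix y g + mix y h := by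
  funext t
  simp only [mix, Pi.add_apply, mul_add]
  exact ENNReal.tsum_add

theorem mix_add_left {Y : Type v} (y z : Y → ℝ≥0∞) (g : Y → S → ℝ≥0∞) :
    mix (y + z) g = mix y g + mix z g := by
  funext t
  simp only [mix, Pi.add_apply, add_mul]
  exact ENNReal.tsum_add

theorem mix_smul_left {Y : Type v} (c : ℝ≥0∞) (y : Y → ℝ≥0∞) (g : Y → S → ℝ≥0∞) :
    mix (c • y) g = c • mix y g := by
  funext t
  simp only [mix, Pi.smul_apply, smul_eq_mul, mul_assoc]
  exact ENNReal.tsum_mul_left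

theorem mix_mix {Y : Type v} {Z : Type w} (y : Y → ℝ≥0∞) (g : Y → Z → ℝ≥0∞)
    (h : Z → S → ℝ≥0∞) : mix (mix y g) h = mix y fun s => mix (g s) h := by
  funext t
  exact pair_mix y g fun z => h z t

theorem mix_eq_sum {Y : Type v} {y : Y → ℝ≥0∞} (hy : y.support.Finite) (g : Y → S → ℝ≥0∞) :
    mix y g = ∑ s ∈ hy.toFinset, y s • g s := by
  funext t
  rw [Finset.sum_apply]
  exact tsum_eq_sum fun s hs => by
    have : y s = 0 := by simpa using hs
    simp [this]

theorem mix_ne_zero {Y : Type v} {y : Y → ℝ≥0∞} {g : Y → S → ℝ≥0∞} {t : S} :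
    mix y g t ≠ 0 ↔ ∃ s, y s ≠ 0 ∧ g s t ≠ 0 := by
  simp [mix, ENNReal.tsum_eq_zero]

/-- A strict inequality at one point of positive finite weight would make the integrals differ, as
the smaller one is finite. This is how equality of values is turned into equality at individual
states. -/
theorem pair_eq_of_le {g f f' : S → ℝ≥0∞} (hle : ∀ s, g s ≠ 0 → f s ≤ f' s)
    (heq : pair g f' ≤ pair g f) (hfin : pair g f ≠ ⊤) (hg : ∀ s, g s ≠ ⊤) {s : S}
    (hs : g s ≠ 0) : f s = f' s := by
  refine le_antisymm (hle s hs) ?_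
  by_contra hlt
  rw [not_le] at hlt
  refine absurd heq (not_le.2 ?_)
  refine ENNReal.tsum_lt_tsum hfin (fun t => ?_) (i := s)
    ((ENNReal.mul_lt_mul_iff_right hs (hg s)).2 hlt)
  by_cases ht : g t = 0
  · simp [ht]
  · exact mul_le_mul_right (hle t ht) _

end Measures

/-! ## Lifted steps and derivations of unbounded measures -/

/-- The lifting of `r` to unbounded measures with finite support. -/
inductive RStep {S : Type u} (r : S → PMF S → Prop) : (S → ℝ≥0∞) → (S → ℝ≥0∞) → Prop
  | zero : RStep r 0 0
  | cons {g l : S → ℝ≥0∞} (c : ℝ≥0∞) {s : S} {μ : PMF S} : r s μ → RStep r g l →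
      RStep r (g + c • dirac s) (l + c • ⇑μ)

namespace RStep

variable {S : Type u} {r : S → PMF S → Prop}

theorem single (c : ℝ≥0∞) {s : S} {μ : PMF S} (h : r s μ) :
    RStep r (c • dirac s) (c • ⇑μ) := by
  simpa using RStep.cons c h RStep.zero

theorem one {s : S} {μ : PMF S} (h : r s μ) : RStep r (dirac s) ⇑μ := by
  simpa using RStep.single 1 h

theorem add {g l g' l' : S → ℝ≥0∞} (h : RStep r g l) (h' : RStep r g' l') :
    RStep r (g + g') (l + l') := by
  induction h' with
  | zero => simpa using h
  | cons c hr _ ih => simpa only [← add_assoc] using RStep.cons c hr ih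

theorem smul {g l : S → ℝ≥0∞} (c : ℝ≥0∞) (h : RStep r g l) : RStep r (c • g) (c • l) := by
  induction h with
  | zero => simpa using RStep.zero
  | cons d hr _ ih => simpa only [smul_add, smul_smul] using RStep.cons (c * d) hr ih

theorem sum {Y : Type v} (t : Finset Y) {g l : Y → S → ℝ≥0∞} (h : ∀ y ∈ t, RStep r (g y) (l y)) :
    RStep r (∑ y ∈ t, g y) (∑ y ∈ t, l y) := by
  classical
  induction t using Finset.induction_on with
  | empty => simpa using RStep.zero
  | insert a t ha ih =>
    rw [Finset.sum_insert ha, Finset.sum_insert ha]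
    exact (h a (Finset.mem_insert_self a t)).add
      (ih fun y hy => h y (Finset.mem_insert_of_mem hy))

theorem mix {Y : Type v} {y : Y → ℝ≥0∞} (hy : y.support.Finite) {g l : Y → S → ℝ≥0∞}
    (h : ∀ s, y s ≠ 0 → RStep r (g s) (l s)) :
    RStep r (Wireless.mix y g) (Wireless.mix y l) := by
  rw [mix_eq_sum hy, mix_eq_sum hy]
  exact RStep.sum _ fun s hs => (h s (by simpa using hs)).smul _

theorem mono {r' : S → PMF S → Prop} (hr : ∀ s μ, r s μ → r' s μ) {g l : S → ℝ≥0∞}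
    (h : RStep r g l) : RStep r' g l := by
  induction h with
  | zero => exact .zero
  | cons c h _ ih => exact .cons c (hr _ _ h) ih

/-- A bound for single transitions integrates over the source. With `U = W` it is monotonicity of a
superharmonic function along lifted steps; distinct `U` and `W` serve the recursion of `payoff` over
horizons. -/
theorem pair_le {U W : S → ℝ≥0∞} (hU : ∀ s μ, r s μ → pair ⇑μ W ≤ U s) {g l : S → ℝ≥0∞}
    (h : RStep r g l) : pair l W ≤ pair g U := by
  induction h with
  | zero => simp [pair_zero]
  | cons c hr _ ih =>
    rw [pair_add, pair_add, pair_smul, pair_smul, pair_dirac]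
    gcongr
    exact hU _ _ hr

theorem le_pair {U W : S → ℝ≥0∞} (hU : ∀ s μ, r s μ → U s ≤ pair ⇑μ W) {g l : S → ℝ≥0∞}
    (h : RStep r g l) : pair g U ≤ pair l W := by
  induction h with
  | zero => simp [pair_zero]
  | cons c hr _ ih =>
    rw [pair_add, pair_add, pair_smul, pair_smul, pair_dirac]
    gcongr
    exact hU _ _ hr

theorem pair_one (μ : PMF S) : pair ⇑μ (fun _ => 1) = 1 := by
  simp [pair, μ.tsum_coe]

theorem tsum_eq {g l : S → ℝ≥0∞} (h : RStep r g l) : ∑' s, l s = ∑' s, g s := by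
  have h1 := h.pair_le (U := fun _ => 1) (W := fun _ => 1) fun s μ _ => (pair_one μ).le
  have h2 := h.le_pair (U := fun _ => 1) (W := fun _ => 1) fun s μ _ => (pair_one μ).ge
  simpa [pair] using le_antisymm h1 h2

theorem finite_right (hfin : ∀ s μ, r s μ → μ.support.Finite) {g l : S → ℝ≥0∞}
    (h : RStep r g l) : l.support.Finite := by
  induction h with
  | zero => simp
  | @cons g l c s μ hr _ ih =>
    refine (ih.union (hfin _ _ hr)).subset fun t ht => ?_
    by_contra hn
    simp only [Set.mem_union, Function.mem_support, PMF.mem_support_iff, not_or, not_not] at hn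
    exact ht (by simp [hn.1, hn.2])

/-- A lifted step restricts to every reweighting of its source, linearly in the weights. -/
theorem exists_kernel {g l : S → ℝ≥0∞} (h : RStep r g l) :
    ∃ κ : S → S → ℝ≥0∞, (∀ t, ∑' s, κ s t = l t) ∧
      ∀ φ : S → ℝ≥0∞, RStep r (fun s => φ s * g s) (Wireless.mix φ κ) := by
  induction h with
  | zero =>
    refine ⟨fun _ _ => 0, by simp, fun φ => ?_⟩
    convert RStep.zero (r := r) using 1 <;> funext t <;> simp [Wireless.mix]
  | @cons g l c s μ hr _ ih =>
    obtain ⟨κ, h1, h2⟩ := ih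
    -- `κ x t` is the mass that the step carries from `x` to `t`; a transition adds to the row of
    -- its source.
    refine ⟨fun x t => κ x t + c * dirac s x * μ t, fun t => ?_, fun φ => ?_⟩
    · rw [ENNReal.tsum_add, h1]
      simp only [Pi.add_apply, Pi.smul_apply, smul_eq_mul]
      congr 1
      rw [tsum_eq_single s fun x hx => by simp [dirac_of_ne hx], dirac_self, mul_one]
    · convert RStep.cons (φ s * c) hr (h2 φ) using 1
      · funext x
        by_cases hx : x = s
        · subst hx; simp [dirac_self, mul_add]
        · simp [dirac_of_ne hx]
      · funext t
        simp only [Wireless.mix, Pi.add_apply, Pi.smul_apply, smul_eq_mul, mul_add]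
        rw [ENNReal.tsum_add]
        congr 1
        rw [tsum_eq_single s fun x hx => by simp [dirac_of_ne hx], dirac_self, mul_one, mul_assoc]

/-- A lifted step uses only transitions from its source's support to its target's support. -/
theorem restrict {g l : S → ℝ≥0∞} (h : RStep r g l) : ∀ {g' l' : S → ℝ≥0∞}, (∀ s, g s ≤ g' s) →
    (∀ s, l s ≤ l' s) →
    RStep (fun s μ => r s μ ∧ g' s ≠ 0 ∧ ∀ t ∈ μ.support, l' t ≠ 0) g l := by
  induction h with
  | zero => intros; exact .zero
  | @cons g l c s μ hr _ ih =>
    intro g' l' hg hl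
    have ih' := ih (g' := g') (l' := l') (fun s => le_trans (by simp) (hg s))
      (fun s => le_trans (by simp) (hl s))
    -- A transition of weight zero need not satisfy the restriction, but it contributes nothing and
    -- can be dropped.
    by_cases hc : c = 0
    · subst hc; simpa using ih'
    · refine .cons c ⟨hr, ?_, fun t ht => ?_⟩ ih'
      · refine ne_of_gt (lt_of_lt_of_le ?_ (hg s))
        simp [dirac_self, pos_iff_ne_zero, hc]
      · refine ne_of_gt (lt_of_lt_of_le ?_ (hl t))
        have : μ t ≠ 0 := ht
        simp [pos_iff_ne_zero, hc, this]

/-- If a superharmonic function has the same integral before and after a lifted step, then only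
transitions which conserve it are used. -/
theorem conserving {U : S → ℝ≥0∞} (hU : ∀ s μ, r s μ → pair ⇑μ U ≤ U s) {g l : S → ℝ≥0∞}
    (h : RStep r g l) (heq : pair g U ≤ pair l U) (hfin : pair g U ≠ ⊤) :
    RStep (fun s μ => r s μ ∧ pair ⇑μ U = U s) g l := by
  induction h with
  | zero => exact .zero
  | @cons g l c s μ hr hgl ih =>
    rw [pair_add, pair_add, pair_smul, pair_smul, pair_dirac] at heq
    rw [pair_add, pair_smul, pair_dirac] at hfin
    have hfin' := ENNReal.add_ne_top.1 hfin
    have h1 : pair l U ≤ pair g U := hgl.pair_le hU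
    have h2 : c * pair ⇑μ U ≤ c * U s := by gcongr; exact hU _ _ hr
    -- Neither summand can gain and the total does not lose, so neither summand loses; finiteness
    -- allows the cancellation.
    have hg : pair g U ≤ pair l U := by
      by_contra hlt
      exact absurd heq (not_le.2 (ENNReal.add_lt_add_of_lt_of_le
        (ne_top_of_le_ne_top hfin'.2 h2) (not_le.1 hlt) h2))
    have hs : c * U s ≤ c * pair ⇑μ U := by
      by_contra hlt
      exact absurd heq (not_le.2 (ENNReal.add_lt_add_of_le_of_lt
        (ne_top_of_le_ne_top hfin'.1 h1) h1 (not_le.1 hlt)))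
    have ih' := ih hg hfin'.1
    by_cases hc : c = 0
    · subst hc; simpa using ih'
    · by_cases hct : c = ⊤
      · subst hct
        have hUs : U s = 0 := by
          by_contra hne
          exact hfin'.2 (ENNReal.top_mul hne)
        have : pair ⇑μ U = U s := le_antisymm (hU _ _ hr) (by rw [hUs]; exact zero_le)
        exact .cons _ ⟨hr, this⟩ ih'
      · exact .cons c ⟨hr, le_antisymm (hU _ _ hr) ((ENNReal.mul_le_mul_iff_right hc hct).1 hs)⟩ ih'

end RStep

end Wireless
namespace Wireless
universe u v w

-- Convolution in time of arrivals with processes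

section Convolution

variable {S : Type u} {Y : Type v}

/-- The convolution in time of the arrivals `y` with the family of processes `g`. -/
noncomputable def conv (y : ℕ → Y → ℝ≥0∞) (g : Y → ℕ → S → ℝ≥0∞) (n : ℕ) : S → ℝ≥0∞ :=
  ∑ x ∈ Finset.HasAntidiagonal.antidiagonal n, mix (y x.1) fun s => g s x.2

theorem conv_zero (y : ℕ → Y → ℝ≥0∞) (g : Y → ℕ → S → ℝ≥0∞) :
    conv y g 0 = mix (y 0) fun s => g s 0 := by
  simp [conv]

theorem conv_succ (y : ℕ → Y → ℝ≥0∞) (g : Y → ℕ → S → ℝ≥0∞) (n : ℕ) :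
    conv y g (n + 1) = (mix (y (n + 1)) fun s => g s 0) + conv y (fun s m => g s (m + 1)) n := by
  unfold conv
  rw [Finset.Nat.sum_antidiagonal_succ', add_comm]

theorem conv_add (y : ℕ → Y → ℝ≥0∞) (g h : Y → ℕ → S → ℝ≥0∞) (n : ℕ) :
    conv y (g + h) n = conv y g n + conv y h n := by
  unfold conv
  rw [← Finset.sum_add_distrib]
  exact Finset.sum_congr rfl fun x _ => mix_add_right (y x.1) (fun s => g s x.2) fun s => h s x.2

theorem conv_ne_zero {y : ℕ → Y → ℝ≥0∞} {g : Y → ℕ → S → ℝ≥0∞} {n : ℕ} {t : S}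
    (h : conv y g n t ≠ 0) : ∃ i j s, y i s ≠ 0 ∧ g s j t ≠ 0 := by
  unfold conv at h
  rw [Finset.sum_apply] at h
  obtain ⟨x, -, hx⟩ := Finset.exists_ne_zero_of_sum_ne_zero h
  obtain ⟨s, h1, h2⟩ := mix_ne_zero.1 hx
  exact ⟨x.1, x.2, s, h1, h2⟩

/-- Tonelli: summed over all times, the starting time and the age of a copy range independently. -/
theorem tsum_conv (y : ℕ → Y → ℝ≥0∞) (g : Y → ℕ → S → ℝ≥0∞) :
    (fun t => ∑' n, conv y g n t) = mix (fun s => ∑' n, y n s) fun s t => ∑' m, g s m t := by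
  funext t
  have h1 : ∀ n, conv y g n t =
      ∑' x : Finset.HasAntidiagonal.antidiagonal n, mix (y x.1.1) (fun s => g s x.1.2) t := fun n => by
    unfold conv
    rw [Finset.sum_apply, Finset.tsum_subtype (Finset.HasAntidiagonal.antidiagonal n)
      fun x => mix (y x.1) (fun s => g s x.2) t]
  simp only [h1]
  rw [← ENNReal.tsum_sigma (fun n (x : Finset.HasAntidiagonal.antidiagonal n) =>
    mix (y x.1.1) (fun s => g s x.1.2) t)]
  rw [← Finset.HasAntidiagonal.sigmaAntidiagonalEquivProd.symm.tsum_eq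
    (fun x : Σ n : ℕ, Finset.HasAntidiagonal.antidiagonal n => mix (y x.2.1.1) (fun s => g s x.2.1.2) t)]
  simp only [Finset.HasAntidiagonal.sigmaAntidiagonalEquivProd_symm_apply_snd_coe]
  rw [ENNReal.tsum_prod (f := fun a b => mix (y a) (fun s => g s b) t)]
  simp only [mix]
  calc ∑' (a : ℕ) (b : ℕ) (s : Y), y a s * g s b t
      = ∑' (a : ℕ) (s : Y) (b : ℕ), y a s * g s b t :=
        tsum_congr fun a => ENNReal.tsum_comm
    _ = ∑' (s : Y) (a : ℕ) (b : ℕ), y a s * g s b t := ENNReal.tsum_comm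
    _ = _ := tsum_congr fun s => by
        simp only [ENNReal.tsum_mul_left, ENNReal.tsum_mul_right]

end Convolution

-- Hyper-derivations of unbounded measures and their composition

section Derivations

variable {S : Type u}

/-- A derivation between unbounded measures, given by what goes on and what halts at each stage. -/
structure Der (T : TestingStructure S) (go halt : ℕ → S → ℝ≥0∞) : Prop where
  step : ∀ k, RStep T.red (go k) (go (k + 1) + halt (k + 1))
  not_success : ∀ k s, go k s ≠ 0 → ¬ T.success s

/-- Hyper-derivations between unbounded measures. -/
def RHyper (T : TestingStructure S) (Δ Θ : S → ℝ≥0∞) : Prop :=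
  ∃ go halt : ℕ → S → ℝ≥0∞, Der T go halt ∧ Δ = go 0 + halt 0 ∧ Θ = fun s => ∑' k, halt k s

/-- Each transition leads to a finitely supported distribution. -/
def FinRed (T : TestingStructure S) : Prop := ∀ s μ, T.red s μ → μ.support.Finite

variable {T : TestingStructure S}

theorem Der.smul {go halt : ℕ → S → ℝ≥0∞} (h : Der T go halt) (c : ℝ≥0∞) :
    Der T (fun k => c • go k) fun k => c • halt k where
  step k := by simpa only [smul_add] using (h.step k).smul c
  not_success k s hs := h.not_success k s fun h0 => hs (by simp [h0])

theorem Der.finite (hT : FinRed T) {go halt : ℕ → S → ℝ≥0∞} (h : Der T go halt)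
    (h0 : (go 0 + halt 0).support.Finite) (k : ℕ) : (go k + halt k).support.Finite := by
  cases k with
  | zero => exact h0
  | succ k => exact (h.step k).finite_right hT

theorem finite_of_add_left {g h : S → ℝ≥0∞} (hf : (g + h).support.Finite) : g.support.Finite :=
  hf.subset fun s hs h0 => hs (by simpa using (add_eq_zero.1 h0).1)

theorem finite_of_add_right {g h : S → ℝ≥0∞} (hf : (g + h).support.Finite) : h.support.Finite :=
  finite_of_add_left (by rwa [add_comm] at hf)

/-- Copies of the derivation of `s` started at time `i` with weight `y i s` run superposed; at time
`n` they are at stage `n - i`. The target contains only what comes from time `n`; the arrivals at `n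
+ 1` have to be added by whoever uses this. -/
theorem Der.conv {Y : Type v} {y : ℕ → Y → ℝ≥0∞} {go halt : Y → ℕ → S → ℝ≥0∞}
    (hy : ∀ n, (y n).support.Finite) (h : ∀ n s, y n s ≠ 0 → Der T (go s) (halt s)) (n : ℕ) :
    RStep T.red (conv y go n) ((conv y (fun s m => go s (m + 1)) n) +
      conv y (fun s m => halt s (m + 1)) n) := by
  rw [← conv_add]
  exact RStep.sum _ fun x _ => RStep.mix (hy x.1) fun s hs => (h x.1 s hs).step x.2

theorem RHyper.refl (Δ : S → ℝ≥0∞) : RHyper T Δ Δ := by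
  refine ⟨fun _ => 0, fun k => if k = 0 then Δ else 0, ⟨fun k => ?_, fun k s h => ?_⟩, ?_, ?_⟩
  · simpa using RStep.zero
  · exact absurd rfl h
  · simp
  · funext s
    rw [tsum_eq_single 0 fun k hk => by simp [hk]]
    simp

theorem RHyper.of_step {Δ Λ : S → ℝ≥0∞} (h : RStep T.red Δ Λ)
    (hs : ∀ s, Δ s ≠ 0 → ¬ T.success s) : RHyper T Δ Λ := by
  refine ⟨fun k => if k = 0 then Δ else 0, fun k => if k = 1 then Λ else 0,
    ⟨fun k => ?_, fun k s h => ?_⟩, ?_, ?_⟩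
  · cases k with
    | zero => simpa using h
    | succ k => simpa using RStep.zero
  · cases k with
    | zero => exact hs s (by simpa using h)
    | succ k => simp at h
  · simp
  · funext s
    rw [tsum_eq_single 1 fun k hk => by simp [hk]]
    simp

theorem RHyper.smul {Δ Θ : S → ℝ≥0∞} (c : ℝ≥0∞) (h : RHyper T Δ Θ) :
    RHyper T (c • Δ) (c • Θ) := by
  obtain ⟨go, halt, hD, rfl, rfl⟩ := h
  refine ⟨_, _, hD.smul c, by simp, ?_⟩
  funext s
  simp [ENNReal.tsum_mul_left]

theorem RHyper.add {Δ Θ Δ' Θ' : S → ℝ≥0∞} (h : RHyper T Δ Θ) (h' : RHyper T Δ' Θ') :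
    RHyper T (Δ + Δ') (Θ + Θ') := by
  obtain ⟨go, halt, hD, rfl, rfl⟩ := h
  obtain ⟨go', halt', hD', rfl, rfl⟩ := h'
  refine ⟨fun k => go k + go' k, fun k => halt k + halt' k, ⟨fun k => ?_, fun k s hs => ?_⟩, ?_, ?_⟩
  · have := (hD.step k).add (hD'.step k)
    rwa [add_add_add_comm] at this
  · by_cases h0 : go k s = 0
    · exact hD'.not_success k s fun h1 => hs (by simp [h0, h1])
    · exact hD.not_success k s h0
  · exact add_add_add_comm _ _ _ _
  · funext s
    simp [ENNReal.tsum_add]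

theorem RHyper.sum {Y : Type v} (t : Finset Y) {Δ Θ : Y → S → ℝ≥0∞}
    (h : ∀ y ∈ t, RHyper T (Δ y) (Θ y)) : RHyper T (∑ y ∈ t, Δ y) (∑ y ∈ t, Θ y) := by
  classical
  induction t using Finset.induction_on with
  | empty => simpa using RHyper.refl 0
  | insert a t ha ih =>
    rw [Finset.sum_insert ha, Finset.sum_insert ha]
    exact (h a (Finset.mem_insert_self a t)).add
      (ih fun y hy => h y (Finset.mem_insert_of_mem hy))

theorem RHyper.mix_left {Y : Type v} {y : Y → ℝ≥0∞} (hy : y.support.Finite) {Δ Θ : Y → S → ℝ≥0∞}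
    (h : ∀ s, y s ≠ 0 → RHyper T (Δ s) (Θ s)) : RHyper T (mix y Δ) (mix y Θ) := by
  rw [mix_eq_sum hy, mix_eq_sum hy]
  exact RHyper.sum _ fun s hs => (h s (by simpa using hs)).smul _

/-- Hyper-derivations compose. -/
theorem RHyper.trans_kernel (hT : FinRed T) {Δ Θ : S → ℝ≥0∞} (hΔ : Δ.support.Finite)
    (h : RHyper T Δ Θ) {F : S → S → ℝ≥0∞} (hF : ∀ s, Θ s ≠ 0 → RHyper T (dirac s) (F s)) :
    RHyper T Δ (mix Θ F) := by
  classical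
  obtain ⟨go, halt, hD, rfl, rfl⟩ := h
  have hfin := hD.finite hT hΔ
  choose! g h hgh h0 hsum using hF
  have hne : ∀ n s, halt n s ≠ 0 → (∑' k, halt k s) ≠ 0 := fun n s hs h0 =>
    hs (ENNReal.tsum_eq_zero.1 h0 n)
  have hstart : ∀ n, ((mix (halt n) fun s => g s 0) + mix (halt n) fun s => h s 0) = halt n := by
    intro n
    rw [← mix_add_right]
    exact (mix_congr fun s hs => (h0 s (hne n s hs)).symm).trans (mix_dirac _)
  -- Mass that halts at stage `i` enters stage 0 of its own derivation at that same time, so no step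
  -- is lost at the junction.
  refine ⟨fun k => go k + conv halt g k, fun k => conv halt h k, ⟨fun k => ?_, fun k s hs => ?_⟩,
    ?_, ?_⟩
  · have h1 := (hD.step k).add (Der.conv (y := halt) (go := g) (halt := h)
      (fun n => finite_of_add_right (hfin n)) (fun n s hs => hgh s (hne n s hs)) k)
    convert h1 using 1
    rw [conv_succ, conv_succ]
    nth_rewrite 3 [← hstart (k + 1)]
    abel
  · by_cases hz : go k s = 0
    · obtain ⟨i, j, x, hx, hs'⟩ := conv_ne_zero (y := halt) (g := g) (n := k) (t := s)
        (fun h1 => hs (by simp [hz, h1]))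
      exact (hgh x (hne i x hx)).not_success j s hs'
    · exact hD.not_success k s hz
  · change _ = go 0 + conv halt g 0 + conv halt h 0
    rw [conv_zero, conv_zero, add_assoc, hstart]
  · rw [tsum_conv]
    exact mix_congr fun s hs => hsum s hs

end Derivations

end Wireless
namespace Wireless
universe u v w

-- Superharmonic bounds on the payoff of a derivation

section Values

variable {S : Type u} {T : TestingStructure S}

open Classical in
/-- The indicator function of success. -/
noncomputable def TestingStructure.ind (T : TestingStructure S) (s : S) : ℝ≥0∞ :=
  if T.success s then 1 else 0

theorem ind_of_success {s : S} (h : T.success s) : T.ind s = 1 := if_pos h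

theorem ind_of_not_success {s : S} (h : ¬ T.success s) : T.ind s = 0 := if_neg h

theorem ind_le_one (s : S) : T.ind s ≤ 1 := by
  unfold TestingStructure.ind; split_ifs <;> simp

theorem value_eq_pair (Δ : SubDist S) : T.value Δ = pair Δ T.ind := by
  unfold TestingStructure.value pair TestingStructure.ind
  exact tsum_congr fun s => by split_ifs <;> simp

theorem Der.step_of_not_success {go halt : ℕ → S → ℝ≥0∞} (h : Der T go halt) (k : ℕ) :
    RStep (fun s μ => T.red s μ ∧ ¬ T.success s) (go k) (go (k + 1) + halt (k + 1)) :=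
  ((h.step k).restrict (fun _ => le_rfl) fun _ => le_rfl).mono
    fun s _ hs => ⟨hs.1, h.not_success k s hs.2.1⟩

/-- A superharmonic function bounds the payoff of each derivation. -/
theorem Der.potential {U f : S → ℝ≥0∞}
    (hU : ∀ s μ, ¬ T.success s → T.red s μ → pair ⇑μ U ≤ U s) (hf : ∀ s, f s ≤ U s)
    {go halt : ℕ → S → ℝ≥0∞} (h : Der T go halt) (n : ℕ) :
    ∑ k ∈ Finset.range n, pair (halt k) f + pair (go n + halt n) U ≤
      pair (go 0 + halt 0) U := by
  induction n with
  | zero => simp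
  | succ n ih =>
    refine le_trans ?_ ih
    -- What halts at stage `n` is cashed in at `f ≤ U`; what goes on keeps at most its potential.
    rw [Finset.sum_range_succ, add_assoc]
    gcongr
    rw [pair_add (go n), add_comm]
    gcongr
    · exact (h.step_of_not_success n).pair_le fun s μ hs => hU s μ hs.2 hs.1
    · exact pair_mono (fun _ => le_rfl) fun s _ => hf s

theorem Der.tsum_le {U f : S → ℝ≥0∞}
    (hU : ∀ s μ, ¬ T.success s → T.red s μ → pair ⇑μ U ≤ U s) (hf : ∀ s, f s ≤ U s)
    {go halt : ℕ → S → ℝ≥0∞} (h : Der T go halt) :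
    ∑' k, pair (halt k) f ≤ pair (go 0 + halt 0) U := by
  rw [ENNReal.tsum_eq_iSup_nat]
  exact iSup_le fun n => le_trans le_self_add (h.potential hU hf n)

theorem RHyper.pair_le {U f : S → ℝ≥0∞}
    (hU : ∀ s μ, ¬ T.success s → T.red s μ → pair ⇑μ U ≤ U s) (hf : ∀ s, f s ≤ U s)
    {Δ Θ : S → ℝ≥0∞} (h : RHyper T Δ Θ) : pair Θ f ≤ pair Δ U := by
  obtain ⟨go, halt, hD, rfl, rfl⟩ := h
  rw [pair_tsum]
  exact hD.tsum_le hU hf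

theorem Der.mass_le {go halt : ℕ → S → ℝ≥0∞} (h : Der T go halt) (n : ℕ) :
    ∑' s, (go n + halt n) s ≤ ∑' s, (go 0 + halt 0) s := by
  have := h.potential (U := fun _ => 1) (f := fun _ => 1)
    (fun _ μ _ _ => (RStep.pair_one μ).le) (fun _ => le_rfl) n
  have := le_trans le_add_self this
  simpa [pair] using this

theorem RHyper.mass_le {Δ Θ : S → ℝ≥0∞} (h : RHyper T Δ Θ) : ∑' s, Θ s ≤ ∑' s, Δ s := by
  have := h.pair_le (U := fun _ => 1) (f := fun _ => 1)
    (fun _ μ _ _ => (RStep.pair_one μ).le) fun _ => le_rfl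
  simpa [pair] using this

theorem tsum_dirac (s : S) : ∑' t, dirac s t = 1 := (PMF.pure s).tsum_coe

theorem ne_top_of_tsum {g : S → ℝ≥0∞} (h : ∑' s, g s ≤ 1) (s : S) : g s ≠ ⊤ :=
  ne_top_of_le_ne_top ENNReal.one_ne_top (le_trans (ENNReal.le_tsum s) h)

theorem support_dirac_finite (s : S) : (dirac s).support.Finite :=
  (Set.finite_singleton s).subset fun _ ht => eq_of_dirac_ne_zero ht

/-- Membership in a set which is closed under transitions is preserved by derivations. -/
theorem RHyper.closed {P : S → Prop}
    (hP : ∀ s μ, P s → ¬ T.success s → T.red s μ → ∀ t ∈ μ.support, P t)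
    {Δ Θ : S → ℝ≥0∞} (h : RHyper T Δ Θ) (hΔ : ∀ s, Δ s ≠ 0 → P s) : ∀ s, Θ s ≠ 0 → P s := by
  classical
  -- The indicator of the complement of `P` is superharmonic, so no mass can leave `P`.
  have := h.pair_le (U := fun s => if P s then 0 else 1) (f := fun s => if P s then 0 else 1)
    (fun s μ hs hr => ?_) fun _ => le_rfl
  · have h0 : pair Δ (fun s => if P s then 0 else 1) = 0 := by
      refine ENNReal.tsum_eq_zero.2 fun s => ?_
      by_cases hs : Δ s = 0
      · simp [hs]
      · simp [hΔ s hs]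
    rw [h0, nonpos_iff_eq_zero] at this
    intro s hs
    have h1 := ENNReal.tsum_eq_zero.1 this s
    by_contra hn
    simp [hn, hs] at h1
  · by_cases hs' : P s
    · simp only [hs', if_true, nonpos_iff_eq_zero]
      refine ENNReal.tsum_eq_zero.2 fun t => ?_
      by_cases ht : μ t = 0
      · simp [ht]
      · simp [hP s μ hs' hs hr t ht]
    · simp only [hs', if_false]
      refine le_trans (pair_mono (fun _ => le_rfl) (f' := fun _ => 1) fun t _ => ?_)
        (RStep.pair_one μ).le
      split_ifs <;> simp

end Values

-- Decomposing a hyper-derivation along its source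

section Splitting

variable {S : Type u} {T : TestingStructure S}

/-- The part of a derivation which descends from the initial state `s`. -/
noncomputable def descend (tot : ℕ → S → ℝ≥0∞) (κ : ℕ → S → S → ℝ≥0∞) (s : S) : ℕ → S → ℝ≥0∞
  | 0 => dirac s
  | k + 1 => mix (fun t => descend tot κ s k t / tot k t) (κ k)

/-- A hyper-derivation splits along the states of its source. -/
theorem RHyper.split {Δ Θ : S → ℝ≥0∞} (h : RHyper T Δ Θ) (hΔ : ∑' s, Δ s ≤ 1) :
    ∃ F : S → S → ℝ≥0∞, (∀ s, Δ s ≠ 0 → RHyper T (dirac s) (F s)) ∧ Θ = mix Δ F := by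
  obtain ⟨go, halt, hD, rfl, rfl⟩ := h
  choose κ hκ hstep using fun k => (hD.step k).exists_kernel
  set tot : ℕ → S → ℝ≥0∞ := fun k => go k + halt k with htot
  have htop : ∀ k t, tot k t ≠ ⊤ := fun k => ne_top_of_tsum (le_trans (hD.mass_le k) hΔ)
  -- The ancestry of the mass at a state is not recorded, so it is shared out proportionally: a
  -- fraction `X s k t / tot k t` of what is at `t` at stage `k` counts as descending from `s`,
  -- whether it goes on or halts.
  set X := descend tot κ with hX
  have hκ0 : ∀ k u t, tot k u = 0 → κ k u t = 0 := by
    intro k u t h0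
    have h1 := (hstep k (dirac u)).tsum_eq
    rw [mix_of_dirac] at h1
    have hgo : go k u = 0 := (add_eq_zero.1 h0).1
    have h2 : ∑' s, dirac u s * go k s = 0 := (pair_dirac u (go k)).trans hgo
    rw [h2] at h1
    exact ENNReal.tsum_eq_zero.1 h1 t
  -- Where the total vanishes so does each share, hence dividing by zero does no harm.
  have hac : ∀ s, tot 0 s ≠ 0 → ∀ k t, tot k t = 0 → X s k t = 0 := by
    intro s hs k t ht
    cases k with
    | zero => exact dirac_of_ne fun h => hs (h ▸ ht)
    | succ k =>
      by_contra hne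
      obtain ⟨u, -, hu⟩ := mix_ne_zero.1 hne
      have : ∑' s, κ k s t = 0 := (hκ k t).trans ht
      exact hu (ENNReal.tsum_eq_zero.1 this u)
  have hself : ∀ k t, tot k t ≠ 0 → tot k t / tot k t = 1 := fun k t h0 =>
    ENNReal.div_self h0 (htop k t)
  have hmix : ∀ k, mix (tot 0) (fun s => X s k) = tot k := by
    intro k
    induction k with
    | zero => exact mix_dirac _
    | succ k ih =>
      change mix (tot 0) (fun s => mix (fun t => X s k t / tot k t) (κ k)) = _
      rw [← mix_mix]
      have h1 : (mix (tot 0) fun s t => X s k t / tot k t) = fun t => tot k t / tot k t := by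
        funext t
        conv_rhs => enter [1]; rw [← ih]
        simp only [mix, div_eq_mul_inv, ← mul_assoc]
        exact ENNReal.tsum_mul_right
      rw [h1]
      funext t
      rw [← show ∑' s, κ k s t = tot (k + 1) t from hκ k t]
      refine tsum_congr fun u => ?_
      by_cases hu : tot k u = 0
      · rw [hκ0 k u t hu, mul_zero]
      · exact (congrArg (· * κ k u t) (hself k u hu)).trans (one_mul _)
  refine ⟨fun s t => ∑' k, X s k t / tot k t * halt k t, fun s hs => ?_, ?_⟩
  · have hX1 : ∀ k, (fun t => X s k t / tot k t * go k t) +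
        (fun t => X s k t / tot k t * halt k t) = X s k := by
      intro k
      funext t
      simp only [Pi.add_apply]
      rw [← mul_add]
      by_cases ht : tot k t = 0
      · simp [hac s hs k t ht]
      · exact ENNReal.div_mul_cancel ht (htop k t)
    refine ⟨fun k t => X s k t / tot k t * go k t, fun k t => X s k t / tot k t * halt k t,
      ⟨fun k => ?_, fun k t ht => ?_⟩, (hX1 0).symm, rfl⟩
    · rw [hX1]
      exact hstep k _
    · exact hD.not_success k t (right_ne_zero_of_mul ht)
  · funext t
    simp only [mix, ← ENNReal.tsum_mul_left]
    rw [ENNReal.tsum_comm]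
    refine tsum_congr fun k => ?_
    have h1 : ∑' s, tot 0 s * X s k t = tot k t := congrFun (hmix k) t
    have h2 : ∀ s, tot 0 s * (X s k t / tot k t * halt k t) =
        tot 0 s * X s k t * ((tot k t)⁻¹ * halt k t) := fun s => by
      rw [div_eq_mul_inv]; ring
    change _ = ∑' s, tot 0 s * (X s k t / tot k t * halt k t)
    rw [tsum_congr h2, ENNReal.tsum_mul_right, h1, ← mul_assoc]
    by_cases ht : tot k t = 0
    · have : halt k t = 0 := (add_eq_zero.1 ht).2
      simp [this]
    · rw [← div_eq_mul_inv, hself k t ht, one_mul]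

/-- Hyper-derivations from the states of a hyper-derivative, taken with weights that may depend on
further data, compose with it. -/
theorem RHyper.exists_mixture (hT : FinRed T) {Δ Θ : S → ℝ≥0∞} (hΔ : Δ.support.Finite)
    (hmass : ∑' s, Δ s ≤ 1) (h : RHyper T Δ Θ) {Y : Type v} {J : Y → S → ℝ≥0∞}
    (hJ : ∀ s, ∑' y, J y s ≤ Θ s) (hfin : {y | ∃ s, J y s ≠ 0}.Finite) {K : Y → S → S → ℝ≥0∞}
    (hK : ∀ y s, J y s ≠ 0 → RHyper T (dirac s) (K y s)) :
    ∃ Θ', RHyper T Δ Θ' ∧ ∀ t, ∑' y, ∑' s, J y s * K y s t ≤ Θ' t := by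
  have htop : ∀ s, Θ s ≠ ⊤ := ne_top_of_tsum (le_trans h.mass_le hmass)
  set w : S → Y → ℝ≥0∞ := fun s y => J y s / Θ s with hw
  have hw1 : ∀ s, ∑' y, w s y ≤ 1 := by
    intro s
    simp only [hw, div_eq_mul_inv]
    rw [ENNReal.tsum_mul_right]
    exact le_trans (mul_le_mul_left (hJ s) _) (ENNReal.mul_inv_le_one _)
  -- At `s` the option `y` is taken with probability `J y s / Θ s`, and the probability left over
  -- stays at `s`.
  set F : S → S → ℝ≥0∞ := fun s =>
    (mix (w s) fun y => K y s) + (1 - ∑' y, w s y) • dirac s with hF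
  refine ⟨mix Θ F, h.trans_kernel hT hΔ fun s _ => ?_, fun t => ?_⟩
  · have h1 : RHyper T (mix (w s) fun _ => dirac s) (mix (w s) fun y => K y s) := by
      refine RHyper.mix_left (hfin.subset fun y hy => ⟨s, fun h0 => hy ?_⟩) fun y hy =>
        hK y s fun h0 => hy ?_ <;> simp [hw, h0]
    have h2 := h1.add (RHyper.refl (T := T) ((1 - ∑' y, w s y) • dirac s))
    convert h2 using 1
    funext t
    simp only [mix, Pi.add_apply, Pi.smul_apply, smul_eq_mul]
    rw [ENNReal.tsum_mul_right, ← add_mul, add_tsub_cancel_of_le (hw1 s), one_mul]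
  · rw [ENNReal.tsum_comm]
    refine ENNReal.tsum_le_tsum fun s => ?_
    refine le_trans ?_ (mul_le_mul_right (le_self_add : mix (w s) (fun y => K y s) t ≤ F s t) _)
    simp only [mix, ← ENNReal.tsum_mul_left]
    refine ENNReal.tsum_le_tsum fun y => ?_
    rw [← mul_assoc]
    refine mul_le_mul_left ?_ _
    by_cases h0 : Θ s = 0
    · have := le_trans (ENNReal.le_tsum y) (hJ s)
      rw [h0] at this
      exact le_trans this (zero_le)
    · exact (ENNReal.mul_div_cancel h0 (htop s)).ge

end Splitting

-- Back and forth between sub-distributions and unbounded measures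

section Conversion

variable {S : Type u} {T : TestingStructure S}

theorem rStep_of_lift {r : S → PMF S → Prop} {Δ Λ : SubDist S} (h : Lift (toSub r) Δ Λ) :
    RStep r Δ Λ := by
  obtain ⟨I, _, p, hp, s, Ξ, hR, rfl, rfl⟩ := h
  choose μ hμ hΞ using hR
  have := RStep.sum (r := r) Finset.univ (g := fun i => p i • dirac (s i))
    (l := fun i => p i • ⇑(μ i)) fun i _ => RStep.single (p i) (hμ i)
  convert this using 1
  · funext x
    rw [Finset.sum_apply]
    rfl
  · funext x
    rw [Finset.sum_apply]
    exact Finset.sum_congr rfl fun i _ => by rw [hΞ i]; rfl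

theorem RStep.exists_family {r : S → PMF S → Prop} {g l : S → ℝ≥0∞} (h : RStep r g l) :
    ∃ (I : Type) (_ : Fintype I) (p : I → ℝ≥0∞) (s : I → S) (μ : I → PMF S),
      (∀ i, r (s i) (μ i)) ∧ (∀ x, g x = ∑ i, p i * dirac (s i) x) ∧
        ∀ x, l x = ∑ i, p i * μ i x := by
  induction h with
  | zero => exact ⟨Empty, inferInstance, Empty.elim, Empty.rec, Empty.rec, by simp, by simp, by simp⟩
  | @cons g l c s μ hr _ ih =>
    obtain ⟨I, _, p, s', μ', h1, h2, h3⟩ := ih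
    refine ⟨Option I, inferInstance, fun i => i.elim c p, fun i => i.elim s s',
      fun i => i.elim μ μ', ?_, fun x => ?_, fun x => ?_⟩
    · rintro (_ | i)
      · exact hr
      · exact h1 i
    · rw [Fintype.sum_option, Pi.add_apply, h2, add_comm]
      rfl
    · rw [Fintype.sum_option, Pi.add_apply, h3, add_comm]
      rfl

theorem lift_of_rStep {r : S → PMF S → Prop} {Δ Λ : SubDist S} (h : RStep r Δ Λ) :
    Lift (toSub r) Δ Λ := by
  obtain ⟨I, _, p, s, μ, h1, h2, h3⟩ := h.exists_family
  have hp : ∑ i, p i ≤ 1 := by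
    refine le_trans (le_of_eq ?_) Δ.mass_le_one
    simp only [h2]
    rw [Summable.tsum_finsetSum fun _ _ => ENNReal.summable]
    exact Finset.sum_congr rfl fun i _ => by rw [ENNReal.tsum_mul_left, tsum_dirac, mul_one]
  exact ⟨I, inferInstance, p, hp, s, fun i => SubDist.ofPMF (μ i), fun i => ⟨μ i, h1 i, rfl⟩,
    SubDist.ext' h2, SubDist.ext' h3⟩

/-- Derivations create no mass, so the bound on the initial mass makes every stage a
sub-distribution. -/
theorem hyper_iff (Δ Θ : SubDist S) : T.Hyper Δ Θ ↔ RHyper T Δ Θ := by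
  constructor
  · rintro ⟨go, halt, h0, hstep, hns, hsum⟩
    refine ⟨fun k => go k, fun k => halt k, ⟨fun k => ?_, hns⟩, funext h0, funext hsum⟩
    obtain ⟨Λ, hΛ, hΛ'⟩ := hstep k
    convert rStep_of_lift hΛ using 1
    exact (funext hΛ').symm
  · rintro ⟨go, halt, hD, h0, hsum⟩
    have hm : ∀ k, ∑' s, (go k + halt k) s ≤ 1 := fun k =>
      le_trans (hD.mass_le k) (by rw [← h0]; exact Δ.mass_le_one)
    have hg : ∀ k, ∑' s, go k s ≤ 1 := fun k =>
      le_trans (ENNReal.tsum_le_tsum fun s => le_self_add) (hm k)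
    have hh : ∀ k, ∑' s, halt k s ≤ 1 := fun k =>
      le_trans (ENNReal.tsum_le_tsum fun s => le_add_self) (hm k)
    exact ⟨fun k => ⟨go k, hg k⟩, fun k => ⟨halt k, hh k⟩, congrFun h0,
      fun k => ⟨⟨_, hm (k + 1)⟩, lift_of_rStep (hD.step k), fun s => rfl⟩,
      hD.not_success, congrFun hsum⟩

theorem coe_point (s : S) : ((SubDist.point s : SubDist S) : S → ℝ≥0∞) = dirac s := rfl

end Conversion

end Wireless
namespace Wireless
universe u v w

-- Extension to extreme derivatives

section Extreme

variable {S : Type u} {T : TestingStructure S}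

open Classical in
/-- The restriction of a measure to the states that satisfy `P`. -/
noncomputable def part (P : S → Prop) (g : S → ℝ≥0∞) : S → ℝ≥0∞ := fun s => if P s then g s else 0

theorem part_add_part (P : S → Prop) (g : S → ℝ≥0∞) : part P g + part (fun s => ¬ P s) g = g := by
  funext s
  by_cases h : P s <;> simp [part, h]

theorem part_ne_zero {P : S → Prop} {g : S → ℝ≥0∞} {s : S} :
    part P g s ≠ 0 ↔ P s ∧ g s ≠ 0 := by
  by_cases h : P s <;> simp [part, h]

theorem part_of_pos {P : S → Prop} {g : S → ℝ≥0∞} {s : S} (h : P s) : part P g s = g s := if_pos h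

theorem part_of_neg {P : S → Prop} {g : S → ℝ≥0∞} {s : S} (h : ¬ P s) : part P g s = 0 := if_neg h

theorem part_finite (P : S → Prop) {g : S → ℝ≥0∞} (h : g.support.Finite) :
    (part P g).support.Finite := h.subset fun _ hs => (part_ne_zero.1 hs).2

/-- What would halt at stage `k` when the states that satisfy `P` go on to `nx`. -/
noncomputable def extended (P : S → Prop) (nx : S → S → ℝ≥0∞) (halt : ℕ → S → ℝ≥0∞) :
    ℕ → S → ℝ≥0∞
  | 0 => halt 0
  | k + 1 => halt (k + 1) + mix (part P (extended P nx halt k)) nx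

/-- Each hyper-derivation can be continued to an extreme one. -/
theorem RHyper.exists_extreme (hT : FinRed T) {Δ Θ : S → ℝ≥0∞} (hΔ : Δ.support.Finite)
    (h : RHyper T Δ Θ) : ∃ Θ', RHyper T Δ Θ' ∧
      (∀ s, Θ' s ≠ 0 → (∃ μ, T.red s μ) → T.success s) ∧ pair Θ T.ind ≤ pair Θ' T.ind := by
  obtain ⟨go, halt, hD, rfl, rfl⟩ := h
  -- `P` singles out the states where halting would violate extremeness; mass that would halt there
  -- takes the chosen transition `nx` instead.
  set P : S → Prop := fun s => ¬ T.success s ∧ ∃ μ, T.red s μ with hP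
  have hnx : ∀ s, ∃ μ : PMF S, P s → T.red s μ := fun s => by
    by_cases hs : P s
    · exact ⟨hs.2.choose, fun _ => hs.2.choose_spec⟩
    · exact ⟨PMF.pure s, fun h => absurd h hs⟩
  choose nx hnx using hnx
  set x := extended P (fun s => ⇑(nx s)) halt with hx
  have hfin : ∀ k, (x k).support.Finite := by
    intro k
    induction k with
    | zero => exact finite_of_add_right hΔ
    | succ k ih =>
      have h1 := finite_of_add_right (hD.finite hT hΔ (k + 1))
      have h2 : RStep T.red (mix (part P (x k)) dirac) (mix (part P (x k)) fun s => ⇑(nx s)) :=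
        RStep.mix (part_finite P ih) fun s hs => RStep.one (hnx s (part_ne_zero.1 hs).1)
      refine (h1.union (h2.finite_right hT)).subset fun t ht => ?_
      by_contra hn
      simp only [Set.mem_union, Function.mem_support, not_or, not_not] at hn
      exact ht (by change (halt (k + 1) + mix (part P (x k)) fun s => ⇑(nx s)) t = 0
                   simp [hn.1, hn.2])
  refine ⟨fun s => ∑' k, part (fun s => ¬ P s) (x k) s,
    ⟨fun k => go k + part P (x k), fun k => part (fun s => ¬ P s) (x k), ⟨fun k => ?_,
      fun k s hs => ?_⟩, ?_, rfl⟩, fun s hs hr => ?_, ?_⟩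
  · have h2 : RStep T.red (mix (part P (x k)) dirac) (mix (part P (x k)) fun s => ⇑(nx s)) :=
      RStep.mix (part_finite P (hfin k)) fun s hs => RStep.one (hnx s (part_ne_zero.1 hs).1)
    rw [mix_dirac] at h2
    convert (hD.step k).add h2 using 1
    rw [add_assoc, part_add_part, add_assoc]
    rfl
  · by_cases h0 : go k s = 0
    · exact (part_ne_zero.1 (fun h1 => hs (by simp [h0, h1]) : part P (x k) s ≠ 0)).1.1
    · exact hD.not_success k s h0
  · rw [add_assoc, part_add_part]
    rfl
  · by_contra hn
    refine hs (ENNReal.tsum_eq_zero.2 fun k => ?_)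
    have : P s := ⟨hn, hr⟩
    simp [part, this]
  -- Successful states are outside `P`, so whatever halted in them still does.
  · refine ENNReal.tsum_le_tsum fun s => ?_
    by_cases hs : T.success s
    · refine mul_le_mul_left (ENNReal.tsum_le_tsum fun k => ?_) _
      have h1 : ¬ P s := fun h => h.1 hs
      simp only [part, h1, not_false_eq_true, if_true]
      cases k with
      | zero => exact le_rfl
      | succ k => exact le_self_add
    · simp [ind_of_not_success hs]

theorem exists_extreme_subDist (hT : FinRed T) {s : S} {Θ : S → ℝ≥0∞}
    (h : RHyper T (dirac s) Θ) :
    ∃ q ∈ T.results (SubDist.point s), pair Θ T.ind ≤ q := by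
  obtain ⟨Θ', h1, h2, h3⟩ := h.exists_extreme hT (support_dirac_finite s)
  have hm : ∑' t, Θ' t ≤ 1 := h1.mass_le.trans (tsum_dirac s).le
  refine ⟨_, ⟨⟨Θ', hm⟩, ⟨(hyper_iff _ _).2 h1, h2⟩, rfl⟩, ?_⟩
  rw [value_eq_pair]
  exact h3

end Extreme

-- The optimal success probability

section OptimalValue

variable {S : Type u} {T : TestingStructure S}

/-- The optimal probability of success. -/
noncomputable def TestingStructure.opt (T : TestingStructure S) (s : S) : ℝ≥0∞ :=
  ⨆ (Θ : S → ℝ≥0∞) (_ : RHyper T (dirac s) Θ), pair Θ T.ind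

theorem le_opt {s : S} {Θ : S → ℝ≥0∞} (h : RHyper T (dirac s) Θ) : pair Θ T.ind ≤ T.opt s :=
  le_iSup₂_of_le Θ h le_rfl

theorem ind_le_opt (s : S) : T.ind s ≤ T.opt s := by
  simpa [pair_dirac] using le_opt (T := T) (RHyper.refl (dirac s))

theorem opt_le_one (s : S) : T.opt s ≤ 1 := by
  refine iSup₂_le fun Θ h => ?_
  have h1 : pair Θ T.ind ≤ pair Θ fun _ => 1 :=
    pair_mono (fun _ => le_rfl) fun s _ => ind_le_one s
  refine h1.trans ?_
  have := h.mass_le.trans (tsum_dirac s).le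
  simpa [pair] using this

theorem opt_ne_top (s : S) : T.opt s ≠ ⊤ := ne_top_of_le_ne_top ENNReal.one_ne_top (opt_le_one s)

theorem opt_of_success {s : S} (h : T.success s) : T.opt s = 1 :=
  le_antisymm (opt_le_one s) ((ind_of_success h).symm.le.trans (ind_le_opt s))

theorem exists_lt_of_lt_opt {s : S} {x : ℝ≥0∞} (h : x < T.opt s) :
    ∃ Θ, RHyper T (dirac s) Θ ∧ x < pair Θ T.ind := by
  obtain ⟨Θ, h1⟩ := lt_iSup_iff.1 h
  obtain ⟨h2, h3⟩ := lt_iSup_iff.1 h1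
  exact ⟨Θ, h2, h3⟩

/-- Follow `Θ` by hyper-derivations from its states that are optimal up to a factor `c < 1`, as the
suprema need not be attained, and compose. A multiplicative error passes through the integral, and
then `c` tends to 1. -/
theorem pair_opt_le (hT : FinRed T) {s : S} {Θ : S → ℝ≥0∞} (h : RHyper T (dirac s) Θ) :
    pair Θ T.opt ≤ T.opt s := by
  refine ENNReal.le_of_forall_lt_one_mul_le fun c hc => ?_
  have : ∀ t, ∃ F, RHyper T (dirac t) F ∧ c * T.opt t ≤ pair F T.ind := by
    intro t
    by_cases h0 : T.opt t = 0
    · exact ⟨_, RHyper.refl _, by simp [h0]⟩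
    · have hlt : c * T.opt t < T.opt t := by
        have := (ENNReal.mul_lt_mul_iff_left h0 (opt_ne_top t)).2 hc
        rwa [one_mul] at this
      obtain ⟨F, h1, h2⟩ := exists_lt_of_lt_opt hlt
      exact ⟨F, h1, h2.le⟩
  choose F hF hle using this
  refine le_trans ?_ (le_opt (h.trans_kernel hT (support_dirac_finite s) fun t _ => hF t))
  rw [pair_mix, ← pair_mul_right]
  exact pair_mono (fun _ => le_rfl) fun t _ => hle t

end OptimalValue

-- Answers up to a coupling

section Reach

variable {S : Type u} {T : TestingStructure S} {Y : Type v} {Z : Type w}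

/-- From `b` a hyper-derivation leads to a measure which dominates a coupling of the weights `p`
along the relation `G`. -/
def Reach (T : TestingStructure S) (b : S) (p : Y → ℝ≥0∞) (G : Y → S → Prop) : Prop :=
  ∃ (Θ : S → ℝ≥0∞) (J : Y → S → ℝ≥0∞), RHyper T (dirac b) Θ ∧ (∀ y, ∑' s, J y s = p y) ∧
    (∀ y s, J y s ≠ 0 → G y s) ∧ ∀ s, ∑' y, J y s ≤ Θ s

theorem Reach.of_hyper {b : S} {p : Y → ℝ≥0∞} {f : Y → S} {G : Y → S → Prop}
    (h : RHyper T (dirac b) (mix p fun y => dirac (f y))) (hG : ∀ y, p y ≠ 0 → G y (f y)) :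
    Reach T b p G := by
  refine ⟨_, fun y s => p y * dirac (f y) s, h, fun y => ?_, fun y s hs => ?_, fun s => le_rfl⟩
  · rw [ENNReal.tsum_mul_left, tsum_dirac, mul_one]
  · rw [eq_of_dirac_ne_zero (right_ne_zero_of_mul hs)]
    exact hG y (left_ne_zero_of_mul hs)

/-- Staying at `b` dominates the product coupling. This is the answer of a successful `b`, which may
not move any more. -/
theorem Reach.of_success {b : S} {p : Y → ℝ≥0∞} {G : Y → S → Prop} (hp : ∑' y, p y ≤ 1)
    (hG : ∀ y, p y ≠ 0 → G y b) : Reach T b p G := by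
  refine ⟨_, fun y s => p y * dirac b s, RHyper.refl _, fun y => ?_, fun y s hs => ?_, fun s => ?_⟩
  · rw [ENNReal.tsum_mul_left, tsum_dirac, mul_one]
  · rw [eq_of_dirac_ne_zero (right_ne_zero_of_mul hs)]
    exact hG y (left_ne_zero_of_mul hs)
  · rw [ENNReal.tsum_mul_right]
    exact mul_le_of_le_one_left' hp

/-- Couplings are glued along their common marginal `p`: given `y`, the choices of `s` and of `z`
are made independently. -/
theorem Reach.transport {b : S} {p : Y → ℝ≥0∞} {q : Z → ℝ≥0∞} {G : Y → S → Prop}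
    {H : Z → S → Prop} (h : Reach T b p G) (π : Y → Z → ℝ≥0∞) (hp : ∀ y, ∑' z, π y z = p y)
    (hq : ∀ z, ∑' y, π y z = q z) (htop : ∀ y, p y ≠ ⊤)
    (hH : ∀ y z s, π y z ≠ 0 → G y s → H z s) : Reach T b q H := by
  obtain ⟨Θ, J, h1, h2, h3, h4⟩ := h
  have hJ0 : ∀ y s, p y = 0 → J y s = 0 := fun y s h0 =>
    ENNReal.tsum_eq_zero.1 ((h2 y).trans h0) s
  have hπ0 : ∀ y z, p y = 0 → π y z = 0 := fun y z h0 =>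
    ENNReal.tsum_eq_zero.1 ((hp y).trans h0) z
  refine ⟨Θ, fun z s => ∑' y, J y s * (π y z / p y), h1, fun z => ?_, fun z s hs => ?_,
    fun s => ?_⟩
  · rw [ENNReal.tsum_comm, ← hq z]
    refine tsum_congr fun y => ?_
    rw [ENNReal.tsum_mul_right, h2]
    by_cases h0 : p y = 0
    · simp [h0, hπ0 y z h0]
    · exact ENNReal.mul_div_cancel h0 (htop y)
  · simp only [ne_eq, ENNReal.tsum_eq_zero, not_forall] at hs
    obtain ⟨y, hy⟩ := hs
    refine hH y z s (fun h0 => hy (by simp [h0])) (h3 y s (left_ne_zero_of_mul hy))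
  · rw [ENNReal.tsum_comm]
    refine le_trans (ENNReal.tsum_le_tsum fun y => ?_) (h4 s)
    rw [ENNReal.tsum_mul_left]
    simp only [div_eq_mul_inv]
    rw [ENNReal.tsum_mul_right, hp]
    exact mul_le_of_le_one_right' (ENNReal.mul_inv_le_one _)

/-- Answers compose. The second answer may depend on the coupled pair `(y, s)` and not on `s` alone;
the extra data in `RHyper.exists_mixture` are there for this. -/
theorem Reach.bind (hT : FinRed T) {b : S} {p : Y → ℝ≥0∞} {G : Y → S → Prop}
    (h : Reach T b p G) (hp : p.support.Finite) {q : Y → Z → ℝ≥0∞} {H : Z → S → Prop}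
    (hq : ∀ y s, p y ≠ 0 → G y s → Reach T s (q y) H) : Reach T b (mix p q) H := by
  obtain ⟨Θ, J, h1, h2, h3, h4⟩ := h
  have hpJ : ∀ y s, J y s ≠ 0 → p y ≠ 0 := fun y s hs h0 =>
    hs (ENNReal.tsum_eq_zero.1 ((h2 y).trans h0) s)
  have := fun y s (hs : J y s ≠ 0) => hq y s (hpJ y s hs) (h3 y s hs)
  choose! K L k1 k2 k3 k4 using this
  obtain ⟨Θ', g1, g2⟩ := h1.exists_mixture hT (support_dirac_finite b) (tsum_dirac b).le h4
    (hp.subset fun y ⟨s, hs⟩ => hpJ y s hs) k1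
  refine ⟨Θ', fun z t => ∑' y, ∑' s, J y s * L y s z t, g1, fun z => ?_, fun z t ht => ?_,
    fun t => ?_⟩
  · rw [ENNReal.tsum_comm]
    refine tsum_congr fun y => ?_
    rw [ENNReal.tsum_comm, ← h2 y, ← ENNReal.tsum_mul_right]
    refine tsum_congr fun s => ?_
    rw [ENNReal.tsum_mul_left]
    by_cases hs : J y s = 0
    · simp [hs]
    · rw [k2 y s hs]
  · simp only [ne_eq, ENNReal.tsum_eq_zero, not_forall] at ht
    obtain ⟨y, s, hys⟩ := ht
    exact k3 y s (left_ne_zero_of_mul hys) z t (right_ne_zero_of_mul hys)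
  · refine le_trans ?_ (g2 t)
    rw [ENNReal.tsum_comm]
    refine ENNReal.tsum_le_tsum fun y => ?_
    rw [ENNReal.tsum_comm]
    refine ENNReal.tsum_le_tsum fun s => ?_
    rw [ENNReal.tsum_mul_left]
    by_cases hs : J y s = 0
    · simp [hs]
    · exact mul_le_mul_right (k4 y s hs t) _

end Reach

end Wireless
namespace Wireless
universe u v w

-- Derivations that attain a superharmonic bound

section Core

variable {S : Type u} {T : TestingStructure S}

/-- The optimal payoff within `n` steps when only the transitions in `A` may be taken. -/
noncomputable def payoff (T : TestingStructure S) (A : S → PMF S → Prop) : ℕ → S → ℝ≥0∞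
  | 0, a => T.ind a
  | n + 1, a => T.ind a ⊔ ⨆ (μ : PMF S) (_ : A a μ), pair ⇑μ (payoff T A n)

theorem ind_le_payoff (A : S → PMF S → Prop) (n : ℕ) (a : S) : T.ind a ≤ payoff T A n a := by
  cases n with
  | zero => exact le_rfl
  | succ n => exact le_sup_left

theorem pair_le_payoff {A : S → PMF S → Prop} {n : ℕ} {a : S} {μ : PMF S} (h : A a μ) :
    pair ⇑μ (payoff T A n) ≤ payoff T A (n + 1) a :=
  le_sup_of_le_right (le_iSup₂_of_le μ h le_rfl)

theorem payoff_le {A : S → PMF S → Prop} {U : S → ℝ≥0∞} (hind : ∀ a, T.ind a ≤ U a)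
    (hA : ∀ a μ, A a μ → pair ⇑μ U ≤ U a) (n : ℕ) (a : S) : payoff T A n a ≤ U a := by
  induction n generalizing a with
  | zero => exact hind a
  | succ n ih =>
    exact sup_le (hind a) (iSup₂_le fun μ h =>
      (pair_mono (fun _ => le_rfl) fun t _ => ih t).trans (hA a μ h))

/-- If a superharmonic bound of the success probability is attained by some hyper-derivation, then
it is approximated from below, at all states that are met, with transitions which conserve it. -/
theorem exists_conserving_core {U : S → ℝ≥0∞}
    (hU : ∀ s μ, ¬ T.success s → T.red s μ → pair ⇑μ U ≤ U s) (hind : ∀ s, T.ind s ≤ U s)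
    {a₀ : S} {Θ : S → ℝ≥0∞} (h : RHyper T (dirac a₀) Θ) (hopt : U a₀ ≤ pair Θ T.ind) :
    ∃ (O : S → Prop) (A : S → PMF S → Prop), O a₀ ∧
      (∀ s μ, A s μ → T.red s μ ∧ ¬ T.success s ∧ pair ⇑μ U = U s ∧ ∀ t ∈ μ.support, O t) ∧
      ∀ a, O a → U a ≤ ⨆ n, payoff T A n a := by
  obtain ⟨go, halt, hD, h0, rfl⟩ := h
  rw [pair_tsum] at hopt
  have hone : ∑' s, (go 0 + halt 0) s = 1 := by rw [← h0, tsum_dirac]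
  have hmass : ∀ n, ∑' s, (go n + halt n) s ≤ 1 := fun n => hone ▸ hD.mass_le n
  -- The tail from stage `n` on is itself a derivation.
  have hrest : ∀ n, ∑' k, pair (halt (k + n)) T.ind ≤ 1 := fun n => by
    have h1 := (Der.mk (fun k => by simpa [add_right_comm] using hD.step (k + n))
      (fun k => hD.not_success (k + n)) : Der T (fun k => go (k + n)) fun k => halt (k + n))
    have := h1.tsum_le (U := fun _ => 1) (f := T.ind) (fun _ μ _ _ => (RStep.pair_one μ).le)
      ind_le_one
    refine this.trans ?_
    simpa [pair] using hmass n
  have hpart : ∀ n, ∑ k ∈ Finset.range n, pair (halt k) T.ind ≠ ⊤ := fun n =>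
    ne_top_of_le_ne_top ENNReal.one_ne_top
      ((ENNReal.sum_le_tsum (Finset.range n)).trans (by simpa using hrest 0))
  -- The value reaches the initial potential, so after subtracting what was earned before stage `n`
  -- the tail must earn all the potential left there. With `hge` this is an equality at every stage.
  have hle : ∀ n, pair (go n + halt n) U ≤ ∑' k, pair (halt (k + n)) T.ind := by
    intro n
    have h1 := hD.potential hU hind n
    rw [← h0, pair_dirac] at h1
    have h2 := h1.trans hopt
    rw [← Summable.sum_add_tsum_nat_add' (k := n) ENNReal.summable] at h2
    exact (ENNReal.add_le_add_iff_left (hpart n)).1 h2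
  have hfin : ∀ n, pair (go n + halt n) U ≠ ⊤ := fun n =>
    ne_top_of_le_ne_top ENNReal.one_ne_top ((hle n).trans (hrest n))
  have hge : ∀ n, ∑' k, pair (halt (k + n)) T.ind ≤ pair (go n + halt n) U := fun n => by
    have h1 := (Der.mk (fun k => by simpa [add_right_comm] using hD.step (k + n))
      (fun k => hD.not_success (k + n)) : Der T (fun k => go (k + n)) fun k => halt (k + n))
    simpa using h1.tsum_le hU hind
  have hsucc : ∀ n, ∑' k, pair (halt (k + n)) T.ind =
      pair (halt n) T.ind + ∑' k, pair (halt (k + (n + 1))) T.ind := by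
    intro n
    rw [tsum_eq_zero_add' ENNReal.summable]
    simp [add_assoc, add_comm 1 n]
  set O : S → Prop := fun t => ∃ k, (go k + halt k) t ≠ 0 with hO
  set A : S → PMF S → Prop := fun s μ =>
    T.red s μ ∧ ¬ T.success s ∧ pair ⇑μ U = U s ∧ ∀ t ∈ μ.support, O t with hA
  -- No stage loses potential, hence by `RStep.conserving` only conserving transitions are used.
  have hstep : ∀ n, RStep A (go n) (go (n + 1) + halt (n + 1)) := by
    intro n
    have h1 := (hD.step_of_not_success n).conserving (U := U) (fun s μ hs => hU s μ hs.2 hs.1) ?_ ?_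
    · exact (h1.restrict (fun _ => le_rfl) fun _ => le_rfl).mono fun s μ hs =>
        ⟨hs.1.1.1, hs.1.1.2, hs.1.2, fun t ht => ⟨n + 1, hs.2.2 t ht⟩⟩
    · have h2 : pair (halt n) T.ind ≤ pair (halt n) U := pair_mono (fun _ => le_rfl) fun s _ => hind s
      have h3 : pair (halt n) T.ind ≠ ⊤ := ne_top_of_le_ne_top ENNReal.one_ne_top
        ((ENNReal.le_tsum n).trans (by simpa using hrest 0))
      refine (ENNReal.add_le_add_iff_right h3).1 ?_
      calc pair (go n) U + pair (halt n) T.ind ≤ pair (go n) U + pair (halt n) U := by gcongr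
        _ = pair (go n + halt n) U := (pair_add _ _ _).symm
        _ ≤ pair (halt n) T.ind + ∑' k, pair (halt (k + (n + 1))) T.ind := by
            rw [← hsucc]; exact hle n
        _ ≤ pair (halt n) T.ind + pair (go (n + 1) + halt (n + 1)) U := by
            gcongr; exact hge (n + 1)
        _ = _ := add_comm _ _
    · refine ne_top_of_le_ne_top (hfin n) ?_
      rw [pair_add]
      exact le_self_add
  -- The next stages of the derivation are one of the strategies over which `payoff` takes a
  -- supremum.
  have hlow : ∀ n k, ∑ j ∈ Finset.range n, pair (halt (j + k)) T.ind ≤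
      pair (go k + halt k) (payoff T A n) := by
    intro n
    induction n with
    | zero => simp
    | succ n ih =>
      intro k
      rw [Finset.sum_range_succ', pair_add]
      refine add_le_add ?_ ?_
      · refine le_trans ?_ ((hstep k).pair_le fun s μ h => pair_le_payoff h)
        simpa [add_assoc, add_comm 1 k] using ih (k + 1)
      · rw [zero_add]
        exact pair_mono (fun _ => le_rfl) fun s _ => ind_le_payoff A _ s
  refine ⟨O, A, ⟨0, ?_⟩, fun s μ h => h, fun a ⟨k, hk⟩ => ?_⟩
  · rw [← h0, dirac_self]
    exact one_ne_zero
  · have h1 : ∀ s, ⨆ n, payoff T A n s ≤ U s := fun s =>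
      iSup_le fun n => payoff_le hind (fun a μ h => h.2.2.1.le) n s
    -- Integrated over stage `k`, the limit of the payoffs equals `U`; since it is below `U`
    -- pointwise, it equals `U` at each state present at that stage.
    have h2 : pair (go k + halt k) U ≤ pair (go k + halt k) fun s => ⨆ n, payoff T A n s := by
      refine (hle k).trans ?_
      rw [ENNReal.tsum_eq_iSup_nat]
      exact iSup_le fun n => (hlow n k).trans
        (pair_mono (fun _ => le_rfl) fun s _ => le_iSup (fun n => payoff T A n s) n)
    exact (pair_eq_of_le (fun s _ => h1 s) h2
      (ne_top_of_le_ne_top (hfin k) (pair_mono (fun _ => le_rfl) fun s _ => h1 s))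
      (ne_top_of_tsum (hmass k)) hk).ge

end Core

end Wireless
namespace Wireless
universe u v w

-- Repeating a derivation in rounds

section Renewal

variable {S : Type u} {T : TestingStructure S}

/-- The stages at which the process `h` is started afresh: each time it halts in `G`. -/
noncomputable def restarts (G : S → Prop) (h : S → ℕ → S → ℝ≥0∞) (b₀ : S) : ℕ → S → ℝ≥0∞
  | 0 => dirac b₀
  -- Halting is counted from stage 1 on, so that restarts at `n + 1` depend on strictly earlier
  -- ones. Nothing is missed when the process does not halt at once.
  | n + 1 => part G (∑ x ∈ (Finset.HasAntidiagonal.antidiagonal n).attach,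
      mix (restarts G h b₀ x.1.1) fun s => h s (x.1.2 + 1))
termination_by n => n
decreasing_by
  have := Finset.HasAntidiagonal.mem_antidiagonal.1 x.2
  omega

theorem restarts_zero (G : S → Prop) (h : S → ℕ → S → ℝ≥0∞) (b₀ : S) :
    restarts G h b₀ 0 = dirac b₀ := by
  rw [restarts]

theorem restarts_succ (G : S → Prop) (h : S → ℕ → S → ℝ≥0∞) (b₀ : S) (n : ℕ) :
    restarts G h b₀ (n + 1) = part G (conv (restarts G h b₀) (fun s m => h s (m + 1)) n) := by
  rw [restarts, Finset.sum_attach (Finset.HasAntidiagonal.antidiagonal n)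
    fun x => mix (restarts G h b₀ x.1) fun s => h s (x.2 + 1)]
  rfl

/-- A hyper-derivation that does not halt at once, from each state of `G`, can be iterated
until it halts outside `G`. -/
theorem exists_iterate (hT : FinRed T) {G : S → Prop} {g h : S → ℕ → S → ℝ≥0∞}
    (hD : ∀ s, G s → Der T (g s) (h s)) (hg : ∀ s, G s → g s 0 = dirac s)
    (hh : ∀ s, G s → h s 0 = 0) {b₀ : S} (hb : G b₀) :
    ∃ B Θ : S → ℝ≥0∞, RHyper T (dirac b₀) (part (fun s => ¬ G s) Θ) ∧
      B = dirac b₀ + part G Θ ∧ Θ = mix B fun s t => ∑' m, h s m t := by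
  set y := restarts G h b₀ with hy
  have hyG : ∀ n s, y n s ≠ 0 → G s := by
    intro n s hs
    cases n with
    | zero =>
      rw [hy, restarts_zero] at hs
      rwa [eq_of_dirac_ne_zero hs]
    | succ n =>
      rw [hy, restarts_succ] at hs
      exact (part_ne_zero.1 hs).1
  have hyD : ∀ n s, y n s ≠ 0 → Der T (g s) (h s) := fun n s hs => hD s (hyG n s hs)
  have hfin : ∀ n, (y n).support.Finite := by
    intro n
    induction n using Nat.strong_induction_on with
    | _ n ih =>
    cases n with
    | zero => rw [hy, restarts_zero]; exact support_dirac_finite b₀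
    | succ n =>
      rw [hy, restarts_succ]
      refine part_finite _ ?_
      unfold conv
      have : ∀ x ∈ Finset.HasAntidiagonal.antidiagonal n,
          (mix (y x.1) fun s => h s (x.2 + 1)).support.Finite := by
        intro x hx
        have hx := Finset.HasAntidiagonal.mem_antidiagonal.1 hx
        have h1 := ih x.1 (by omega)
        refine (h1.biUnion (t := fun s => {t | y x.1 s ≠ 0 ∧ h s (x.2 + 1) t ≠ 0})
          fun s hs => ?_).subset fun t ht => ?_
        · refine (finite_of_add_right ((hyD x.1 s hs).finite hT ?_ (x.2 + 1))).subset
            fun t ht => ht.2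
          rw [hg s (hyG _ s hs), hh s (hyG _ s hs), add_zero]
          exact support_dirac_finite s
        · obtain ⟨s, h2, h3⟩ := mix_ne_zero.1 ht
          exact Set.mem_biUnion (show s ∈ Function.support (y x.1) from h2) ⟨h2, h3⟩
      refine ((Finset.finite_toSet (Finset.HasAntidiagonal.antidiagonal n)).biUnion this).subset
        fun t ht => ?_
      rw [Function.mem_support, Finset.sum_apply] at ht
      obtain ⟨x, hx, hx'⟩ := Finset.exists_ne_zero_of_sum_ne_zero ht
      exact Set.mem_biUnion (Finset.mem_coe.2 hx) hx'
  have hm0 : ∀ n, (mix (y n) fun s => h s 0) = 0 := fun n => by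
    refine (mix_congr (g' := fun _ => 0) fun s hs => hh s (hyG n s hs)).trans ?_
    funext t
    simp [mix]
  have hmg : ∀ n, (mix (y n) fun s => g s 0) = y n := fun n =>
    (mix_congr fun s hs => hg s (hyG n s hs)).trans (mix_dirac _)
  have hc0 : conv y h 0 = 0 := by rw [conv_zero, hm0]
  have hcs : ∀ n, conv y h (n + 1) = conv y (fun s m => h s (m + 1)) n := fun n => by
    rw [conv_succ, hm0, zero_add]
  have hys : ∀ n, y (n + 1) = part G (conv y h (n + 1)) := fun n => by
    rw [hcs, hy, restarts_succ]
  have hpt : ∀ (P : S → Prop) s, ∑' n, part P (conv y h n) s =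
      part P (fun s => ∑' n, conv y h n s) s := by
    intro P s
    by_cases hs : P s <;> simp [part, hs]
  -- `B` is the expected number of rounds started at each state, possibly of infinite total mass,
  -- and `Θ` is what halts at the end of any round, whether or not a new round follows.
  refine ⟨fun s => ∑' n, y n s, fun s => ∑' n, conv y h n s,
    ⟨conv y g, fun n => part (fun s => ¬ G s) (conv y h n), ⟨fun n => ?_, fun n s hs => ?_⟩, ?_, ?_⟩,
    ?_, tsum_conv y h⟩
  · have h1 := Der.conv hfin hyD n
    convert h1 using 1
    rw [conv_succ, hmg, hys, ← hcs, add_right_comm, part_add_part, add_comm]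
  · obtain ⟨i, j, x, hx, hs'⟩ := conv_ne_zero hs
    exact (hyD i x hx).not_success j s hs'
  · change dirac b₀ = conv y g 0 + part (fun s => ¬ G s) (conv y h 0)
    rw [conv_zero, hmg, hc0, hy, restarts_zero]
    funext s
    simp [part]
  · funext s
    exact (hpt _ s).symm
  · funext s
    rw [tsum_eq_zero_add' ENNReal.summable, Pi.add_apply, hy, restarts_zero, ← hy]
    congr 1
    rw [← hpt, tsum_eq_zero_add' (f := fun n => part G (conv y h n) s) ENNReal.summable, hc0]
    simp only [hys]
    simp [part]

theorem part_add (P : S → Prop) (g h : S → ℝ≥0∞) : part P (g + h) = part P g + part P h := by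
  funext s
  by_cases hs : P s <;> simp [part, hs]

theorem pair_part_left (P : S → Prop) (g f : S → ℝ≥0∞) :
    pair (part P g) f = pair g (part P f) := by
  refine tsum_congr fun s => ?_
  by_cases hs : P s <;> simp [part, hs]

/-- If each round earns half of the potential `V` and loses none of it, then the rounds together
earn all of it. -/
theorem le_pair_of_rounds {G : S → Prop} {F : S → S → ℝ≥0∞} {V f : S → ℝ≥0∞}
    (hhalf : ∀ s, G s → V s / 2 ≤ pair (F s) f)
    (hkeep : ∀ s, G s → V s ≤ pair (F s) f + pair (F s) (part G V)) :
    ∀ (n : ℕ) (c : ℝ≥0∞), c + 2⁻¹ ^ n = 1 → ∀ B B₀ : S → ℝ≥0∞, (∀ s, B₀ s ≠ 0 → G s) →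
      B = B₀ + part G (mix B F) → c * pair B₀ V ≤ pair (mix B F) f := by
  intro n
  induction n with
  | zero =>
    intro c hc B B₀ _ _
    have : c = 0 := (ENNReal.add_left_inj ENNReal.one_ne_top).1 (by simpa using hc)
    simp [this]
  | succ n ih =>
    intro c hc B B₀ hB₀ hB
    have hd : (2⁻¹ : ℝ≥0∞) ^ n ≤ 1 := pow_le_one' (by simp) n
    obtain ⟨c', hc'⟩ : ∃ c' : ℝ≥0∞, c' + 2⁻¹ ^ n = 1 := ⟨1 - 2⁻¹ ^ n, tsub_add_cancel_of_le hd⟩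
    have hcc : c = c' + 2⁻¹ ^ n / 2 := by
      have hne : (2⁻¹ : ℝ≥0∞) ^ (n + 1) ≠ ⊤ := ENNReal.pow_ne_top (by simp)
      refine (ENNReal.add_left_inj hne).1 ?_
      rw [hc, ← hc', pow_succ, ← div_eq_mul_inv, add_assoc, ENNReal.add_halves]
    -- After removal of the first round, the starts of the later rounds satisfy the same renewal
    -- equation, with the initial measure replaced by what the first round leaves in `G`.
    have h1 := ih c' hc' (part G (mix B F)) (part G (mix B₀ F))
      (fun s hs => (part_ne_zero.1 hs).1) (by
        conv_lhs => rw [hB]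
        rw [mix_add_left, part_add])
    have h2 : pair (mix B F) f = pair (mix B₀ F) f + pair (mix (part G (mix B F)) F) f := by
      conv_lhs => rw [hB]
      rw [mix_add_left, pair_add]
    rw [h2]
    refine le_trans ?_ (add_le_add_right h1 _)
    rw [pair_part_left, pair_mix, pair_mix, ← pair_mul_right, ← pair_mul_right]
    simp only [pair]
    rw [← ENNReal.tsum_add]
    refine ENNReal.tsum_le_tsum fun s => ?_
    rw [← mul_add]
    by_cases hs : B₀ s = 0
    · simp [hs]
    refine mul_le_mul_right ?_ _
    change _ ≤ pair (F s) f + c' * pair (F s) (part G V)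
    -- `hkeep` enters with weight `c'` and `hhalf` with weight `2⁻¹ ^ n`; these add up to 1, which
    -- is the weight of the first round's earnings.
    calc c * V s = c' * V s + 2⁻¹ ^ n * (V s / 2) := by
          rw [hcc, add_mul, div_eq_mul_inv, div_eq_mul_inv]; ring
      _ ≤ c' * (pair (F s) f + pair (F s) (part G V)) + 2⁻¹ ^ n * pair (F s) f := by
          gcongr
          · exact hkeep s (hB₀ s hs)
          · exact hhalf s (hB₀ s hs)
      _ = (c' + 2⁻¹ ^ n) * pair (F s) f + c' * pair (F s) (part G V) := by ring
      _ = _ := by rw [hc', one_mul]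

/-- A hyper-derivation from a state splits off what halts at once. -/
theorem RHyper.normalise {b : S} {Θ : S → ℝ≥0∞} (h : RHyper T (dirac b) Θ) :
    ∃ (α β : ℝ≥0∞) (Θ₁ : S → ℝ≥0∞), α + β = 1 ∧ Θ = α • dirac b + β • Θ₁ ∧
      (β ≠ 0 → ∃ g h : ℕ → S → ℝ≥0∞, Der T g h ∧ g 0 = dirac b ∧ h 0 = 0 ∧
        Θ₁ = fun s => ∑' k, h k s) := by
  obtain ⟨go, halt, hD, h0, rfl⟩ := h
  have hat : ∀ s, go 0 s + halt 0 s = dirac b s := fun s => (congrFun h0 s).symm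
  have hgo : go 0 = go 0 b • dirac b := by
    funext s
    by_cases hs : s = b
    · subst hs; simp [dirac_self]
    · have := hat s
      rw [dirac_of_ne hs] at this
      simp [dirac_of_ne hs, (add_eq_zero.1 this).1]
  have hhalt : halt 0 = halt 0 b • dirac b := by
    funext s
    by_cases hs : s = b
    · subst hs; simp [dirac_self]
    · have := hat s
      rw [dirac_of_ne hs] at this
      simp [dirac_of_ne hs, (add_eq_zero.1 this).2]
  have hsum : halt 0 b + go 0 b = 1 := by rw [add_comm, hat, dirac_self]
  set h' : ℕ → S → ℝ≥0∞ := fun k => if k = 0 then 0 else halt k with hh'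
  have hD' : Der T go h' := ⟨fun k => by simpa [hh'] using hD.step k, hD.not_success⟩
  have hΘ : (fun s => ∑' k, halt k s) = halt 0 + fun s => ∑' k, h' k s := by
    funext s
    rw [tsum_eq_zero_add' ENNReal.summable, Pi.add_apply]
    congr 1
    rw [tsum_eq_zero_add' (f := fun k => h' k s) ENNReal.summable]
    simp [hh']
  set β := go 0 b with hβ
  have hβt : β ≠ ⊤ := ne_top_of_le_ne_top ENNReal.one_ne_top (hsum ▸ le_add_self)
  refine ⟨halt 0 b, β, β⁻¹ • fun s => ∑' k, h' k s, hsum, ?_, fun hβ0 => ?_⟩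
  · rw [hΘ, hhalt]
    congr 1
    · simp [dirac_self]
    -- If nothing goes on, then nothing halts later, and the infinite factor `β⁻¹` multiplies zero.
    by_cases hβ0 : β = 0
    · have h1 : RHyper T (go 0) fun s => ∑' k, h' k s := ⟨go, h', hD', by simp [hh'], rfl⟩
      have h2 := h1.mass_le
      rw [hgo, hβ0] at h2
      simp only [zero_smul, Pi.zero_apply, tsum_zero, nonpos_iff_eq_zero] at h2
      funext s
      rw [hβ0, zero_smul]
      exact ENNReal.tsum_eq_zero.1 h2 s
    · rw [smul_smul, ENNReal.mul_inv_cancel hβ0 hβt, one_smul]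
  · refine ⟨_, _, hD'.smul β⁻¹, ?_, by simp [hh'], ?_⟩
    · rw [hgo, smul_smul, ENNReal.inv_mul_cancel hβ0 hβt, one_smul]
    · funext s
      simp [ENNReal.tsum_mul_left]

end Renewal

end Wireless
namespace Wireless
universe u v w

-- May simulations preserve results

section Soundness

variable {S : Type u} {T : TestingStructure S}

/-- A simulation for may testing: success is preserved, and each step is matched by a
hyper-derivation up to a coupling. -/
structure IsMaySim (T : TestingStructure S) (R : S → S → Prop) : Prop where
  success : ∀ a b, R a b → T.success a → T.success b
  step : ∀ a b μ, R a b → ¬ T.success a → T.red a μ → Reach T b ⇑μ R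

/-- The least optimal value among the states which simulate `a`. -/
noncomputable def lowerOpt (T : TestingStructure S) (R : S → S → Prop) (a : S) : ℝ≥0∞ :=
  ⨅ (b : S) (_ : R a b), T.opt b

variable {R : S → S → Prop}

theorem lowerOpt_le {a b : S} (h : R a b) : lowerOpt T R a ≤ T.opt b := iInf₂_le b h

theorem tsum_coupling {Y : Type v} {J : Y → S → ℝ≥0∞} {p : Y → ℝ≥0∞}
    (hJ : ∀ y, ∑' s, J y s = p y) (f : Y → ℝ≥0∞) : ∑' y, ∑' s, J y s * f y = pair p f :=
  tsum_congr fun y => by rw [ENNReal.tsum_mul_right, hJ]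

theorem tsum_coupling_le {Y : Type v} {J : Y → S → ℝ≥0∞} {Θ : S → ℝ≥0∞}
    (hJ : ∀ s, ∑' y, J y s ≤ Θ s) (f : S → ℝ≥0∞) : ∑' y, ∑' s, J y s * f s ≤ pair Θ f := by
  rw [ENNReal.tsum_comm]
  exact ENNReal.tsum_le_tsum fun s => by
    rw [ENNReal.tsum_mul_right]; exact mul_le_mul_left (hJ s) _

/-- Each `b` that simulates `a` answers the step by a hyper-derivation whose coupled states have
`opt` at least `lowerOpt`, and a hyper-derivation does not increase the mean of `opt`. -/
theorem IsMaySim.lowerOpt_superharmonic (hR : IsMaySim T R) (hT : FinRed T) (a : S) (μ : PMF S)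
    (ha : ¬ T.success a) (hr : T.red a μ) : pair ⇑μ (lowerOpt T R) ≤ lowerOpt T R a := by
  refine le_iInf₂ fun b hb => ?_
  obtain ⟨Θ, J, h1, h2, h3, h4⟩ := hR.step a b μ hb ha hr
  rw [← tsum_coupling h2]
  refine le_trans (ENNReal.tsum_le_tsum fun t => ENNReal.tsum_le_tsum fun s => ?_)
    ((tsum_coupling_le h4 T.opt).trans (pair_opt_le hT h1))
  by_cases hJ : J t s = 0
  · simp [hJ]
  · exact mul_le_mul_right (lowerOpt_le (h3 t s hJ)) _

theorem IsMaySim.ind_le_lowerOpt (hR : IsMaySim T R) (a : S) : T.ind a ≤ lowerOpt T R a := by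
  by_cases ha : T.success a
  · exact le_iInf₂ fun b hb => by
      rw [opt_of_success (hR.success a b hb ha)]; exact ind_le_one a
  · simp [ind_of_not_success ha]

/-- The states which simulate a state of `O` with the same value. -/
def Tight (T : TestingStructure S) (R : S → S → Prop) (O : S → Prop) (b : S) : Prop :=
  ∃ a, O a ∧ R a b ∧ lowerOpt T R a = T.opt b

/-- The states which are successful or tight. -/
def Settled (T : TestingStructure S) (R : S → S → Prop) (O : S → Prop) (b : S) : Prop :=
  T.success b ∨ Tight T R O b

theorem exists_lt_one_le_mul_self {c : ℝ≥0∞} (hc : c < 1) : ∃ d < 1, c ≤ d * d := by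
  lift c to ℝ≥0 using ne_top_of_lt hc
  have hc' : c < 1 := by exact_mod_cast hc
  refine ⟨((1 + c) / 2 : ℝ≥0), ?_, ?_⟩
  · have h : (1 + c) / 2 < 1 := by
      rw [← NNReal.coe_lt_coe] at hc' ⊢
      push_cast at hc' ⊢
      linarith
    exact_mod_cast h
  · have h : c ≤ (1 + c) / 2 * ((1 + c) / 2) := by
      rw [← NNReal.coe_le_coe]
      push_cast
      nlinarith [sq_nonneg (1 - (c : ℝ))]
    exact_mod_cast h

/-- A finite-horizon strategy of the simulated state is matched, up to a factor, by a
hyper-derivation which loses nothing of the optimal value. -/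
theorem IsMaySim.exists_round (hR : IsMaySim T R) (hT : FinRed T) {O : S → Prop}
    {A : S → PMF S → Prop}
    (hA : ∀ s μ, A s μ → T.red s μ ∧ ¬ T.success s ∧ pair ⇑μ (lowerOpt T R) = lowerOpt T R s ∧
      ∀ t ∈ μ.support, O t) (n : ℕ) :
    ∀ (c : ℝ≥0∞), c < 1 → ∀ a b, O a → R a b → lowerOpt T R a = T.opt b →
      ∃ Θ, RHyper T (dirac b) Θ ∧ c * payoff T A n a ≤ pair Θ T.ind ∧
        T.opt b ≤ pair Θ (part (Settled T R O) T.opt) := by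
  induction n with
  | zero =>
    intro c hc a b ha hab heq
    refine ⟨_, RHyper.refl _, ?_, ?_⟩
    · rw [pair_dirac]
      by_cases hs : T.success a
      · rw [ind_of_success (hR.success a b hab hs)]
        exact (mul_le_of_le_one_left' hc.le).trans (ind_le_one a)
      · simp [payoff, ind_of_not_success hs]
    · rw [pair_dirac, part_of_pos (P := Settled T R O) (Or.inr ⟨a, ha, hab, heq⟩)]
  | succ n ih =>
    intro c hc a b ha hab heq
    have htriv : ∀ x : ℝ≥0∞, x ≤ T.ind b → ∃ Θ, RHyper T (dirac b) Θ ∧ x ≤ pair Θ T.ind ∧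
        T.opt b ≤ pair Θ (part (Settled T R O) T.opt) := fun x hx =>
      ⟨_, RHyper.refl _, by rwa [pair_dirac],
        by rw [pair_dirac, part_of_pos (P := Settled T R O) (Or.inr ⟨a, ha, hab, heq⟩)]⟩
    have hpl : ∀ n s, payoff T A n s ≤ lowerOpt T R s :=
      payoff_le hR.ind_le_lowerOpt fun s μ h => (hA s μ h).2.2.1.le
    by_cases hs : T.success a
    · refine htriv _ ?_
      rw [ind_of_success (hR.success a b hab hs)]
      exact (mul_le_of_le_one_left' hc.le).trans ((hpl _ a).trans (heq ▸ opt_le_one b))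
    by_cases h0 : payoff T A (n + 1) a = 0
    · exact htriv _ (by simp [h0])
    -- One factor `d` pays for a transition that is not quite optimal, the other for the induction
    -- hypothesis.
    obtain ⟨d, hd1, hd⟩ := exists_lt_one_le_mul_self hc
    have hlt : d * payoff T A (n + 1) a < payoff T A (n + 1) a := by
      have := (ENNReal.mul_lt_mul_iff_left h0 (ne_top_of_le_ne_top (opt_ne_top b)
        ((hpl (n + 1) a).trans heq.le))).2 hd1
      rwa [one_mul] at this
    obtain ⟨μ, hμ, hle⟩ : ∃ μ, A a μ ∧ d * payoff T A (n + 1) a < pair ⇑μ (payoff T A n) := by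
      nth_rewrite 2 [payoff] at hlt
      rcases lt_sup_iff.1 hlt with h | h
      · simp [ind_of_not_success hs] at h
      · obtain ⟨μ, h⟩ := lt_iSup_iff.1 h
        obtain ⟨h1, h2⟩ := lt_iSup_iff.1 h
        exact ⟨μ, h1, h2⟩
    obtain ⟨hred, -, hcons, hO⟩ := hA a μ hμ
    obtain ⟨Θ, J, h1, h2, h3, h4⟩ := hR.step a b μ hab hs hred
    have hJμ : ∀ t s, J t s ≠ 0 → t ∈ μ.support := fun t s hJ h0 =>
      hJ (ENNReal.tsum_eq_zero.1 ((h2 t).trans h0) s)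
    have hup : pair Θ T.opt ≤ pair ⇑μ (lowerOpt T R) := by
      rw [hcons, heq]; exact pair_opt_le hT h1
    -- Along the coupling `lowerOpt` is at most `opt`, while the mean of `opt` is at most `opt b =
    -- lowerOpt a`, which is the mean of `lowerOpt` because `μ` conserves it. So every coupled pair
    -- is tight again, and the induction hypothesis applies to it.
    have hJeq : ∀ t s, J t s ≠ 0 → lowerOpt T R t = T.opt s := by
      intro t s hJ
      have := pair_eq_of_le (g := fun x : S × S => J x.1 x.2) (f := fun x => lowerOpt T R x.1)
        (f' := fun x => T.opt x.2) (fun x hx => lowerOpt_le (h3 x.1 x.2 hx)) ?_ ?_ ?_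
        (s := (t, s)) hJ
      · exact this
      · simp only [pair]
        rw [ENNReal.tsum_prod (f := fun t s => J t s * T.opt s),
          ENNReal.tsum_prod (f := fun t s => J t s * lowerOpt T R t), tsum_coupling h2]
        exact (tsum_coupling_le h4 T.opt).trans hup
      · simp only [pair]
        rw [ENNReal.tsum_prod (f := fun t s => J t s * lowerOpt T R t), tsum_coupling h2, hcons,
          heq]
        exact opt_ne_top b
      · rintro ⟨t, s⟩
        refine ne_top_of_le_ne_top (PMF.apply_ne_top μ t) ?_
        rw [← h2 t]
        exact ENNReal.le_tsum s
    choose! K k1 k2 k3 using fun t s (hJ : J t s ≠ 0) =>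
      ih d hd1 t s (hO t (hJμ t s hJ)) (h3 t s hJ) (hJeq t s hJ)
    obtain ⟨Θ', g1, g2⟩ := h1.exists_mixture hT (support_dirac_finite b) (tsum_dirac b).le h4
      ((hT a μ hred).subset fun t ⟨s, hs⟩ => hJμ t s hs) k1
    have hpair : ∀ f : S → ℝ≥0∞, ∑' t, ∑' s, J t s * pair (K t s) f ≤ pair Θ' f := by
      intro f
      refine le_trans (le_of_eq ?_) (pair_mono g2 (f := f) fun _ _ => le_rfl)
      simp only [pair, ← ENNReal.tsum_mul_right, ← ENNReal.tsum_mul_left]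
      calc ∑' (t : S) (s : S) (x : S), J t s * (K t s x * f x)
          = ∑' (t : S) (x : S) (s : S), J t s * (K t s x * f x) :=
            tsum_congr fun t => ENNReal.tsum_comm
        _ = ∑' (x : S) (t : S) (s : S), J t s * (K t s x * f x) := ENNReal.tsum_comm
        _ = _ := by simp only [mul_assoc]
    refine ⟨Θ', g1, ?_, ?_⟩
    · refine le_trans ?_ (hpair T.ind)
      calc c * payoff T A (n + 1) a ≤ d * (d * payoff T A (n + 1) a) := by
            rw [← mul_assoc]; gcongr
        _ ≤ d * pair ⇑μ (payoff T A n) := by gcongr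
        _ = ∑' (t : S) (s : S), J t s * (d * payoff T A n t) := by
            rw [tsum_coupling h2, pair_mul_right]
        _ ≤ _ := ENNReal.tsum_le_tsum fun t => ENNReal.tsum_le_tsum fun s => by
            by_cases hJ : J t s = 0
            · simp [hJ]
            · exact mul_le_mul_right (k2 t s hJ) _
    · refine le_trans ?_ (hpair _)
      rw [← heq, ← hcons, ← tsum_coupling h2]
      refine ENNReal.tsum_le_tsum fun t => ENNReal.tsum_le_tsum fun s => ?_
      by_cases hJ : J t s = 0
      · simp [hJ]
      · rw [hJeq t s hJ]
        exact mul_le_mul_right (k3 t s hJ) _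

/-- The critical case, in which a result of `a₀` is as large as the supremum at `b₀`. Rounds are
repeated from tight states; each of them comes from a finite horizon and takes at least one step, so
that the rounds combine into one hyper-derivation. -/
theorem IsMaySim.opt_attained (hR : IsMaySim T R) (hT : FinRed T) {a₀ b₀ : S} (h₀ : R a₀ b₀)
    {Θ₀ : S → ℝ≥0∞} (h : RHyper T (dirac a₀) Θ₀) (hle : T.opt b₀ ≤ pair Θ₀ T.ind) :
    ∃ Θ, RHyper T (dirac b₀) Θ ∧ T.opt b₀ ≤ pair Θ T.ind := by
  have hsup := hR.lowerOpt_superharmonic hT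
  have hind := hR.ind_le_lowerOpt
  obtain ⟨O, A, hO, hA, hpay⟩ := exists_conserving_core hsup hind h ((lowerOpt_le h₀).trans hle)
  have heq₀ : lowerOpt T R a₀ = T.opt b₀ := by
    refine le_antisymm (lowerOpt_le h₀) (hle.trans ?_)
    simpa [pair_dirac] using h.pair_le hsup hind
  -- New rounds start where the state is tight and something remains to be earned.
  set G : S → Prop := fun s => Tight T R O s ∧ ¬ T.success s ∧ T.opt s ≠ 0 with hG
  have hround : ∀ b, G b → ∃ g h : ℕ → S → ℝ≥0∞, Der T g h ∧ g 0 = dirac b ∧ h 0 = 0 ∧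
      T.opt b / 2 ≤ pair (fun s => ∑' k, h k s) T.ind ∧
      T.opt b ≤ pair (fun s => ∑' k, h k s)
        (part (Settled T R O) T.opt) := by
    rintro b ⟨⟨a, ha, hab, heq⟩, hns, hne⟩
    obtain ⟨Θ, k1, k2, k3⟩ : ∃ Θ, RHyper T (dirac b) Θ ∧ T.opt b / 2 ≤ pair Θ T.ind ∧
        T.opt b ≤ pair Θ (part (Settled T R O) T.opt) := by
      -- One factor `d` pays for the choice of a finite horizon, the other for the loss in
      -- `exists_round`; together they leave a half.
      obtain ⟨d, hd1, hd⟩ := exists_lt_one_le_mul_self (c := 2⁻¹) (by simp)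
      have hlt : d * T.opt b < T.opt b := by
        have := (ENNReal.mul_lt_mul_iff_left hne (opt_ne_top b)).2 hd1
        rwa [one_mul] at this
      obtain ⟨n, hn⟩ := lt_iSup_iff.1 (hlt.trans_le (heq ▸ hpay a ha))
      obtain ⟨Θ, k1, k2, k3⟩ := hR.exists_round hT hA n d hd1 a b ha hab heq
      refine ⟨Θ, k1, le_trans ?_ k2, k3⟩
      calc T.opt b / 2 = 2⁻¹ * T.opt b := by rw [div_eq_mul_inv, mul_comm]
        _ ≤ d * (d * T.opt b) := by rw [← mul_assoc]; gcongr
        _ ≤ _ := by gcongr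
    -- What halts at once sits at the non-successful `b`: it earns nothing, so `β ≠ 0`, and it keeps
    -- exactly its share of `opt b`, which cancels.
    obtain ⟨α, β, Θ₁, hαβ, hΘ, hβ⟩ := k1.normalise
    have hpos : T.opt b / 2 ≠ 0 := by simp [hne]
    rw [hΘ, pair_add, pair_smul, pair_smul, pair_dirac, ind_of_not_success hns, mul_zero,
      zero_add] at k2
    have hβ0 : β ≠ 0 := by
      rintro rfl
      exact hpos (by simpa using k2)
    obtain ⟨g, h, l1, l2, l3, rfl⟩ := hβ hβ0
    refine ⟨g, h, l1, l2, l3, k2.trans (mul_le_of_le_one_left' (hαβ ▸ le_add_self)), ?_⟩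
    rw [hΘ, pair_add, pair_smul, pair_smul, pair_dirac,
      part_of_pos (P := Settled T R O) (Or.inr ⟨a, ha, hab, heq⟩)] at k3
    have hβt : β ≠ ⊤ := ne_top_of_le_ne_top ENNReal.one_ne_top (hαβ ▸ le_add_self)
    have hαt : α ≠ ⊤ := ne_top_of_le_ne_top ENNReal.one_ne_top (hαβ ▸ le_self_add)
    have h4 : α * T.opt b + β * T.opt b ≤ α * T.opt b + β * pair (fun s => ∑' k, h k s)
        (part (Settled T R O) T.opt) := by
      rwa [← add_mul, hαβ, one_mul]
    exact (ENNReal.mul_le_mul_iff_right hβ0 hβt).1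
      ((ENNReal.add_le_add_iff_left (ENNReal.mul_ne_top hαt (opt_ne_top b))).1 h4)
  by_cases hb : G b₀
  swap
  · refine ⟨_, RHyper.refl _, ?_⟩
    rw [pair_dirac]
    by_cases hs : T.success b₀
    · rw [ind_of_success hs]; exact opt_le_one b₀
    · have : T.opt b₀ = 0 := by
        by_contra hne
        exact hb ⟨⟨a₀, hO, h₀, heq₀⟩, hs, hne⟩
      simp [this]
  choose! g h l1 l2 l3 l4 l5 using hround
  obtain ⟨B, Θ, hΘ, hB, hmix⟩ := exists_iterate hT l1 l2 l3 hb
  refine ⟨_, hΘ, ?_⟩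
  -- States of `G` are not successful, so leaving them out costs nothing.
  have hval : pair (part (fun s => ¬ G s) Θ) T.ind = pair Θ T.ind := by
    rw [pair_part_left]
    congr 1
    funext s
    by_cases hs : G s
    · rw [part_of_neg (P := fun s => ¬ G s) (not_not.2 hs), ind_of_not_success hs.2.1]
    · rw [part_of_pos (P := fun s => ¬ G s) hs]
  rw [hval, hmix]
  refine ENNReal.le_of_forall_lt_one_mul_le fun c hc => ?_
  -- The number of rounds after which less than `1 - c` is unearned.
  obtain ⟨n, hn⟩ := ENNReal.exists_inv_two_pow_lt (tsub_pos_of_lt hc).ne'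
  have hd : (2⁻¹ : ℝ≥0∞) ^ n ≤ 1 := pow_le_one' (by simp) n
  have hsum : 1 - 2⁻¹ ^ n + (2⁻¹ : ℝ≥0∞) ^ n = 1 := tsub_add_cancel_of_le hd
  have hc' : c ≤ 1 - 2⁻¹ ^ n := by
    refine ENNReal.le_sub_of_add_le_right (ne_top_of_le_ne_top ENNReal.one_ne_top hd) ?_
    calc c + 2⁻¹ ^ n ≤ c + (1 - c) := by gcongr
      _ = 1 := add_tsub_cancel_of_le hc.le
  refine (mul_le_mul_left hc' _).trans ?_
  have := le_pair_of_rounds (V := T.opt) (f := T.ind) l4 (fun s hs => ?_) n _ hsum B (dirac b₀)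
    (fun s hs => by rwa [eq_of_dirac_ne_zero hs]) (by rw [← hmix, hB])
  · rwa [pair_dirac] at this
  · refine (l5 s hs).trans ?_
    simp only [pair]
    rw [← ENNReal.tsum_add]
    refine ENNReal.tsum_le_tsum fun t => ?_
    rw [← mul_add]
    refine mul_le_mul_right ?_ _
    -- A settled state is successful and paid in full, or in `G` and kept for later rounds, or has
    -- `opt` zero.
    by_cases ht : T.success t
    · rw [part_of_pos (P := Settled T R O) (Or.inl ht), ind_of_success ht]
      exact (opt_le_one t).trans le_self_add
    · by_cases hG' : G t
      · rw [part_of_pos hG', part_of_pos (P := Settled T R O) (Or.inr hG'.1)]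
        exact le_add_self
      · by_cases h0 : T.opt t = 0
        · simp [part, h0]
        · rw [part_of_neg (P := Settled T R O) fun hor => ?_]
          · exact zero_le
          · exact hor.elim ht fun hor => hG' ⟨hor, ht, h0⟩

/-- Attainment matters only when the given result is not below `opt b`; otherwise a nearly optimal
hyper-derivation suffices. -/
theorem IsMaySim.hoareLE (hR : IsMaySim T R) (hT : FinRed T) {a b : S} (hab : R a b) :
    HoareLE (T.results (SubDist.point a)) (T.results (SubDist.point b)) := by
  rintro p ⟨Θ, ⟨hΘ, -⟩, rfl⟩
  have h := (hyper_iff _ _).1 hΘ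
  rw [coe_point] at h
  rw [value_eq_pair]
  obtain ⟨Θ', h1, h2⟩ : ∃ Θ', RHyper T (dirac b) Θ' ∧ pair Θ T.ind ≤ pair Θ' T.ind := by
    by_cases hlt : pair Θ T.ind < T.opt b
    · obtain ⟨Θ', h1, h2⟩ := exists_lt_of_lt_opt hlt
      exact ⟨Θ', h1, h2.le⟩
    · obtain ⟨Θ', h1, h2⟩ := hR.opt_attained hT hab h (not_lt.1 hlt)
      refine ⟨Θ', h1, le_trans ?_ h2⟩
      have := h.pair_le (hR.lowerOpt_superharmonic hT) hR.ind_le_lowerOpt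
      rw [pair_dirac] at this
      exact this.trans (lowerOpt_le hab)
  obtain ⟨q, hq, hle⟩ := exists_extreme_subDist hT h1
  exact ⟨q, hq, h2.trans hle⟩

end Soundness

end Wireless
namespace Wireless
universe u v w

-- Success as an enabled ω

section Success

variable {C : Sig.{u}} {D : Env C}

/-- The clause `ω` is enabled in the state. -/
inductive State.Enabled (D : Env C) : State C 0 → Prop
  | omega : State.Enabled D .omega
  | sumL {s t : State C 0} : State.Enabled D s → State.Enabled D (.sum s t)
  | sumR {s t : State C 0} : State.Enabled D t → State.Enabled D (.sum s t)
  | branchTrue {b : C.Pred} {args : Fin (C.predArity b) → Exp C 0} {s t : State C 0} :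
      testEval b args = true → State.Enabled D s → State.Enabled D (.branch b args s t)
  | branchFalse {b : C.Pred} {args : Fin (C.predArity b) → Exp C 0} {s t : State C 0} :
      testEval b args = false → State.Enabled D t → State.Enabled D (.branch b args s t)
  | call {A : C.Const} {args : Fin (C.arity A) → Exp C 0} :
      State.Enabled D ((D A).subst args) → State.Enabled D (.call A args)

theorem State.enabled_sum {s t : State C 0} :
    State.Enabled D (.sum s t) ↔ State.Enabled D s ∨ State.Enabled D t :=
  ⟨fun h => by cases h with
    | sumL h => exact Or.inl h
    | sumR h => exact Or.inr h, fun h => h.elim .sumL .sumR⟩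

/-- Symmetry and transitivity rule out inverting a congruence directly, so success is tested by an
invariant of it. -/
theorem StateCongr.enabled_iff {s t : State C 0} (h : StateCongr D s t) :
    State.Enabled D s ↔ State.Enabled D t := by
  induction h with
  | refl => rfl
  | symm _ ih => exact ih.symm
  | trans _ _ ih₁ ih₂ => exact ih₁.trans ih₂
  | sum _ _ ih₁ ih₂ => rw [State.enabled_sum, State.enabled_sum, ih₁, ih₂]
  | comm => rw [State.enabled_sum, State.enabled_sum, or_comm]
  | assoc => simp only [State.enabled_sum, or_assoc]
  | unit s =>
    rw [State.enabled_sum]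
    exact ⟨fun h => h.elim id (fun h => by cases h), Or.inl⟩
  | branchTrue s t hb =>
    refine ⟨fun h => ?_, .branchTrue hb⟩
    cases h with
    | branchTrue _ h => exact h
    | branchFalse hb' _ => simp [hb] at hb'
  | branchFalse s t hb =>
    refine ⟨fun h => ?_, .branchFalse hb⟩
    cases h with
    | branchFalse _ h => exact h
    | branchTrue hb' _ => simp [hb] at hb'
  | call A args =>
    refine ⟨fun h => ?_, .call⟩
    cases h with
    | call h => exact h

theorem State.Enabled.exists_congr {s : State C 0} (h : State.Enabled D s) :
    ∃ t, StateCongr D s (.sum .omega t) := by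
  induction h with
  | omega => exact ⟨.nil, (StateCongr.unit _).symm⟩
  | @sumL s t _ ih =>
    obtain ⟨r, hr⟩ := ih
    exact ⟨.sum r t, (StateCongr.sum hr (.refl t)).trans (.assoc _ _ _)⟩
  | @sumR s t _ ih =>
    obtain ⟨r, hr⟩ := ih
    exact ⟨.sum r s, (StateCongr.comm _ _).trans ((StateCongr.sum hr (.refl s)).trans (.assoc _ _ _))⟩
  | branchTrue hb _ ih =>
    obtain ⟨r, hr⟩ := ih
    exact ⟨r, (StateCongr.branchTrue _ _ hb).trans hr⟩
  | branchFalse hb _ ih =>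
    obtain ⟨r, hr⟩ := ih
    exact ⟨r, (StateCongr.branchFalse _ _ hb).trans hr⟩
  | call _ ih =>
    obtain ⟨r, hr⟩ := ih
    exact ⟨r, (StateCongr.call _ _).trans hr⟩

/-- The clause `ω` is enabled at some node of the system term. -/
def Sys.Enabled (D : Env C) : Sys C → Prop
  | .node s _ => State.Enabled D s
  | .par M N => M.Enabled D ∨ N.Enabled D
  | .nil => False

theorem SysCongr.enabled_iff {M N : Sys C} (h : SysCongr D M N) : M.Enabled D ↔ N.Enabled D := by
  induction h with
  | refl => rfl
  | symm _ ih => exact ih.symm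
  | trans _ _ ih₁ ih₂ => exact ih₁.trans ih₂
  | par _ _ ih₁ ih₂ => exact or_congr ih₁ ih₂
  | comm => exact or_comm
  | assoc => exact or_assoc
  | unit => simp [Sys.Enabled]
  | node _ h => exact h.enabled_iff

/-- Success quantifies over all congruent terms; the invariant `Sys.Enabled` decomposes along
parallel composition, which the treatment of composites needs. -/
theorem Sys.success_iff (M : Sys C) : M.Success D ↔ M.Enabled D := by
  constructor
  · rintro ⟨M', s, n, h⟩
    exact h.enabled_iff.2 (Or.inr (.sumL .omega))
  · intro h
    induction M with
    | node s n =>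
      obtain ⟨t, ht⟩ := State.Enabled.exists_congr h
      exact ⟨.nil, t, n, (SysCongr.node n ht).trans ((SysCongr.unit _).symm.trans (.comm _ _))⟩
    | par M N ihM ihN =>
      rcases h with h | h
      · obtain ⟨M', s, n, hc⟩ := ihM h
        exact ⟨.par M' N, s, n, (SysCongr.par hc (.refl N)).trans ((SysCongr.assoc _ _ _).trans
          ((SysCongr.par (.refl M') (.comm _ _)).trans (SysCongr.assoc _ _ _).symm))⟩
      · obtain ⟨N', s, n, hc⟩ := ihN h
        exact ⟨.par M N', s, n, (SysCongr.par (.refl M) hc).trans (SysCongr.assoc _ _ _).symm⟩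
    | nil => exact h.elim

end Success

-- Code free of ω is closed under transitions

section OmegaFree

variable {C : Sig.{u}} {D : Env C} {K : Set C.Const}

mutual
theorem Proc.OmegaFree.subst {n m : ℕ} (σ : Fin n → Exp C m) :
    ∀ p : Proc C n, p.OmegaFree K → (p.subst σ).OmegaFree K
  | .ret s, h => by
    simp only [Proc.subst, Proc.OmegaFree] at h ⊢
    exact State.OmegaFree.subst σ s h
  | .choice r p q, h => by
    simp only [Proc.subst, Proc.OmegaFree] at h ⊢
    exact ⟨Proc.OmegaFree.subst σ p h.1, Proc.OmegaFree.subst σ q h.2⟩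
theorem State.OmegaFree.subst {n m : ℕ} (σ : Fin n → Exp C m) :
    ∀ s : State C n, s.OmegaFree K → (s.subst σ).OmegaFree K
  | .send c e p, h => by
    simp only [State.subst, State.OmegaFree] at h ⊢
    exact Proc.OmegaFree.subst σ p h
  | .recv c p, h => by
    simp only [State.subst, State.OmegaFree] at h ⊢
    exact Proc.OmegaFree.subst (Exp.up σ) p h
  | .omega, h => by simp only [State.OmegaFree] at h
  | .sum s t, h => by
    simp only [State.subst, State.OmegaFree] at h ⊢
    exact ⟨State.OmegaFree.subst σ s h.1, State.OmegaFree.subst σ t h.2⟩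
  | .branch b args s t, h => by
    simp only [State.subst, State.OmegaFree] at h ⊢
    exact ⟨State.OmegaFree.subst σ s h.1, State.OmegaFree.subst σ t h.2⟩
  | .tau p, h => by
    simp only [State.subst, State.OmegaFree] at h ⊢
    exact Proc.OmegaFree.subst σ p h
  | .call A args, h => by
    simp only [State.subst, State.OmegaFree] at h ⊢
    exact h
  | .nil, _ => by simp only [State.subst, State.OmegaFree]
end

theorem Proc.mem_support_choice {n : ℕ} {r : Prob} {p q : Proc C n} {s : State C n}
    (hs : s ∈ (Proc.choice r p q).interp.support) : s ∈ p.interp.support ∨ s ∈ q.interp.support := by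
  rw [Proc.interp, PMF.mem_support_bind_iff] at hs
  obtain ⟨b, -, hb⟩ := hs
  cases b
  · exact Or.inr hb
  · exact Or.inl hb

theorem Proc.interp_support {n : ℕ} (P : Proc C n → Prop) (Q : State C n → Prop)
    (hret : ∀ s, P (.ret s) → Q s) (hchoice : ∀ r p q, P (.choice r p q) → P p ∧ P q) :
    ∀ p : Proc C n, P p → ∀ s ∈ p.interp.support, Q s
  | .ret t, h, s, hs => by
    simp only [Proc.interp, PMF.support_pure, Set.mem_singleton_iff] at hs
    exact hs ▸ hret t h
  | .choice r p q, h, s, hs => by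
    rcases Proc.mem_support_choice hs with hs | hs
    · exact Proc.interp_support P Q hret hchoice p (hchoice r p q h).1 s hs
    · exact Proc.interp_support P Q hret hchoice q (hchoice r p q h).2 s hs

theorem Proc.OmegaFree.interp {n : ℕ} (p : Proc C n) (h : p.OmegaFree K) :
    ∀ s ∈ p.interp.support, s.OmegaFree K :=
  Proc.interp_support (fun p => p.OmegaFree K) (fun s => s.OmegaFree K)
    (fun s h => by simpa only [Proc.OmegaFree] using h)
    (fun r p q h => by simpa only [Proc.OmegaFree] using h) p h

theorem Proc.finite_support_interp {n : ℕ} : ∀ p : Proc C n, p.interp.support.Finite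
  | .ret s => by simp [Proc.interp]
  | .choice r p q =>
    ((Proc.finite_support_interp p).union (Proc.finite_support_interp q)).subset
      fun _ hs => Proc.mem_support_choice hs

theorem StateStep.finite_support {s : State C 0} {α : Act C} {Δ : PMF (State C 0)}
    (h : StateStep D s α Δ) : Δ.support.Finite := by
  induction h with
  | send | recv | tau => exact Proc.finite_support_interp _
  | sumL _ ih | sumR _ ih | branchTrue _ _ ih | branchFalse _ _ ih | call _ ih => exact ih

theorem StateStep.omegaFree (hK : ∀ A ∈ K, (D A).OmegaFree K) {s : State C 0} {α : Act C}
    {Δ : PMF (State C 0)} (h : StateStep D s α Δ) (hs : s.OmegaFree K) :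
    ∀ t ∈ Δ.support, t.OmegaFree K := by
  induction h with
  | send c e p =>
    simp only [State.OmegaFree] at hs
    exact Proc.OmegaFree.interp p hs
  | recv c p v =>
    simp only [State.OmegaFree] at hs
    exact Proc.OmegaFree.interp _ (Proc.OmegaFree.subst _ p hs)
  | tau p =>
    simp only [State.OmegaFree] at hs
    exact Proc.OmegaFree.interp p hs
  | sumL _ ih =>
    simp only [State.OmegaFree] at hs
    exact ih hs.1
  | sumR _ ih =>
    simp only [State.OmegaFree] at hs
    exact ih hs.2
  | branchTrue _ _ ih =>
    simp only [State.OmegaFree] at hs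
    exact ih hs.1
  | branchFalse _ _ ih =>
    simp only [State.OmegaFree] at hs
    exact ih hs.2
  | @call A args α Δ _ ih =>
    simp only [State.OmegaFree] at hs
    exact ih (State.OmegaFree.subst args (D A) (hK A hs))

theorem State.OmegaFree.not_enabled (hK : ∀ A ∈ K, (D A).OmegaFree K) {s : State C 0}
    (hs : s.OmegaFree K) : ¬ State.Enabled D s := by
  intro h
  induction h with
  | omega => simp only [State.OmegaFree] at hs
  | sumL _ ih =>
    simp only [State.OmegaFree] at hs
    exact ih hs.1
  | sumR _ ih =>
    simp only [State.OmegaFree] at hs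
    exact ih hs.2
  | branchTrue _ _ ih =>
    simp only [State.OmegaFree] at hs
    exact ih hs.1
  | branchFalse _ _ ih =>
    simp only [State.OmegaFree] at hs
    exact ih hs.2
  | @call A args _ ih =>
    simp only [State.OmegaFree] at hs
    exact ih (State.OmegaFree.subst args (D A) (hK A hs))

theorem Sys.OmegaFree.not_enabled (hK : ∀ A ∈ K, (D A).OmegaFree K) {M : Sys C}
    (hM : M.OmegaFree K) : ¬ M.Enabled D := by
  induction M with
  | node s n => exact State.OmegaFree.not_enabled hK hM
  | par M N ihM ihN => exact fun h => h.elim (ihM hM.1) (ihN hM.2)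
  | nil => exact id

end OmegaFree

-- Invariants of system steps and locality of the graph

section SysSteps

variable {C : Sig.{u}} {D : Env C} {Γ Γ' : Graph C}

theorem mem_support_parDist {Δ Θ : PMF (Sys C)} {M : Sys C} :
    M ∈ (parDist Δ Θ).support ↔ ∃ A ∈ Δ.support, ∃ B ∈ Θ.support, M = .par A B := by
  simp only [parDist, PMF.mem_support_bind_iff, PMF.mem_support_map_iff, eq_comm]

theorem finite_support_parDist {Δ Θ : PMF (Sys C)} (hΔ : Δ.support.Finite)
    (hΘ : Θ.support.Finite) : (parDist Δ Θ).support.Finite := by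
  refine (hΔ.image2 Sys.par hΘ).subset fun M hM => ?_
  obtain ⟨A, hA, B, hB, rfl⟩ := mem_support_parDist.1 hM
  exact Set.mem_image2_of_mem hA hB

theorem parDist_pure_pure (M N : Sys C) :
    parDist (PMF.pure M) (PMF.pure N) = PMF.pure (.par M N) := by
  simp [parDist, PMF.pure_map]

theorem finite_support_map {α : Type v} {β : Type w} {p : PMF α} (f : α → β)
    (h : p.support.Finite) : (p.map f).support.Finite := by
  rw [PMF.support_map]
  exact h.image f

theorem SysStep.finite_support {M : Sys C} {α : SysAct C} {Δ : PMF (Sys C)}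
    (h : SysStep D Γ M α Δ) : Δ.support.Finite := by
  induction h with
  | broad h => exact finite_support_map _ h.finite_support
  | hear h _ => exact finite_support_map _ h.finite_support
  | tau h => exact finite_support_map _ h.finite_support
  | deaf | disc | nil => simp
  | tauPropL _ ih => exact finite_support_parDist ih (by simp)
  | tauPropR _ ih => exact finite_support_parDist (by simp) ih
  | prop _ _ ih₁ ih₂ | syncL _ _ ih₁ ih₂ | syncR _ _ ih₁ ih₂ =>
    exact finite_support_parDist ih₁ ih₂

theorem SysStep.names_eq {M : Sys C} {α : SysAct C} {Δ : PMF (Sys C)}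
    (h : SysStep D Γ M α Δ) : ∀ M' ∈ Δ.support, M'.names = M.names := by
  have hpar : ∀ {M N : Sys C} {Δ Θ : PMF (Sys C)}, (∀ M' ∈ Δ.support, M'.names = M.names) →
      (∀ N' ∈ Θ.support, N'.names = N.names) →
      ∀ L ∈ (parDist Δ Θ).support, L.names = (Sys.par M N).names := by
    intro M N Δ Θ h1 h2 L hL
    obtain ⟨A, hA, B, hB, rfl⟩ := mem_support_parDist.1 hL
    simp [Sys.names, h1 A hA, h2 B hB]
  have hmap : ∀ {s : State C 0} {n : C.Node} {Δ : PMF (State C 0)},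
      ∀ M' ∈ (Δ.map fun t => Sys.node t n).support, M'.names = (Sys.node s n).names := by
    intro s n Δ M' hM'
    obtain ⟨t, -, rfl⟩ := (PMF.mem_support_map_iff _ _ _).1 hM'
    rfl
  induction h with
  | broad h => exact hmap
  | hear h _ => exact hmap
  | tau h => exact hmap
  | deaf | disc | nil => simp
  | tauPropL _ ih => exact hpar ih (by simp)
  | tauPropR _ ih => exact hpar (by simp) ih
  | prop _ _ ih₁ ih₂ | syncL _ _ ih₁ ih₂ | syncR _ _ ih₁ ih₂ => exact hpar ih₁ ih₂

theorem SysStep.omegaFree {K : Set C.Const} (hK : ∀ A ∈ K, (D A).OmegaFree K) {M : Sys C}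
    {α : SysAct C} {Δ : PMF (Sys C)} (h : SysStep D Γ M α Δ) (hM : M.OmegaFree K) :
    ∀ M' ∈ Δ.support, M'.OmegaFree K := by
  have hpar : ∀ {Δ Θ : PMF (Sys C)}, (∀ M' ∈ Δ.support, M'.OmegaFree K) →
      (∀ N' ∈ Θ.support, N'.OmegaFree K) → ∀ L ∈ (parDist Δ Θ).support, L.OmegaFree K := by
    intro Δ Θ h1 h2 L hL
    obtain ⟨A, hA, B, hB, rfl⟩ := mem_support_parDist.1 hL
    exact ⟨h1 A hA, h2 B hB⟩
  have hmap : ∀ {s : State C 0} {n : C.Node} {α : Act C} {Δ : PMF (State C 0)},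
      StateStep D s α Δ → s.OmegaFree K →
      ∀ M' ∈ (Δ.map fun t => Sys.node t n).support, M'.OmegaFree K := by
    intro s n α Δ h hs M' hM'
    obtain ⟨t, ht, rfl⟩ := (PMF.mem_support_map_iff _ _ _).1 hM'
    exact h.omegaFree hK hs t ht
  induction h with
  | broad h => exact hmap h hM
  | hear h _ => exact hmap h hM
  | tau h => exact hmap h hM
  | deaf | disc | nil => simpa using hM
  | tauPropL _ ih => exact hpar (ih hM.1) (by simpa using hM.2)
  | tauPropR _ ih => exact hpar (by simpa using hM.1) (ih hM.2)
  | prop _ _ ih₁ ih₂ | syncL _ _ ih₁ ih₂ | syncR _ _ ih₁ ih₂ =>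
    exact hpar (ih₁ hM.1) (ih₂ hM.2)

/-- The node at which an action takes place. -/
def SysAct.loc : SysAct C → C.Node
  | .recv m _ _ => m
  | .send m _ _ => m
  | .tau m => m

/-- Only the connections from the acting node to the nodes of the system matter for its steps. -/
theorem SysStep.congr_graph {M : Sys C} {α : SysAct C} {Δ : PMF (Sys C)}
    (h : SysStep D Γ M α Δ) (hΓ : ∀ n ∈ M.names, (Γ.edge α.loc n ↔ Γ'.edge α.loc n)) :
    SysStep D Γ' M α Δ := by
  induction h with
  | broad h => exact .broad h
  | hear h he => exact .hear h ((hΓ _ (by simp [Sys.names])).1 he)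
  | tau h => exact .tau h
  | deaf h => exact .deaf h
  | disc he => exact .disc fun he' => he ((hΓ _ (by simp [Sys.names])).2 he')
  | nil => exact .nil
  | tauPropL _ ih => exact .tauPropL (ih fun n hn => hΓ n (by simp [Sys.names, hn]))
  | tauPropR _ ih => exact .tauPropR (ih fun n hn => hΓ n (by simp [Sys.names, hn]))
  | prop _ _ ih₁ ih₂ =>
    exact .prop (ih₁ fun n hn => hΓ n (by simp [Sys.names, hn]))
      (ih₂ fun n hn => hΓ n (by simp [Sys.names, hn]))
  | syncL _ _ ih₁ ih₂ =>
    exact .syncL (ih₁ fun n hn => hΓ n (by simp [Sys.names, hn]))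
      (ih₂ fun n hn => hΓ n (by simp [Sys.names, hn]))
  | syncR _ _ ih₁ ih₂ =>
    exact .syncR (ih₁ fun n hn => hΓ n (by simp [Sys.names, hn]))
      (ih₂ fun n hn => hΓ n (by simp [Sys.names, hn]))

theorem SysStep.loc_mem {M : Sys C} {α : SysAct C} {Δ : PMF (Sys C)} (h : SysStep D Γ M α Δ)
    (hα : ∀ m c v, α ≠ .recv m c v) : α.loc ∈ M.names := by
  induction h with
  | broad | tau => simp [Sys.names, SysAct.loc]
  | hear | deaf | disc | nil | prop => exact absurd rfl (hα _ _ _)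
  | tauPropL _ ih => simp [Sys.names, ih hα]
  | tauPropR _ ih => simp [Sys.names, ih hα]
  | syncL _ _ ih₁ _ => simp [Sys.names, show _ ∈ _ from ih₁ hα]
  | syncR _ _ _ ih₂ => simp [Sys.names, show _ ∈ _ from ih₂ hα]

end SysSteps

-- Reception by a set of nodes

section Hearing

variable {C : Sig.{u}} {D : Env C} {Γ : Graph C}

/-- The system receives the value `v` along `c` exactly at its nodes in `η`. -/
inductive Hears (D : Env C) (η : Set C.Node) (c : C.Chan) (v : C.Val) :
    Sys C → PMF (Sys C) → Prop
  | hear {s : State C 0} {n : C.Node} {Δ : PMF (State C 0)} :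
      StateStep D s (.recv c v) Δ → n ∈ η →
      Hears D η c v (.node s n) (Δ.map fun t => .node t n)
  | deaf {s : State C 0} {n : C.Node} : (¬ ∃ Δ, StateStep D s (.recv c v) Δ) →
      Hears D η c v (.node s n) (PMF.pure (.node s n))
  | disc {s : State C 0} {n : C.Node} : n ∉ η →
      Hears D η c v (.node s n) (PMF.pure (.node s n))
  | nil : Hears D η c v .nil (PMF.pure .nil)
  | par {M N : Sys C} {Δ Θ : PMF (Sys C)} : Hears D η c v M Δ → Hears D η c v N Θ →
      Hears D η c v (.par M N) (parDist Δ Θ)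

/-- Reception depends on the set of listeners within earshot and not on the sender. Therefore the
tester reacts alike to broadcasts of different senders that have the same audience. -/
theorem Hears.sysStep {η : Set C.Node} {m : C.Node} {c : C.Chan} {v : C.Val} {M : Sys C}
    {Δ : PMF (Sys C)} (h : Hears D η c v M Δ) (hη : ∀ n ∈ M.names, (n ∈ η ↔ Γ.edge m n)) :
    SysStep D Γ M (.recv m c v) Δ := by
  induction h with
  | hear h hn => exact .hear h ((hη _ (by simp [Sys.names])).1 hn)
  | deaf h => exact .deaf h
  | disc hn => exact .disc fun he => hn ((hη _ (by simp [Sys.names])).2 he)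
  | nil => exact .nil
  | par _ _ ih₁ ih₂ =>
    exact .prop (ih₁ fun n hn => hη n (by simp [Sys.names, hn]))
      (ih₂ fun n hn => hη n (by simp [Sys.names, hn]))

theorem SysStep.hears {η : Set C.Node} {m : C.Node} {c : C.Chan} {v : C.Val} {M : Sys C}
    {Δ : PMF (Sys C)} (h : SysStep D Γ M (.recv m c v) Δ)
    (hη : ∀ n ∈ M.names, (n ∈ η ↔ Γ.edge m n)) : Hears D η c v M Δ := by
  generalize hα : SysAct.recv m c v = α at h
  induction h with
  | broad | tau | tauPropL | tauPropR | syncL | syncR => cases hα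
  | hear h he =>
    cases hα
    exact .hear h ((hη _ (by simp [Sys.names])).2 he)
  | deaf h =>
    cases hα
    exact .deaf h
  | disc he =>
    cases hα
    exact .disc fun hn => he ((hη _ (by simp [Sys.names])).1 hn)
  | nil => exact .nil
  | prop _ _ ih₁ ih₂ =>
    exact .par (ih₁ (fun n hn => hη n (by simp [Sys.names, hn])) hα)
      (ih₂ (fun n hn => hη n (by simp [Sys.names, hn])) hα)

theorem Hears.eq_pure {η : Set C.Node} {c : C.Chan} {v : C.Val} {M : Sys C} {Δ : PMF (Sys C)}
    (h : Hears D η c v M Δ) (hη : ∀ n ∈ M.names, n ∉ η) : Δ = PMF.pure M := by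
  induction h with
  | hear _ hn => exact absurd hn (hη _ (by simp [Sys.names]))
  | deaf | disc | nil => rfl
  | par _ _ ih₁ ih₂ =>
    rw [ih₁ fun n hn => hη n (by simp [Sys.names, hn]),
      ih₂ fun n hn => hη n (by simp [Sys.names, hn]), parDist_pure_pure]

theorem hears_pure {η : Set C.Node} (c : C.Chan) (v : C.Val) {M : Sys C}
    (hη : ∀ n ∈ M.names, n ∉ η) : Hears D η c v M (PMF.pure M) := by
  induction M with
  | node s n => exact .disc (hη n (by simp [Sys.names]))
  | par M N ih₁ ih₂ =>
    rw [← parDist_pure_pure]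
    exact .par (ih₁ fun n hn => hη n (by simp [Sys.names, hn]))
      (ih₂ fun n hn => hη n (by simp [Sys.names, hn]))
  | nil => exact .nil

theorem Hears.finite_support {η : Set C.Node} {c : C.Chan} {v : C.Val} {M : Sys C}
    {Δ : PMF (Sys C)} (h : Hears D η c v M Δ) : Δ.support.Finite := by
  induction h with
  | hear h _ => exact finite_support_map _ h.finite_support
  | deaf | disc | nil => simp
  | par _ _ ih₁ ih₂ => exact finite_support_parDist ih₁ ih₂

theorem Hears.names_eq {η : Set C.Node} {c : C.Chan} {v : C.Val} {M : Sys C}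
    {Δ : PMF (Sys C)} (h : Hears D η c v M Δ) : ∀ M' ∈ Δ.support, M'.names = M.names := by
  induction h with
  | hear h _ =>
    intro M' hM'
    obtain ⟨t, -, rfl⟩ := (PMF.mem_support_map_iff _ _ _).1 hM'
    rfl
  | deaf | disc | nil => simp
  | par _ _ ih₁ ih₂ =>
    intro M' hM'
    obtain ⟨A, hA, B, hB, rfl⟩ := mem_support_parDist.1 hM'
    simp [Sys.names, ih₁ A hA, ih₂ B hB]

/-- Apply a kernel to each component of a parallel composition. -/
noncomputable def parKernel (K L : Sys C → PMF (Sys C)) : Sys C → PMF (Sys C)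
  | .par M N => parDist (K M) (L N)
  | M => PMF.pure M

/-- The same independent draws are made in two different orders. -/
theorem parDist_bind (Δ Θ : PMF (Sys C)) (K L : Sys C → PMF (Sys C)) :
    parDist (Δ.bind K) (Θ.bind L) = (parDist Δ Θ).bind (parKernel K L) := by
  simp only [parDist, PMF.map, PMF.bind_bind, Function.comp_def, PMF.pure_bind, parKernel]
  congr 1
  funext A
  exact PMF.bind_comm _ _ _

/-- Reception at two disjoint sets of nodes can be done one after the other. -/
theorem Hears.split {η₁ η₂ : Set C.Node} {c : C.Chan} {v : C.Val} {M : Sys C} {Δ : PMF (Sys C)}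
    (h : Hears D (η₁ ∪ η₂) c v M Δ) (hη : η₁ ∩ η₂ = ∅) :
    ∃ (Δ₁ : PMF (Sys C)) (K : Sys C → PMF (Sys C)), Hears D η₁ c v M Δ₁ ∧
      (∀ M₁ ∈ Δ₁.support, Hears D η₂ c v M₁ (K M₁)) ∧ Δ = Δ₁.bind K := by
  induction h with
  | @hear s n Δ h hn =>
    -- A node hears in the instalment whose audience contains it. By disjointness a node that
    -- changed in the first is out of reach of the second, and a node in the second is still in its
    -- original state.
    by_cases h1 : n ∈ η₁
    · refine ⟨_, PMF.pure, .hear h h1, fun M₁ hM₁ => ?_, (PMF.bind_pure _).symm⟩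
      obtain ⟨t, -, rfl⟩ := (PMF.mem_support_map_iff _ _ _).1 hM₁
      exact .disc fun h2 => (Set.eq_empty_iff_forall_notMem.1 hη n) ⟨h1, h2⟩
    · refine ⟨_, fun _ => Δ.map fun t => .node t n, .disc h1, fun M₁ hM₁ => ?_,
        by rw [PMF.pure_bind]⟩
      obtain rfl : M₁ = .node s n := by simpa using hM₁
      exact .hear h (hn.resolve_left h1)
  | @deaf s n h =>
    refine ⟨_, PMF.pure, .deaf h, fun M₁ hM₁ => ?_, (PMF.bind_pure _).symm⟩
    obtain rfl : M₁ = .node s n := by simpa using hM₁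
    exact .deaf h
  | @disc s n hn =>
    refine ⟨_, PMF.pure, .disc fun h => hn (Or.inl h), fun M₁ hM₁ => ?_, (PMF.bind_pure _).symm⟩
    obtain rfl : M₁ = .node s n := by simpa using hM₁
    exact .disc fun h => hn (Or.inr h)
  | nil =>
    refine ⟨_, PMF.pure, .nil, fun M₁ hM₁ => ?_, (PMF.bind_pure _).symm⟩
    obtain rfl : M₁ = .nil := by simpa using hM₁
    exact .nil
  | par _ _ ih₁ ih₂ =>
    obtain ⟨Δ₁, K, h1, h2, rfl⟩ := ih₁
    obtain ⟨Θ₁, L, k1, k2, rfl⟩ := ih₂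
    refine ⟨parDist Δ₁ Θ₁, parKernel K L, .par h1 k1, fun M₁ hM₁ => ?_, parDist_bind _ _ _ _⟩
    obtain ⟨A, hA, B, hB, rfl⟩ := mem_support_parDist.1 hM₁
    exact .par (h2 A hA) (k2 B hB)

end Hearing

end Wireless
namespace Wireless
universe u v w

-- Product measures

section Tensor

variable {S : Type u} {Y : Type v} {Z : Type w}

/-- The product of two measures. -/
noncomputable def tensor (g : Y → ℝ≥0∞) (h : Z → ℝ≥0∞) : Y × Z → ℝ≥0∞ := fun x => g x.1 * h x.2

theorem tsum_tensor (g : Y → ℝ≥0∞) (h : Z → ℝ≥0∞) :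
    ∑' x, tensor g h x = (∑' y, g y) * ∑' z, h z := by
  unfold tensor
  rw [ENNReal.tsum_prod (f := fun y z => g y * h z)]
  simp only [ENNReal.tsum_mul_left, ENNReal.tsum_mul_right]

theorem tensor_ne_zero {g : Y → ℝ≥0∞} {h : Z → ℝ≥0∞} {x : Y × Z} :
    tensor g h x ≠ 0 ↔ g x.1 ≠ 0 ∧ h x.2 ≠ 0 := mul_ne_zero_iff

theorem finite_support_tensor {g : Y → ℝ≥0∞} {h : Z → ℝ≥0∞} (hg : g.support.Finite)
    (hh : h.support.Finite) : (tensor g h).support.Finite :=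
  (hg.prod hh).subset fun _ hx => ⟨(tensor_ne_zero.1 hx).1, (tensor_ne_zero.1 hx).2⟩

theorem mix_tensor {Y' Z' : Type*} (g : Y → ℝ≥0∞) (h : Z → ℝ≥0∞) (F : Y → Y' → ℝ≥0∞)
    (H : Z → Z' → ℝ≥0∞) :
    (mix (tensor g h) fun x => tensor (F x.1) (H x.2)) = tensor (mix g F) (mix h H) := by
  funext x
  simp only [mix, tensor]
  rw [ENNReal.tsum_prod (f := fun y z => g y * h z * (F y x.1 * H z x.2)),
    ← ENNReal.tsum_mul_right]
  refine tsum_congr fun y => ?_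
  rw [← ENNReal.tsum_mul_left]
  exact tsum_congr fun z => by ring

theorem mix_tensor_left {Y' : Type*} (g : Y → ℝ≥0∞) (F : Y → Y' → ℝ≥0∞) (h : Z → ℝ≥0∞) :
    (mix g fun y => tensor (F y) h) = tensor (mix g F) h := by
  funext x
  simp only [mix, tensor]
  rw [← ENNReal.tsum_mul_right]
  exact tsum_congr fun y => by ring

theorem mix_tensor_iterated (g : Y → ℝ≥0∞) (h : Z → ℝ≥0∞) (F : Y × Z → S → ℝ≥0∞) :
    mix (tensor g h) F = mix g fun y => mix h fun z => F (y, z) := by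
  funext s
  simp only [mix, tensor]
  rw [ENNReal.tsum_prod (f := fun y z => g y * h z * F (y, z) s)]
  refine tsum_congr fun y => ?_
  rw [← ENNReal.tsum_mul_left]
  exact tsum_congr fun z => by ring

theorem coe_bind (p : PMF Y) (K : Y → PMF Z) : ⇑(p.bind K) = mix ⇑p fun y => ⇑(K y) := by
  funext z
  exact PMF.bind_apply p K z

theorem coe_map (p : PMF Y) (f : Y → Z) : ⇑(p.map f) = mix ⇑p fun y => dirac (f y) :=
  coe_bind p _

end Tensor

-- Transport of derivations along maps of states

section Mapping

variable {S : Type u} {S' : Type v}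

theorem RStep.exists_source {r : S → PMF S → Prop} {g l : S → ℝ≥0∞} (h : RStep r g l) {t : S}
    (ht : l t ≠ 0) : ∃ s μ, r s μ ∧ t ∈ μ.support := by
  induction h with
  | zero => exact absurd rfl ht
  | @cons g l c s μ hr _ ih =>
    by_cases h0 : l t = 0
    · refine ⟨s, μ, hr, fun h1 => ht ?_⟩
      simp [h0, h1]
    · exact ih h0

theorem RStep.map {r : S → PMF S → Prop} {r' : S' → PMF S' → Prop} (f : S → S')
    (hr : ∀ s μ, r s μ → r' (f s) (μ.map f)) {g l : S → ℝ≥0∞} (h : RStep r g l) :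
    RStep r' (Wireless.mix g fun s => dirac (f s)) (Wireless.mix l fun s => dirac (f s)) := by
  induction h with
  | zero => convert RStep.zero (r := r') using 1 <;> funext t <;> simp [Wireless.mix]
  | @cons g l c s μ h _ ih =>
    rw [mix_add_left, mix_add_left, mix_smul_left, mix_smul_left, mix_of_dirac, ← coe_map]
    exact .cons c (hr s μ h) ih

/-- Hyper-derivations are mapped along a map of states which preserves transitions. -/
theorem RHyper.map {T : TestingStructure S} {T' : TestingStructure S'} (f : S → S') (P : S → Prop)
    (hP : ∀ s μ, P s → ¬ T.success s → T.red s μ → ∀ t ∈ μ.support, P t)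
    (hr : ∀ s μ, P s → ¬ T.success s → T.red s μ → T'.red (f s) (μ.map f))
    (hs : ∀ s, P s → ¬ T'.success (f s)) {Δ Θ : S → ℝ≥0∞} (h : RHyper T Δ Θ)
    (hΔ : ∀ s, Δ s ≠ 0 → P s) :
    RHyper T' (mix Δ fun s => dirac (f s)) (mix Θ fun s => dirac (f s)) := by
  obtain ⟨go, halt, hD, rfl, rfl⟩ := h
  have hstep : ∀ k, RStep (fun s μ => (T.red s μ ∧ ¬ T.success s) ∧ go k s ≠ 0) (go k)
      (go (k + 1) + halt (k + 1)) := fun k =>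
    ((hD.step_of_not_success k).restrict (fun _ => le_rfl) fun _ => le_rfl).mono
      fun s μ h => ⟨h.1, h.2.1⟩
  have hgo : ∀ k s, go k s ≠ 0 → P s := by
    intro k
    induction k with
    | zero => exact fun s h0 => hΔ s fun h1 => h0 (add_eq_zero.1 h1).1
    | succ k ih =>
      intro t ht
      obtain ⟨s, μ, h1, h2⟩ := (hstep k).exists_source (t := t)
        fun h1 => ht (add_eq_zero.1 h1).1
      exact hP s μ (ih s h1.2) h1.1.2 h1.1.1 t h2
  refine ⟨fun k => mix (go k) fun s => dirac (f s), fun k => mix (halt k) fun s => dirac (f s),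
    ⟨fun k => ?_, fun k t ht => ?_⟩, mix_add_left _ _ _, ?_⟩
  · rw [← mix_add_left]
    exact ((hstep k).mono fun s μ h => ⟨hgo k s h.2, h.1⟩).map (r := fun s μ =>
      P s ∧ (T.red s μ ∧ ¬ T.success s)) f fun s μ h => hr s μ h.1 h.2.2 h.2.1
  · obtain ⟨s, h1, h2⟩ := mix_ne_zero.1 ht
    rw [eq_of_dirac_ne_zero h2]
    exact hs s (hgo k s h1)
  · funext t
    exact pair_tsum halt fun s => dirac (f s) t

end Mapping

-- Relabelling the outcomes of an answer

section ReachLemmas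

variable {S : Type u} {T : TestingStructure S} {Y : Type v} {Z : Type w}

theorem Reach.map {b : S} {p : Y → ℝ≥0∞} {G : Y → S → Prop} (h : Reach T b p G)
    (hp : ∀ y, p y ≠ ⊤) (f : Y → Z) {H : Z → S → Prop}
    (hH : ∀ y s, p y ≠ 0 → G y s → H (f y) s) : Reach T b (mix p fun y => dirac (f y)) H := by
  refine h.transport (fun y z => p y * dirac (f y) z) (fun y => ?_) (fun z => rfl) hp
    fun y z s hyz hG => ?_
  · rw [ENNReal.tsum_mul_left, tsum_dirac, mul_one]
  · rw [eq_of_dirac_ne_zero (right_ne_zero_of_mul hyz)]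
    exact hH y s (left_ne_zero_of_mul hyz) hG

end ReachLemmas

end Wireless
namespace Wireless
universe u v w

-- Running a network against a tester

section Composition

variable {C : Sig.{u}} {D : Env C} {K : Set C.Const} {M T L : Net C}

/-- The network `L` in parallel with the system term `N` over the graph `Γ`. -/
def Net.with (Γ : Graph C) (L : Net C) (N : Sys C) : Net C := ⟨L.graph.union Γ, .par L.sys N⟩

/-- The composition of distributions of networks and of system terms over `Γ`. -/
noncomputable def withDist (Γ : Graph C) (μ : PMF (Net C)) (Θ : PMF (Sys C)) : PMF (Net C) :=
  μ.bind fun L => Θ.map (L.with Γ)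

theorem coe_withDist (Γ : Graph C) (μ : PMF (Net C)) (Θ : PMF (Sys C)) :
    ⇑(withDist Γ μ Θ) = mix (tensor ⇑μ ⇑Θ) fun x => dirac (x.1.with Γ x.2) := by
  rw [mix_tensor_iterated, withDist, coe_bind]
  congr 1

theorem map_parDist (g Γ : Graph C) (Δ Θ : PMF (Sys C)) :
    (parDist Δ Θ).map (Net.mk (g.union Γ)) = withDist Γ (Δ.map (Net.mk g)) Θ := by
  simp only [parDist, withDist, PMF.map, PMF.bind_bind, Function.comp_def, PMF.pure_bind]
  rfl

/-- What the networks reachable from `M` have in common. -/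
structure Net.InPLTS (K : Set C.Const) (M L : Net C) : Prop where
  graph_eq : L.graph = M.graph
  names_eq : L.sys.names = M.sys.names
  omegaFree : L.sys.OmegaFree K

/-- The network `M` can be tested by `T`. -/
structure Testable (D : Env C) (K : Set C.Const) (M T : Net C) : Prop where
  closed : ∀ A ∈ K, (D A).OmegaFree K
  isNet_left : M.IsNet
  isNet_right : T.IsNet
  compDefined : M.CompDefined T

theorem Net.InPLTS.mk_map (hL : Net.InPLTS K M L) (hK : ∀ A ∈ K, (D A).OmegaFree K)
    {α : SysAct C} {Δ : PMF (Sys C)} (h : SysStep D L.graph L.sys α Δ) :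
    ∀ L' ∈ (Δ.map (Net.mk L.graph)).support, Net.InPLTS K M L' := by
  intro L' hL'
  obtain ⟨N, hN, rfl⟩ := (PMF.mem_support_map_iff _ _ _).1 hL'
  exact ⟨hL.graph_eq, (h.names_eq N hN).trans hL.names_eq, h.omegaFree hK hL.omegaFree N hN⟩

theorem Net.InPLTS.extStep (hL : Net.InPLTS K M L) (hK : ∀ A ∈ K, (D A).OmegaFree K)
    {lam : ExtAct C} {μ : PMF (Net C)} (h : ExtStep D L lam μ) :
    ∀ L' ∈ μ.support, Net.InPLTS K M L' := by
  cases h with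
  | tau _ h => exact hL.mk_map hK h
  | hidden _ h _ => exact hL.mk_map hK h
  | inp _ h _ => exact hL.mk_map hK h
  | out _ h _ _ => exact hL.mk_map hK h

theorem Net.InPLTS.inp_eq (hL : Net.InPLTS K M L) : L.inp = M.inp := by
  simp only [Net.inp, Net.interface, Sys.nodes, hL.graph_eq, hL.names_eq]

theorem Net.InPLTS.not_success (hL : Net.InPLTS K M L) (hK : ∀ A ∈ K, (D A).OmegaFree K) :
    ¬ L.Success D := fun h =>
  Sys.OmegaFree.not_enabled hK hL.omegaFree ((Sys.success_iff _).1 h)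

/-- Properness enters here: the left component never has ω enabled, now or later. -/
theorem Net.InPLTS.success_with_iff (hL : Net.InPLTS K M L) (hK : ∀ A ∈ K, (D A).OmegaFree K)
    (Γ : Graph C) (N : Sys C) : (netTS D).success (L.with Γ N) ↔ N.Enabled D := by
  change Sys.Success D (.par L.sys N) ↔ _
  rw [Sys.success_iff]
  exact or_iff_right (Sys.OmegaFree.not_enabled hK hL.omegaFree)

theorem Testable.not_mem (h : Testable D K M T) (hL : Net.InPLTS K M L) {n : C.Node}
    (hn : n ∈ L.sys.names) : n ∉ T.graph.verts := fun hn' =>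
  Set.disjoint_left.1 h.compDefined (show n ∈ M.sys.names from hL.names_eq ▸ hn) hn'

theorem Testable.edge_to_left (h : Testable D K M T) (hL : Net.InPLTS K M L) {m n : C.Node}
    (hn : n ∈ L.sys.names) : L.graph.edge m n ↔ (L.graph.union T.graph).edge m n :=
  ⟨Or.inl, fun he => he.resolve_right fun he => h.not_mem hL hn (T.graph.edge_mem _ _ he).2⟩

theorem Testable.not_mem_left (h : Testable D K M T) (hL : Net.InPLTS K M L) {n : C.Node}
    (hn : n ∈ T.sys.names) : n ∉ L.sys.names := fun hn' =>
  h.not_mem hL hn' (h.isNet_right.nodes_subset hn)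

/-- The tester's listeners are thus determined by the audience named in the output action, which is
all that the answering network has to reproduce. -/
theorem Testable.edge_left_right (h : Testable D K M T) (hL : Net.InPLTS K M L) {m n : C.Node}
    (hm : m ∈ L.sys.names) (hn : n ∈ T.sys.names) :
    n ∈ {n | n ∈ L.outp ∧ L.graph.edge m n} ↔ (L.graph.union T.graph).edge m n := by
  constructor
  · exact fun hn' => Or.inl hn'.2
  · intro he
    have he' := he.resolve_right fun he => h.not_mem hL hm (T.graph.edge_mem _ _ he).1
    exact ⟨⟨⟨(L.graph.edge_mem _ _ he').2, h.not_mem_left hL hn⟩, m, he'⟩, he'⟩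

/-- Every edge of a well-formed `M` has an end inside `M`, so its graph adds no connection between
nodes of the tester. The tester's own moves are therefore the same against either network. -/
theorem Testable.edge_right_right (h : Testable D K M T) (hL : Net.InPLTS K M L) {m n : C.Node}
    (hm : m ∈ T.sys.names) (hn : n ∈ T.sys.names) :
    (L.graph.union T.graph).edge m n ↔ T.graph.edge m n := by
  refine ⟨fun he => he.resolve_left fun he => ?_, Or.inr⟩
  rw [hL.graph_eq] at he
  have h1 := h.not_mem_left hL hm
  have h2 := h.not_mem_left hL hn
  rw [hL.names_eq] at h1 h2
  exact (h.isNet_left.conn m n (Or.inl he)).elim h1 h2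

theorem Testable.edge_right_left (h : Testable D K M T) (hL : Net.InPLTS K M L) {m n : C.Node}
    (hm : m ∈ T.sys.names) (hm' : m ∉ L.inp) : ¬ L.graph.edge m n := fun he =>
  hm' ⟨⟨(L.graph.edge_mem _ _ he).1, h.not_mem_left hL hm⟩, n, he⟩

theorem finRed_netTS : FinRed (netTS D) := by
  rintro L μ ⟨Δ, rfl, ⟨m, -, h⟩ | ⟨m, c, v, h⟩⟩ <;> exact finite_support_map _ h.finite_support

/-- A hidden broadcast is internal for the left component but remains a broadcast in the composite,
so the tester has to be deaf to it: an audience inside `L` contains no node of the tester. -/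
theorem Testable.red_of_tau (h : Testable D K M T) (hL : Net.InPLTS K M L) {N : Sys C}
    (hN : N.names = T.sys.names) {μ : PMF (Net C)} (hμ : ExtStep D L .tau μ) :
    (netTS D).red (L.with T.graph N) (withDist T.graph μ (PMF.pure N)) := by
  cases hμ with
  | @tau m Δ _ hΔ =>
    refine ⟨_, (map_parDist _ _ _ _).symm, Or.inl ⟨m, ?_, .tauPropL
      (hΔ.congr_graph fun n hn => h.edge_to_left hL hn)⟩⟩
    exact List.mem_append_left _ (hΔ.loc_mem (by simp))
  | @hidden m c v Δ _ hΔ hhid =>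
    refine ⟨_, (map_parDist _ _ _ _).symm, Or.inr ⟨m, c, v, .syncL
      (hΔ.congr_graph fun n hn => h.edge_to_left hL hn)
      ((hears_pure (η := ∅) c v (by simp)).sysStep fun n hn => ?_)⟩⟩
    have hm : m ∈ L.sys.names := hΔ.loc_mem (by simp)
    rw [hN] at hn
    refine iff_of_false (by simp) fun he => h.not_mem_left hL hn ?_
    exact hhid n ((h.edge_left_right hL hm hn).2 he).2

/-- The tester stands still and must not be successful, since a successful composite may not go on
although the left component alone could. -/
theorem Testable.hyper_with (h : Testable D K M T) {N : Sys C} (hN : N.names = T.sys.names)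
    (hN' : ¬ N.Enabled D) {Δ Θ : Net C → ℝ≥0∞} (hΘ : RHyper (extTS D) Δ Θ)
    (hΔ : ∀ L, Δ L ≠ 0 → Net.InPLTS K M L) :
    RHyper (netTS D) (mix Δ fun L => dirac (L.with T.graph N))
      (mix Θ fun L => dirac (L.with T.graph N)) := by
  refine hΘ.map (fun L => L.with T.graph N) (Net.InPLTS K M)
    (fun L μ hL _ hr => hL.extStep h.closed hr) (fun L μ hL _ hr => ?_)
    (fun L hL hs => hN' ((hL.success_with_iff h.closed _ _).1 hs)) hΔ
  convert h.red_of_tau hL hN hr using 1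
  simp only [withDist, PMF.pure_map]
  rfl

theorem hyper_inPLTS (hK : ∀ A ∈ K, (D A).OmegaFree K) {Δ Θ : Net C → ℝ≥0∞}
    (hΘ : RHyper (extTS D) Δ Θ) (hΔ : ∀ L, Δ L ≠ 0 → Net.InPLTS K M L) :
    ∀ L, Θ L ≠ 0 → Net.InPLTS K M L :=
  hΘ.closed (fun _ _ hL _ hr => hL.extStep hK hr) hΔ

/-- The composite of the second components, unless it is successful. -/
def Composite (D : Env C) (K : Set C.Const) (M T : Net C) (x : Net C × Sys C) (b : Net C) : Prop :=
  (b = x.1.with T.graph x.2 ∧ Net.InPLTS K M x.1 ∧ x.2.names = T.sys.names) ∨ (netTS D).success b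

theorem tsum_tensor_le_one {g : Net C → ℝ≥0∞} (hg : ∑' L, g L ≤ 1) (Θ : PMF (Sys C)) :
    ∑' x, tensor g ⇑Θ x ≤ 1 := by
  rw [tsum_tensor, Θ.tsum_coe, mul_one]
  exact hg

theorem Testable.reach_tau (h : Testable D K M T) (hL : Net.InPLTS K M L) {N : Sys C}
    (hN : N.names = T.sys.names) {Θ : Net C → ℝ≥0∞} (hΘ : RHyper (extTS D) (dirac L) Θ) :
    Reach (netTS D) (L.with T.graph N) (tensor Θ (dirac N)) (Composite D K M T) := by
  by_cases hN' : N.Enabled D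
  · exact Reach.of_success
      (tsum_tensor_le_one (hΘ.mass_le.trans (tsum_dirac L).le) (PMF.pure N))
      fun x _ => Or.inr ((hL.success_with_iff h.closed _ _).2 hN')
  have hdL : ∀ L', dirac L L' ≠ 0 → Net.InPLTS K M L' := fun L' h' => eq_of_dirac_ne_zero h' ▸ hL
  refine Reach.of_hyper (f := fun x => x.1.with T.graph x.2) ?_ fun x hx => ?_
  · have h1 := h.hyper_with hN hN' hΘ hdL
    rw [mix_of_dirac] at h1
    convert h1 using 1
    rw [mix_tensor_iterated]
    congr 1
    funext L'
    exact mix_of_dirac _ _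
  · obtain ⟨h1, h2⟩ := tensor_ne_zero.1 hx
    have h3 : x.2 = N := eq_of_dirac_ne_zero h2
    exact Or.inl ⟨rfl, hyper_inPLTS h.closed hΘ hdL _ h1, h3 ▸ hN⟩

/-- A weak action of the left component with one strong action in the middle, which is turned
into a reduction together with the move `Ξ` of the right component. -/
theorem Testable.reach_hyperStep (h : Testable D K M T) (hL : Net.InPLTS K M L) {N : Sys C}
    (hN : N.names = T.sys.names) {lam : ExtAct C} {Θ : SubDist (Net C)}
    (hΘ : HyperStep D L lam Θ) {Ξ : PMF (Sys C)} (hΞ : Ξ.support.Finite)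
    (hΞN : ∀ N' ∈ Ξ.support, N'.names = N.names)
    (hred : ∀ L' μ, Net.InPLTS K M L' → ExtStep D L' lam μ →
      (netTS D).red (L'.with T.graph N) (withDist T.graph μ Ξ)) :
    Reach (netTS D) (L.with T.graph N) (tensor ⇑Θ ⇑Ξ) (Composite D K M T) := by
  by_cases hN' : N.Enabled D
  · exact Reach.of_success (tsum_tensor_le_one Θ.mass_le_one Ξ)
      fun x _ => Or.inr ((hL.success_with_iff h.closed _ _).2 hN')
  obtain ⟨Δ₁, Δ₂, h1, h2, h3⟩ := hΘ
  obtain ⟨I, _, p, hp, s, Λ, hΛ, rfl, rfl⟩ := h2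
  choose μ hμ hΛμ using hΛ
  obtain rfl : Λ = fun i => SubDist.ofPMF (μ i) := funext hΛμ
  have h1' := (hyper_iff _ _).1 h1
  rw [coe_point] at h1'
  -- After the strong action the tester's term varies from branch to branch, and may be successful
  -- in some of them only. So the last hyper-derivation is cut into one for each state, to be run
  -- against each tester term separately.
  obtain ⟨F, hF, hΘF⟩ := ((hyper_iff _ _).1 h3).split (SubDist.mass_le_one _)
  have hdL : ∀ L', dirac L L' ≠ 0 → Net.InPLTS K M L' := fun L' h' => eq_of_dirac_ne_zero h' ▸ hL
  have hΔ₁ : (SubDist.combine p hp fun i => SubDist.point (s i)).toFun =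
      mix p fun i => dirac (s i) := by
    funext x
    exact (tsum_fintype _).symm
  have hΔ₂ : (SubDist.combine p hp fun i => SubDist.ofPMF (μ i)).toFun =
      mix p fun i => ⇑(μ i) := by
    funext x
    exact (tsum_fintype _).symm
  have hs : ∀ i, p i ≠ 0 → Net.InPLTS K M (s i) := fun i hi => by
    refine hyper_inPLTS h.closed h1' hdL _ ?_
    rw [hΔ₁]
    exact mix_ne_zero.2 ⟨i, hi, by simp [dirac_self]⟩
  have r1 : Reach (netTS D) (L.with T.graph N) p
      fun i b => b = (s i).with T.graph N := by
    refine Reach.of_hyper (f := fun i => (s i).with T.graph N) ?_ fun i _ => rfl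
    have h4 := h.hyper_with hN hN' h1' hdL
    rw [mix_of_dirac, hΔ₁, mix_mix] at h4
    simpa only [mix_of_dirac] using h4
  have r2 := r1.bind finRed_netTS (Set.toFinite _)
    (q := fun i => tensor ⇑(μ i) ⇑Ξ)
    (H := fun x b => b = x.1.with T.graph x.2 ∧ Net.InPLTS K M x.1 ∧ x.2.names = T.sys.names)
    fun i b hi hb => by
      subst hb
      refine Reach.of_hyper (f := fun x => x.1.with T.graph x.2) ?_ fun x hx => ?_
      · rw [← coe_withDist]
        refine RHyper.of_step (RStep.one (hred _ _ (hs i hi) (hμ i))) fun b hb hsucc => ?_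
        rw [eq_of_dirac_ne_zero hb] at hsucc
        exact hN' (((hs i hi).success_with_iff h.closed _ _).1 hsucc)
      · obtain ⟨k1, k2⟩ := tensor_ne_zero.1 hx
        exact ⟨rfl, (hs i hi).extStep h.closed (hμ i) _ k1, (hΞN _ k2).trans hN⟩
  rw [mix_tensor_left, ← hΔ₂] at r2
  have hfin : (mix p fun i => ⇑(μ i)).support.Finite := by
    have hsub : (mix p fun i => ⇑(μ i)).support ⊆
        ⋃ i ∈ p.support, {L | p i ≠ 0 ∧ L ∈ (μ i).support} := fun L' hL' => by
      obtain ⟨i, hi, hi'⟩ := mix_ne_zero.1 hL'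
      exact Set.mem_biUnion (show i ∈ p.support from hi) ⟨hi, hi'⟩
    refine ((Set.toFinite p.support).biUnion fun i hi => ?_).subset hsub
    have := finRed_netTS (D := D) _ _ (hred _ _ (hs i hi) (hμ i))
    rw [withDist, PMF.support_bind] at this
    -- With one tester term fixed, the support of `μ i` embeds in the finite support of the
    -- composite step. The map is injective since all these networks have the graph of `M`, which
    -- the union of graphs alone would not reveal.
    obtain ⟨N₀, hN₀⟩ := Ξ.support_nonempty
    refine Set.Finite.of_finite_image (f := fun L => L.with T.graph N₀)
      (this.subset ?_) ?_
    · rintro _ ⟨L', hL', rfl⟩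
      refine Set.mem_biUnion hL'.2 ?_
      rw [PMF.support_map]
      exact Set.mem_image_of_mem _ hN₀
    · rintro L₁ ⟨_, h₁⟩ L₂ ⟨_, h₂⟩ heq
      have g1 := ((hs i hi).extStep h.closed (hμ i) _ h₁).graph_eq
      have g2 := ((hs i hi).extStep h.closed (hμ i) _ h₂).graph_eq
      cases L₁; cases L₂
      simp only [Net.with, Net.mk.injEq, Sys.par.injEq] at heq g1 g2 ⊢
      exact ⟨g1.trans g2.symm, heq.2.1⟩
  have r3 := r2.bind finRed_netTS (finite_support_tensor (hΔ₂ ▸ hfin) hΞ)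
    (q := fun x => tensor (F x.1) (dirac x.2)) (H := Composite D K M T) fun x b hx hb => by
      obtain ⟨rfl, k1, k2⟩ := hb
      exact h.reach_tau k1 k2 (hF _ (tensor_ne_zero.1 hx).1)
  rw [mix_tensor, mix_dirac, ← hΘF] at r3
  exact r3

/-- A weak output of the left component is turned into a sequence of reductions in which the
right component hears all of the broadcasts. -/
theorem Testable.reach_weakOut (h : Testable D K M T) {c : C.Chan} {v : C.Val} {η : Set C.Node}
    {Θ : SubDist (Net C)} (hΘ : WeakOut D c v L η Θ) (hL : Net.InPLTS K M L) {N : Sys C}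
    (hN : N.names = T.sys.names) {Ξ : PMF (Sys C)} (hΞ : Hears D η c v N Ξ) :
    Reach (netTS D) (L.with T.graph N) (tensor ⇑Θ ⇑Ξ) (Composite D K M T) := by
  induction hΘ generalizing N Ξ with
  | single hΘ =>
    refine h.reach_hyperStep hL hN hΘ hΞ.finite_support hΞ.names_eq fun L' μ hL' hμ => ?_
    cases hμ with
    | @out m _ _ _ Δ _ hΔ hη _ =>
      refine ⟨_, (map_parDist _ _ _ _).symm, Or.inr ⟨m, c, v, .syncL
        (hΔ.congr_graph fun n hn => h.edge_to_left hL' hn) (hΞ.sysStep fun n hn => ?_)⟩⟩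
      rw [hN] at hn
      rw [hη]
      exact h.edge_left_right hL' (hΔ.loc_mem (by simp)) hn
  | @multi L η₁ η₂ Δ' I _ p hp N' Λ _ hΔ' _ hη ih₁ ih₂ =>
    -- The tester hears with the audience of the first weak output, then with that of the second.
    obtain ⟨Ξ₁, κ, k1, k2, rfl⟩ := hΞ.split hη
    have hΔ : Δ'.toFun = mix p fun i => dirac (N' i) := by
      rw [hΔ']
      funext x
      exact (tsum_fintype _).symm
    have r1 := ih₁ hL hN k1
    -- The second weak output is chosen for each index `i`, and equal networks `N' i` may behave
    -- differently, so the first answer is recoupled with the weights `p`.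
    have r2 : Reach (netTS D) (L.with T.graph N) (tensor p ⇑Ξ₁)
        fun x b => Composite D K M T (N' x.1, x.2) b := by
      refine r1.transport
        (fun y x => p x.1 * dirac (N' x.1) y.1 * (Ξ₁ y.2 * dirac y.2 x.2)) ?_ ?_ ?_ ?_
      · rintro ⟨L', N₁⟩
        have := tsum_tensor (fun i => p i * dirac (N' i) L') fun z => Ξ₁ N₁ * dirac N₁ z
        refine this.trans ?_
        rw [ENNReal.tsum_mul_left, tsum_dirac, mul_one]
        change _ = Δ'.toFun L' * Ξ₁ N₁
        rw [hΔ]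
        rfl
      · rintro ⟨i, N₁⟩
        have := tsum_tensor (fun L' => p i * dirac (N' i) L') fun N₂ => Ξ₁ N₂ * dirac N₂ N₁
        refine this.trans ?_
        rw [ENNReal.tsum_mul_left, tsum_dirac, mul_one]
        change p i * mix ⇑Ξ₁ dirac N₁ = p i * Ξ₁ N₁
        rw [mix_dirac]
      · exact ne_top_of_tsum (tsum_tensor_le_one Δ'.mass_le_one Ξ₁)
      · rintro ⟨L', N₁⟩ ⟨i, N₂⟩ b hne hG
        have h1 := eq_of_dirac_ne_zero (right_ne_zero_of_mul (left_ne_zero_of_mul hne))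
        have h2 := eq_of_dirac_ne_zero (right_ne_zero_of_mul (right_ne_zero_of_mul hne))
        dsimp only at h1 h2 ⊢
        rw [← h1, h2]
        exact hG
    have r3 := r2.bind finRed_netTS
      (finite_support_tensor (Set.toFinite _) k1.finite_support)
      (q := fun x => tensor ⇑(Λ x.1) ⇑(κ x.2)) (H := Composite D K M T) fun x b hx hb => by
        -- Where the composite has become successful, nothing remains to be done.
        rcases hb with ⟨rfl, l1, l2⟩ | hb
        · exact ih₂ x.1 l1 l2 (k2 _ (tensor_ne_zero.1 hx).2)
        · exact Reach.of_success (tsum_tensor_le_one (Λ x.1).mass_le_one (κ x.2))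
            fun _ _ => Or.inr hb
    have hcomb : (SubDist.combine p hp Λ).toFun = mix p fun i => ⇑(Λ i) := by
      funext x
      exact (tsum_fintype _).symm
    rw [hcomb, coe_bind]
    have := mix_tensor p ⇑Ξ₁ (fun i => ⇑(Λ i)) fun x => ⇑(κ x)
    rw [← this]
    exact r3

end Composition

end Wireless
namespace Wireless
universe u v w

-- Composites form a may simulation

section MaySimulation

variable {C : Sig.{u}} {D : Env C} {K K' : Set C.Const} {M N T : Net C}

theorem map_parDist_pure (L : Net C) (Γ : Graph C) (Θ : PMF (Sys C)) :
    (parDist (PMF.pure L.sys) Θ).map (Net.mk (L.graph.union Γ)) = withDist Γ (PMF.pure L) Θ := by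
  rw [map_parDist, PMF.pure_map]

/-- The simulation matches weak moves, whereas `IsMaySim` challenges with strong ones. -/
theorem ExtStep.weakStep {L : Net C} {lam : ExtAct C} {μ : PMF (Net C)} (h : ExtStep D L lam μ) :
    WeakStep D L lam (SubDist.ofPMF μ) := by
  have hstep : HyperStep D L lam (SubDist.ofPMF μ) :=
    ⟨SubDist.point L, SubDist.ofPMF μ, (hyper_iff _ _).2 (RHyper.refl _),
      (lift_closed _).point _ _ ⟨μ, h, rfl⟩, (hyper_iff _ _).2 (RHyper.refl _)⟩
  cases lam with
  | tau =>
    refine (hyper_iff _ _).2 (RHyper.of_step (RStep.one h) fun s hs => ?_)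
    rw [eq_of_dirac_ne_zero hs]
    cases h with
    | tau h _ => exact h
    | hidden h _ _ => exact h
  | inp n c v => exact hstep
  | out c v η => exact .single hstep

/-- Two composite networks with the same right component and related left components, or a
successful second network. -/
def CompositeRel (D : Env C) (R : Net C → Net C → Prop) (K K' : Set C.Const) (M N T : Net C)
    (a b : Net C) : Prop :=
  (∃ L L' t, a = Net.with T.graph L t ∧ b = Net.with T.graph L' t ∧ R L L' ∧
    Net.InPLTS K M L ∧ Net.InPLTS K' N L' ∧ t.names = T.sys.names) ∨ (netTS D).success b

/-- If the left component has matched the move `μ` up to `R`, then so have the composites. -/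
theorem Reach.compositeRel {R : Net C → Net C → Prop} {b : Net C} {μ : PMF (Net C)}
    {Θ : SubDist (Net C)} {Ξ : PMF (Sys C)} (hl : Lift (toPoint R) (SubDist.ofPMF μ) Θ)
    (hμ : ∀ L ∈ μ.support, Net.InPLTS K M L)
    (h : Reach (netTS D) b (tensor ⇑Θ ⇑Ξ) (Composite D K' N T)) :
    Reach (netTS D) b ⇑(withDist T.graph μ Ξ) (CompositeRel D R K K' M N T) := by
  obtain ⟨I, _, p, hp, s, Λ, hΛ, h1, h2⟩ := hl
  choose t hR hΛt using hΛ
  obtain rfl : Λ = fun i => SubDist.point (t i) := funext hΛt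
  have h1' : ⇑μ = mix p fun i => dirac (s i) := by
    funext x
    refine (congrArg (fun Δ : SubDist (Net C) => Δ x) h1).trans ?_
    exact (tsum_fintype _).symm
  have h2' : Θ.toFun = mix p fun i => dirac (t i) := by
    rw [h2]
    funext x
    exact (tsum_fintype _).symm
  have hs : ∀ i, p i ≠ 0 → Net.InPLTS K M (s i) := fun i hi => hμ _ <| by
    rw [PMF.mem_support_iff, h1']
    exact mix_ne_zero.2 ⟨i, hi, by simp [dirac_self]⟩
  -- The lifting pairs `s i` with `t i` through a common index; recoupling the answer with the
  -- indices makes it possible to exchange `t i` for `s i`.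
  have r := h.transport (Z := I × Sys C) (q := tensor p ⇑Ξ)
    (H := fun x b => Composite D K' N T (t x.1, x.2) b)
    (fun y x => p x.1 * dirac (t x.1) y.1 * (Ξ y.2 * dirac y.2 x.2)) ?_ ?_
    (ne_top_of_tsum (tsum_tensor_le_one Θ.mass_le_one Ξ)) ?_
  · have r' := r.map (fun x => ?_) (fun x => (s x.1).with T.graph x.2)
      (H := CompositeRel D R K K' M N T) fun x b hx hb => ?_
    · rw [coe_withDist, h1']
      have : tensor (mix p fun i => dirac (s i)) ⇑Ξ =
          mix (tensor p ⇑Ξ) fun x => tensor (dirac (s x.1)) (dirac x.2) := by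
        have e := mix_tensor p ⇑Ξ (fun i => dirac (s i)) dirac
        rw [mix_dirac] at e
        exact e.symm
      rw [this, mix_mix]
      convert r' using 2
      funext x
      rw [mix_tensor_iterated, mix_of_dirac, mix_of_dirac]
    · have h3 : tensor p ⇑Ξ x ≤ 1 * 1 := mul_le_mul'
        ((Finset.single_le_sum (fun _ _ => zero_le) (Finset.mem_univ x.1)).trans hp)
        (PMF.coe_le_one Ξ x.2)
      exact ne_top_of_le_ne_top (by simp) h3
    · rcases hb with ⟨hb, h3, h4⟩ | hb
      · exact Or.inl ⟨s x.1, t x.1, x.2, rfl, hb, hR x.1, hs _ (tensor_ne_zero.1 hx).1, h3, h4⟩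
      · exact Or.inr hb
  · rintro ⟨L', N₁⟩
    have := tsum_tensor (fun i => p i * dirac (t i) L') fun z => Ξ N₁ * dirac N₁ z
    refine this.trans ?_
    rw [ENNReal.tsum_mul_left, tsum_dirac, mul_one]
    change _ = Θ.toFun L' * Ξ N₁
    rw [h2']
    rfl
  · rintro ⟨i, N₁⟩
    have := tsum_tensor (fun L' => p i * dirac (t i) L') fun N₂ => Ξ N₂ * dirac N₂ N₁
    refine this.trans ?_
    rw [ENNReal.tsum_mul_left, tsum_dirac, mul_one]
    change p i * mix ⇑Ξ dirac N₁ = p i * Ξ N₁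
    rw [mix_dirac]
  · rintro ⟨L', N₁⟩ ⟨i, N₂⟩ b hne hG
    have h3 := eq_of_dirac_ne_zero (right_ne_zero_of_mul (left_ne_zero_of_mul hne))
    have h4 := eq_of_dirac_ne_zero (right_ne_zero_of_mul (right_ne_zero_of_mul hne))
    dsimp only at h3 h4 ⊢
    rw [← h3, h4]
    exact hG

/-- A move of the right component alone. -/
theorem reach_right {R : Net C → Net C → Prop} {L L' : Net C} (hR : R L L')
    (hL : Net.InPLTS K M L) (hL' : Net.InPLTS K' N L') {t : Sys C}
    (hs : ¬ (netTS D).success (L'.with T.graph t)) {Ξ : PMF (Sys C)}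
    (hΞ : ∀ t' ∈ Ξ.support, t'.names = T.sys.names)
    (hred : (netTS D).red (L'.with T.graph t) (withDist T.graph (PMF.pure L') Ξ)) :
    Reach (netTS D) (L'.with T.graph t) ⇑(withDist T.graph (PMF.pure L) Ξ)
      (CompositeRel D R K K' M N T) := by
  have hmap : ∀ L₀ : Net C, ⇑(withDist T.graph (PMF.pure L₀) Ξ) =
      mix ⇑Ξ fun t' => dirac (L₀.with T.graph t') := fun L₀ => by
    rw [withDist, PMF.pure_bind, coe_map]
  have r : Reach (netTS D) (L'.with T.graph t) ⇑Ξ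
      fun t' b => b = L'.with T.graph t' := by
    refine Reach.of_hyper (f := fun t' => L'.with T.graph t') ?_ fun _ _ => rfl
    rw [← hmap]
    refine RHyper.of_step (RStep.one hred) fun b hb => ?_
    rwa [eq_of_dirac_ne_zero hb]
  rw [hmap]
  exact r.map (PMF.apply_ne_top Ξ) _ fun t' b ht' hb =>
    Or.inl ⟨L, L', t', rfl, hb, hR, hL, hL', hΞ t' ht'⟩

/-- Each composite step is read as an extensional action of `L` together with a move of the tester,
or as a move of the tester alone. In the first case the simulation supplies a weak action of `L'`,
which is played against the same move of the tester. -/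
theorem isMaySim_compositeRel {R : Net C → Net C → Prop} (hR : IsDFDeadlockSim D R)
    (hM : Testable D K M T) (hN : Testable D K' N T) (hinp : M.inp = N.inp) :
    IsMaySim (netTS D) (CompositeRel D R K K' M N T) where
  success := by
    rintro a b (⟨L, L', t, rfl, rfl, -, hL, hL', -⟩ | hb) ha
    · exact (hL'.success_with_iff hN.closed _ _).2 ((hL.success_with_iff hM.closed _ _).1 ha)
    · exact hb
  step := by
    rintro a b μ (⟨L, L', t, rfl, rfl, hLL', hL, hL', ht⟩ | hb) ha hred
    swap
    · exact Reach.of_success μ.tsum_coe.le fun _ _ => Or.inr hb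
    have hb : ¬ (netTS D).success (L'.with T.graph t) := fun h =>
      ha ((hL.success_with_iff hM.closed _ _).2 ((hL'.success_with_iff hN.closed _ _).1 h))
    have hns := hL.not_success hM.closed
    have key : ∀ (lam : ExtAct C) (ν : PMF (Net C)) (Ξ : PMF (Sys C)), ExtStep D L lam ν →
        (∀ Θ, WeakStep D L' lam Θ →
          Reach (netTS D) (L'.with T.graph t) (tensor ⇑Θ ⇑Ξ) (Composite D K' N T)) →
        Reach (netTS D) (L'.with T.graph t) ⇑(withDist T.graph ν Ξ)
          (CompositeRel D R K K' M N T) := by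
      intro lam ν Ξ hν h
      obtain ⟨Θ, h1, h2⟩ := hR.step L L' hLL' lam _ hν.weakStep
      exact Reach.compositeRel h2 (hL.extStep hM.closed hν) (h Θ h1)
    have hkt : ∀ ν, ExtStep D L .tau ν →
        Reach (netTS D) (L'.with T.graph t) ⇑(withDist T.graph ν (PMF.pure t))
          (CompositeRel D R K K' M N T) := fun ν hν =>
      key .tau ν (PMF.pure t) hν fun Θ hΘ => hN.reach_tau hL' ht ((hyper_iff _ _).1 hΘ)
    have hleft : ∀ {α : SysAct C} {Δ : PMF (Sys C)},
        SysStep D (L.graph.union T.graph) L.sys α Δ → SysStep D L.graph L.sys α Δ :=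
      fun h => h.congr_graph fun n hn => (hM.edge_to_left hL hn).symm
    have hright : ∀ {α : SysAct C} {Δ : PMF (Sys C)}, α.loc ∈ T.sys.names →
        SysStep D (L.graph.union T.graph) t α Δ → SysStep D (L'.graph.union T.graph) t α Δ :=
      fun hm h => h.congr_graph fun n hn => by
        rw [ht] at hn
        rw [hM.edge_right_right hL hm hn, hN.edge_right_right hL' hm hn]
    obtain ⟨Δ, rfl, ⟨m, -, hΔ⟩ | ⟨m, c, v, hΔ⟩⟩ := hred
    · cases hΔ with
      | tauPropL hΔ =>
        have := hkt _ (.tau hns (hleft hΔ))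
        rwa [← map_parDist] at this
      | @tauPropR _ _ _ Ξ hΔ =>
        have hm : m ∈ T.sys.names := ht ▸ hΔ.loc_mem (by simp)
        have hΔ' := hright (α := .tau m) hm hΔ
        have := reach_right hLL' hL hL' hb (fun t' h' => (hΔ.names_eq t' h').trans ht)
          ⟨_, (map_parDist_pure L' T.graph Ξ).symm, Or.inl ⟨m, List.mem_append_right _
            (show m ∈ t.names from ht ▸ hm), .tauPropR hΔ'⟩⟩
        rwa [← map_parDist_pure] at this
    · cases hΔ with
      | @syncL _ _ _ _ _ Δ Ξ hΔ hΞ =>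
        have hm : m ∈ L.sys.names := hΔ.loc_mem (by simp)
        have hΞ' : Hears D {n | n ∈ L.outp ∧ L.graph.edge m n} c v t Ξ :=
          hΞ.hears fun n hn => hM.edge_left_right hL hm (ht ▸ hn)
        -- Without external listeners the broadcast is no output action but an internal move, and
        -- the tester stays unchanged.
        by_cases hη : {n | n ∈ L.outp ∧ L.graph.edge m n}.Nonempty
        · have := key _ _ Ξ (.out hns (hleft hΔ) rfl hη) fun Θ hΘ =>
            hN.reach_weakOut hΘ hL' ht hΞ'
          rwa [← map_parDist] at this
        · rw [Set.not_nonempty_iff_eq_empty] at hη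
          obtain rfl := hΞ'.eq_pure fun n _ => by simp [hη]
          have := hkt _ (.hidden hns (hleft hΔ) fun n hn => ?_)
          · rwa [← map_parDist] at this
          · by_contra hn'
            exact Set.eq_empty_iff_forall_notMem.1 hη n
              ⟨⟨⟨(L.graph.edge_mem _ _ hn).2, hn'⟩, m, hn⟩, hn⟩
      | @syncR _ _ _ _ _ Δ Ξ hΔ hΞ =>
        have hm : m ∈ T.sys.names := ht ▸ hΞ.loc_mem (by simp)
        have hΞ' := hright (α := .send m c v) hm hΞ
        have hnames : ∀ t' ∈ Ξ.support, t'.names = t.names := hΞ.names_eq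
        -- A sender that is not an input node of `L` is not heard by it. Equality of the input nodes
        -- makes `L'` just as deaf, so this is a move of the tester alone.
        by_cases hin : m ∈ L.inp
        · have := key _ _ Ξ (.inp hns (hleft hΔ) hin) fun Θ hΘ =>
            hN.reach_hyperStep hL' ht hΘ hΞ.finite_support hnames fun L₁ μ hL₁ hμ => by
              cases hμ with
              | inp _ hΔ₁ _ =>
                refine ⟨_, (map_parDist _ _ _ _).symm, Or.inr ⟨m, c, v, .syncR
                  (hΔ₁.congr_graph fun n hn => hN.edge_to_left hL₁ hn)
                  (hΞ'.congr_graph fun n _ => ?_)⟩⟩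
                change (L'.graph.union T.graph).edge _ _ ↔ (L₁.graph.union T.graph).edge _ _
                rw [hL₁.graph_eq, hL'.graph_eq]
          rwa [← map_parDist] at this
        · have hin' : m ∉ L'.inp := by
            rwa [hL'.inp_eq, ← hinp, ← hL.inp_eq]
          obtain rfl := ((hleft hΔ).hears (η := ∅) fun n _ =>
            iff_of_false (by simp) (hM.edge_right_left hL hm hin)).eq_pure (by simp)
          have := reach_right hLL' hL hL' hb (fun t' h' => (hnames t' h').trans ht)
            ⟨_, (map_parDist_pure L' T.graph Ξ).symm, Or.inr ⟨m, c, v, .syncR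
              ((hears_pure (η := ∅) c v (by simp)).sysStep fun n hn => iff_of_false (by simp)
                fun he => hN.edge_right_left hL' hm hin' ((hN.edge_to_left hL' hn).2 he)) hΞ'⟩⟩
          rwa [← map_parDist_pure] at this

end MaySimulation

end Wireless
-- Simulation implies the may preorder
theorem theorem6p12 (C : Wireless.Sig) (D : Wireless.Env C) (M N : Wireless.Net C)
    (hM : M.IsNet) (hN : N.IsNet)
    (hMconv : Wireless.Convergent D M) (hNconv : Wireless.Convergent D N)
    (hMproper : Wireless.Proper D M) (hNproper : Wireless.Proper D N)
    (hinp : M.inp = N.inp) (houtp : M.outp = N.outp)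
    (hsim : Wireless.DFDeadlockSim D M N) :
    Wireless.MayLE D M N := by
  obtain ⟨K, hK, hMK⟩ := hMproper
  obtain ⟨K', hK', hNK⟩ := hNproper
  obtain ⟨R, hR, hMN⟩ := hsim
  refine ⟨hM, hN, hinp, houtp, fun T hT hMT hNT => ?_⟩
  exact (Wireless.isMaySim_compositeRel hR ⟨hK, hM, hT, hMT⟩ ⟨hK', hN, hT, hNT⟩ hinp).hoareLE
    Wireless.finRed_netTS (Or.inl ⟨M, N, T.sys, rfl, rfl, hMN, ⟨rfl, rfl, hMK⟩, ⟨rfl, rfl, hNK⟩, rfl⟩)
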